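/- Let $\mathbb F$ be an algebraically closed field of characteristic $0$, let $\mathfrak g$ be a finite-dimensional simple Lie algebra over $\mathbb F$ with a non-degenerate symmetric invariant bilinear form $(\cdot\,|\,\cdot)$, and let $f\in\mathfrak g$ be a minimal nilpotent element, i.e. a lowest root vector of $\mathfrak g$. Let $\{f,2x,e\}\subset\mathfrak g$ be an $\mathfrak{sl}_2$-triple and, for $i\in\frac12\mathbb Z$, let $\mathfrak g_i$ be the $\operatorname{ad}x$-eigenspace of eigenvalue $i$, so that $\mathfrak g=\mathbb Ff\oplus\mathfrak g_{-\frac12}\oplus\mathfrak g_0\oplus\mathfrak g_{\frac12}\oplus\mathbb Fe$. Let $\mathfrak g_0^f$ be the centralizer of $f$ in $\mathfrak g_0$; for $a\in\mathfrak g_0=\mathfrak g_0^f\oplus\mathbb Fx$ let $a^\sharp=a-\frac{(a|x)}{(x|x)}x$ be its component in $\mathfrak g_0^f$. Put $\omega_-(u,u_1)=(e|[u,u_1])$ for $u,u_1\in\mathfrak g_{-\frac12}$ and $\omega_+(v,v_1)=(f|[v,v_1])$ for $v,v_1\in\mathfrak g_{\frac12}$. Let $\mathcal V(\mathfrak g)=S(\mathbb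 F[\partial]\mathfrak g)$ be the algebra of differential polynomials over $\mathfrak g$ and, for $z\in\mathbb F$, endow it with the Poisson vertex algebra $\lambda$-bracket that extends $$\{a_\lambda b\}_z=[a,b]+(a|b)\lambda+z(e|[a,b]),\qquad a,b\in\mathfrak g,$$ by sesquilinearity and the Leibniz rules, i.e. for a basis $\{u_j\}_{j\in J}$ of $\mathfrak g$ and $H_{ji}(\lambda)=\{u_i{}_\lambda u_j\}_z$, $$\{g_\lambda h\}_z=\sum_{i,j\in J,\;m,n\ge0}\frac{\partial h}{\partial u_j^{(n)}}(\lambda+\partial)^nH_{ji}(\lambda+\partial)(-\lambda-\partial)^m\frac{\partial g}{\partial u_i^{(m)}}.$$ Let $\rho:\mathcal V(\mathfrak g)\to\mathcal V(\mathfrak g_{\le\frac12})$ be the differential algebra homomorphism with $\rho(a)=\pi_{\le\frac12}(a)+(f|a)$ for $a\in\mathfrak g$, where $\pi_{\le\frac12}$ is the projection of $\mathfrak g$ onto $\mathfrak g_{\le\frac12}=\bigoplus_{i\le\frac12}\mathfrak g_i$ with kernel $\mathfrak g_{\geq1}$. The classical $\mathcal W$-algebra (with the choice $s=e$) is $$\mathcal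 W=\{g\in\mathcal V(\mathfrak g_{\le\frac12})\mid\rho\{a_\lambda g\}_z=0\text{ for all }a\in\mathfrak g_{\ge\frac12}\},\qquad\{g_\lambda h\}_{z,\rho}=\rho\{g_\lambda h\}_z\quad(g,h\in\mathcal W).$$ Let $\{a_j\},\{a^j\}$ be bases of $\mathfrak g_0$ with $(a_i|a^j)=\delta_{ij}$, let $\{v_k\},\{v^k\}$ be bases of $\mathfrak g_{\frac12}$ with $\omega_+(v_h,v^k)=\delta_{hk}$, and let $\{c_i\},\{c^i\}$ be bases of $\mathfrak g_0^f$ with $(c_i|c^j)=\delta_{ij}$. Define $$L=f+\partial x+\tfrac12\sum_ja_ja^j+\sum_kv^k[f,v_k]+\tfrac12\sum_kv^k\partial v_k,$$ $$\varphi(a)=a+\tfrac12\sum_k[a,v_k]v^k\quad(a\in\mathfrak g_0^f),$$ $$\psi(u)=u+\tfrac13\sum_{h,k}[[u,v_h],v_k]v^hv^k+\sum_k[u,v_k]v^k+\partial[e,u]\quad(u\in\mathfrak g_{-\frac12}),$$ $$\tilde L=L-\tfrac12\sum_i\varphi(c_i)\varphi(c^i).$$ **Theorem.** For every $z\in\mathbb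 F$, the elements $L$, $\varphi(a)$ ($a\in\mathfrak g_0^f$) and $\psi(u)$ ($u\in\mathfrak g_{-\frac12}$) belong to $\mathcal W$ and generate it as a differential algebra, and for all $a,b\in\mathfrak g_0^f$ and $u,u_1\in\mathfrak g_{-\frac12}$ their $\lambda$-brackets are $$\{L_\lambda L\}_{z,\rho}=(\partial+2\lambda)L-(x|x)\lambda^3+4(x|x)z\lambda,$$ $$\{L_\lambda\varphi(b)\}_{z,\rho}=(\partial+\lambda)\varphi(b),\qquad\{L_\lambda\psi(u_1)\}_{z,\rho}=\big(\partial+\tfrac32\lambda\big)\psi(u_1),$$ $$\{\varphi(a)_\lambda L\}_{z,\rho}=\lambda\varphi(a),\qquad\{\varphi(a)_\lambda\varphi(b)\}_{z,\rho}=\varphi([a,b])+(a|b)\lambda,\qquad\{\varphi(a)_\lambda\psi(u_1)\}_{z,\rho}=\psi([a,u_1]),$$ $$\{\psi(u)_\lambda L\}_{z,\rho}=\big(\tfrac12\partial+\tfrac32\lambda\big)\psi(u),\qquad\{\psi(u)_\lambda\varphi(b)\}_{z,\rho}=\psi([u,b]),$$ $$\{\psi(u)_\lambda\psi(u_1)\}_{z,\rho}=\sum_k\varphi([u,v^k]^\sharp)\varphi([u_1,v_k]^\sharp)+(\partial+2\lambda)\varphi([u,[e,u_1]]^\sharp)+\frac{\omega_-(u,u_1)}{2(x|x)}\tilde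 L-\lambda^2\omega_-(u,u_1)+z\,\omega_-(u,u_1).$$ In particular, for every $z\in\mathbb F$, $L$ is an energy-momentum element of $\mathcal W$ (that is, $\{L_\lambda L\}_{z,\rho}=(\partial+2\lambda)L+c\lambda^3+\alpha\lambda$ with $c,\alpha\in\mathbb F$, and $\mathcal W$ has a basis over $\mathbb F$ consisting of elements $w$ with $\{L_\lambda w\}_{z,\rho}=(\partial+\Delta_w\lambda)w+O(\lambda^2)$ for some $\Delta_w\in\mathbb F$); every $\varphi(a)$ is primary of conformal weight $1$, i.e. $\{L_\lambda\varphi(a)\}_{z,\rho}=(\partial+\lambda)\varphi(a)$; and every $\psi(u)$ is primary of conformal weight $\frac32$, i.e. $\{L_\lambda\psi(u)\}_{z,\rho}=(\partial+\frac32\lambda)\psi(u)$. -/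

import Mathlib

open scoped Polynomial

namespace ClassicalW

noncomputable section

/-! ### Algebras of differential polynomials -/

section DiffPoly

variable {F J : Type*} [Field F]

/-- The algebra of differential polynomials `F[u_j^(n) | j ∈ J, n ≥ 0]`;
the pair `(j, n)` stands for the variable `u_j^(n)`. -/
abbrev DiffPoly (J F : Type*) [Field F] : Type _ := MvPolynomial (J × ℕ) F

/-- The derivation `∂` of the algebra of differential polynomials, `∂ u_j^(n) = u_j^(n+1)`. -/
def der : Derivation F (DiffPoly J F) (DiffPoly J F) :=
  MvPolynomial.mkDerivation F fun p => MvPolynomial.X (p.1, p.2 + 1)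

/-- The operator `∂ + λ` on `V[λ]`, where `∂` acts on coefficients. The variable `λ` is the
polynomial variable `Polynomial.X`. -/
def lamDer : (DiffPoly J F)[X] →ₗ[F] (DiffPoly J F)[X] :=
  Polynomial.lsum (fun n =>
      ((Polynomial.monomial n).restrictScalars F) ∘ₗ (der (F := F) (J := J)).toLinearMap)
    + LinearMap.mulLeft F Polynomial.X

/-- A constant of the ground field, as an element of `V[λ]`. -/
def cst (c : F) : (DiffPoly J F)[X] := Polynomial.C (MvPolynomial.C c)

/-- The element `(r ∂ + Δ λ) a` of `V[λ]`. -/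
def derLam (r Δ : F) (a : DiffPoly J F) : (DiffPoly J F)[X] :=
  Polynomial.C (r • der a) + Polynomial.C (Δ • a) * Polynomial.X

/-- `a` is an eigenvector for `L` of conformal weight `Δ`:
`{L_λ a} = (∂ + Δ λ) a + O(λ²)`. -/
def IsEigenvector (br : DiffPoly J F → DiffPoly J F → (DiffPoly J F)[X])
    (L : DiffPoly J F) (Δ : F) (a : DiffPoly J F) : Prop :=
  ∃ r : (DiffPoly J F)[X], br L a = derLam 1 Δ a + Polynomial.X ^ 2 * r

/-- `a` is primary for `L` of conformal weight `Δ`: `{L_λ a} = (∂ + Δ λ) a`. -/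
def IsPrimary (br : DiffPoly J F → DiffPoly J F → (DiffPoly J F)[X])
    (L : DiffPoly J F) (Δ : F) (a : DiffPoly J F) : Prop :=
  br L a = derLam 1 Δ a

/-- `L` is a Virasoro element: `{L_λ L} = (∂ + 2 λ) L + c λ³ + α λ` with `c, α ∈ F`. -/
def IsVirasoro (br : DiffPoly J F → DiffPoly J F → (DiffPoly J F)[X])
    (L : DiffPoly J F) : Prop :=
  ∃ c α : F, br L L = derLam 1 2 L + cst c * Polynomial.X ^ 3 + cst α * Polynomial.X

/-- `L` is an energy-momentum element of the subalgebra `W` with `λ`-bracket `br`: it is a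
Virasoro element of `W`, and `W` has a basis over `F` consisting of eigenvectors for `L`. -/
def IsEnergyMomentum (W : Subalgebra F (DiffPoly J F))
    (br : DiffPoly J F → DiffPoly J F → (DiffPoly J F)[X]) (L : DiffPoly J F) : Prop :=
  L ∈ W ∧ IsVirasoro br L ∧
    ∃ S : Set (DiffPoly J F), LinearIndepOn F id S ∧
      Submodule.span F S = Subalgebra.toSubmodule W ∧
      ∀ a ∈ S, ∃ Δ : F, IsEigenvector br L Δ a

end DiffPoly

section Lie

variable {F 𝔤 J : Type*} [Field F] [LieRing 𝔤] [LieAlgebra F 𝔤]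

/-! ### The grading and minimal nilpotent elements -/

/-- The `ad x`-eigenspace `𝔤_i`. -/
def grade (F : Type*) {𝔤 : Type*} [Field F] [LieRing 𝔤] [LieAlgebra F 𝔤]
    (x : 𝔤) (i : ℚ) : Submodule F 𝔤 :=
  Module.End.eigenspace (LieAlgebra.ad F 𝔤 x) (i : F)

/-- `𝔤_{≥ 1/2}`, the sum of the eigenspaces `𝔤_i` with `i ≥ 1/2`. -/
def gradeGeHalf (F : Type*) {𝔤 : Type*} [Field F] [LieRing 𝔤] [LieAlgebra F 𝔤]
    (x : 𝔤) : Submodule F 𝔤 :=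
  ⨆ (i : ℚ) (_ : 1 / 2 ≤ i), grade F x i

/-- `𝔤_0^f`, the centralizer of `f` in `𝔤_0`. -/
def gradeZeroCentralizer (F : Type*) {𝔤 : Type*} [Field F] [LieRing 𝔤] [LieAlgebra F 𝔤]
    (x f : 𝔤) : Submodule F 𝔤 :=
  grade F x 0 ⊓ LinearMap.ker (LieAlgebra.ad F 𝔤 f : 𝔤 →ₗ[F] 𝔤)

/-- `f` is a minimal nilpotent element of the simple Lie algebra `𝔤`: for some Cartan subalgebra
and some base of its root system, `f` is a non-zero root vector for the lowest root `θ`, i.e. the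
root `θ` such that `β - θ` is a sum of simple roots for every root `β`. -/
def IsMinimalNilpotent (F : Type*) {𝔤 : Type*} [Field F] [IsAlgClosed F] [CharZero F]
    [LieRing 𝔤] [LieAlgebra F 𝔤] [FiniteDimensional F 𝔤] [LieAlgebra.IsSimple F 𝔤]
    (f : 𝔤) : Prop :=
  ∃ (H : LieSubalgebra F 𝔤) (_ : H.IsCartanSubalgebra)
    (b : (LieAlgebra.IsKilling.rootSystem H).Base) (θ : H.root),
    (∀ β : H.root,
      (LieAlgebra.IsKilling.rootSystem H).root β - (LieAlgebra.IsKilling.rootSystem H).root θ ∈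
        AddSubmonoid.closure ((LieAlgebra.IsKilling.rootSystem H).root '' b.support)) ∧
    f ∈ LieAlgebra.rootSpace H (θ : LieModule.Weight F H 𝔤) ∧ f ≠ 0

/-! ### The affine Poisson vertex algebra `V(𝔤)`

For a basis `u` of `𝔤` indexed by `J`, `V(𝔤) = S(F[∂] 𝔤)` is `DiffPoly J F`. -/

/-- The inclusion of `𝔤` in `V(𝔤)`. -/
def emb (u : Module.Basis J F 𝔤) : 𝔤 →ₗ[F] DiffPoly J F :=
  u.constr F fun j => MvPolynomial.X (j, 0)

/-- The operator `H_{ji}(∂ + λ)` on `V(𝔤)[λ]`, where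
`H_{ji}(λ) = {u_i _λ u_j}_z = [u_i, u_j] + (u_i | u_j) λ + z (s | [u_i, u_j])`. -/
def genOp (B : LinearMap.BilinForm F 𝔤) (u : Module.Basis J F 𝔤) (s : 𝔤) (z : F) (i j : J) :
    (DiffPoly J F)[X] →ₗ[F] (DiffPoly J F)[X] :=
  LinearMap.mulLeft F (Polynomial.C (emb u ⁅u i, u j⁆) + cst (z * B s ⁅u i, u j⁆))
    + B (u i) (u j) • lamDer

/-- The `λ`-bracket `{g _λ h}_z` of `V(𝔤)`, given by the master formula
`∑ ∂h/∂u_j^(n) (∂ + λ)^n H_{ji}(∂ + λ) (-λ - ∂)^m ∂g/∂u_i^(m)`,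
where `p = (i, m)` runs over the variables of `g` and `q = (j, n)` over those of `h` (the other
partial derivatives vanish). -/
def lamBracket (B : LinearMap.BilinForm F 𝔤) (u : Module.Basis J F 𝔤) (s : 𝔤) (z : F)
    (g h : DiffPoly J F) : (DiffPoly J F)[X] :=
  ∑ q ∈ h.vars, ∑ p ∈ g.vars,
    Polynomial.C (MvPolynomial.pderiv q h) *
      (lamDer ^ q.2) (genOp B u s z p.1 q.1
        (((-lamDer) ^ p.2) (Polynomial.C (MvPolynomial.pderiv p g))))

/-! ### The classical W-algebra

The basis `u` consists of `ad x`-eigenvectors, `u j` having eigenvalue `deg j`. -/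

/-- The differential subalgebra `V(𝔤_{≤ 1/2})` of `V(𝔤)`. -/
def VLeHalf (F : Type*) {J : Type*} [Field F] (deg : J → ℚ) : Subalgebra F (DiffPoly J F) :=
  MvPolynomial.supported F {p : J × ℕ | deg p.1 ≤ 1 / 2}

/-- The differential algebra homomorphism `ρ` with `ρ(a) = π_{≤ 1/2}(a) + (f | a)` for `a ∈ 𝔤`. -/
def rho (B : LinearMap.BilinForm F 𝔤) (u : Module.Basis J F 𝔤) (deg : J → ℚ) (f : 𝔤) :
    DiffPoly J F →ₐ[F] DiffPoly J F :=
  MvPolynomial.aeval fun p : J × ℕ =>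
    (⇑(der (F := F) (J := J)))^[p.2]
      ((if deg p.1 ≤ 1 / 2 then MvPolynomial.X (p.1, 0) else 0)
        + MvPolynomial.C (B f (u p.1)))

/-- `{g _λ h}_{z,ρ} = ρ {g _λ h}_z`. -/
def rhoBracket (B : LinearMap.BilinForm F 𝔤) (u : Module.Basis J F 𝔤) (deg : J → ℚ)
    (f s : 𝔤) (z : F) (g h : DiffPoly J F) : (DiffPoly J F)[X] :=
  (lamBracket B u s z g h).map (rho B u deg f : DiffPoly J F →+* DiffPoly J F)

lemma lamBracket_eq_sum (B : LinearMap.BilinForm F 𝔤) (u : Module.Basis J F 𝔤) (s : 𝔤) (z : F)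
    (g h : DiffPoly J F) (T : Finset (J × ℕ)) (hT : h.vars ⊆ T) :
    lamBracket B u s z g h = ∑ q ∈ T, ∑ p ∈ g.vars,
      Polynomial.C (MvPolynomial.pderiv q h) *
        (lamDer ^ q.2) (genOp B u s z p.1 q.1
          (((-lamDer) ^ p.2) (Polynomial.C (MvPolynomial.pderiv p g)))) := by
  refine Finset.sum_subset hT fun q _ hq => ?_
  simp [MvPolynomial.pderiv_eq_zero_of_notMem_vars hq]

lemma lamBracket_add (B : LinearMap.BilinForm F 𝔤) (u : Module.Basis J F 𝔤) (s : 𝔤) (z : F)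
    (g h k : DiffPoly J F) :
    lamBracket B u s z g (h + k) = lamBracket B u s z g h + lamBracket B u s z g k := by
  classical
  rw [lamBracket_eq_sum B u s z g (h + k) (h.vars ∪ k.vars) (MvPolynomial.vars_add_subset _ _),
    lamBracket_eq_sum B u s z g h (h.vars ∪ k.vars) Finset.subset_union_left,
    lamBracket_eq_sum B u s z g k (h.vars ∪ k.vars) Finset.subset_union_right]
  simp only [map_add, add_mul, Finset.sum_add_distrib]

lemma lamBracket_mul (B : LinearMap.BilinForm F 𝔤) (u : Module.Basis J F 𝔤) (s : 𝔤) (z : F)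
    (g h k : DiffPoly J F) :
    lamBracket B u s z g (h * k) =
      Polynomial.C h * lamBracket B u s z g k + Polynomial.C k * lamBracket B u s z g h := by
  classical
  rw [lamBracket_eq_sum B u s z g (h * k) (h.vars ∪ k.vars) (MvPolynomial.vars_mul _ _),
    lamBracket_eq_sum B u s z g h (h.vars ∪ k.vars) Finset.subset_union_left,
    lamBracket_eq_sum B u s z g k (h.vars ∪ k.vars) Finset.subset_union_right]
  simp only [Derivation.leibniz, smul_eq_mul, map_add, map_mul, add_mul, Finset.sum_add_distrib,
    Finset.mul_sum, mul_assoc]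

/-- The classical W-algebra: the algebra of all `g ∈ V(𝔤_{≤ 1/2})` such that
`ρ {a _λ g}_z = 0` for all `a ∈ 𝔤_{≥ 1/2}`. -/
def WAlg (B : LinearMap.BilinForm F 𝔤) (u : Module.Basis J F 𝔤) (deg : J → ℚ)
    (x f s : 𝔤) (z : F) : Subalgebra F (DiffPoly J F) where
  carrier := {g | g ∈ VLeHalf F deg ∧
    ∀ a ∈ gradeGeHalf F x, rhoBracket B u deg f s z (emb u a) g = 0}
  add_mem' := by
    rintro g h ⟨hg, hg'⟩ ⟨hh, hh'⟩
    refine ⟨add_mem hg hh, fun a ha => ?_⟩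
    have h1 := hg' a ha
    have h2 := hh' a ha
    simp only [rhoBracket] at h1 h2 ⊢
    rw [lamBracket_add, Polynomial.map_add, h1, h2, add_zero]
  mul_mem' := by
    rintro g h ⟨hg, hg'⟩ ⟨hh, hh'⟩
    refine ⟨mul_mem hg hh, fun a ha => ?_⟩
    have h1 := hg' a ha
    have h2 := hh' a ha
    simp only [rhoBracket] at h1 h2 ⊢
    rw [lamBracket_mul, Polynomial.map_add, Polynomial.map_mul, Polynomial.map_mul, h1, h2,
      mul_zero, mul_zero, add_zero]
  algebraMap_mem' := by
    intro r
    refine ⟨Subalgebra.algebraMap_mem _ r, fun a _ => ?_⟩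
    simp [rhoBracket, lamBracket, MvPolynomial.algebraMap_eq]

/-! ### The generators -/

/-- The skew-symmetric form `ω_-(u, u₁) = (e | [u, u₁])` on `𝔤_{-1/2}`. -/
def omegaMinus (B : LinearMap.BilinForm F 𝔤) (e w w₁ : 𝔤) : F := B e ⁅w, w₁⁆

/-- The skew-symmetric form `ω_+(v, v₁) = (f | [v, v₁])` on `𝔤_{1/2}`. -/
def omegaPlus (B : LinearMap.BilinForm F 𝔤) (f v v₁ : 𝔤) : F := B f ⁅v, v₁⁆

/-- For `a ∈ 𝔤_0 = 𝔤_0^f ⊕ F x`, the component `a^♯ = a - (a | x) / (x | x) x` of `a` in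
`𝔤_0^f`. -/
def sharp (B : LinearMap.BilinForm F 𝔤) (x a : 𝔤) : 𝔤 := a - (B a x / B x x) • x

variable {J₀ J₁ K : Type*} [Fintype J₀] [Fintype J₁] [Fintype K]

/-- `L = f + x' + 1/2 ∑ a_j a^j + ∑ v^k [f, v_k] + 1/2 ∑ v^k ∂ v_k`. -/
def genL (u : Module.Basis J F 𝔤) (x f : 𝔤) (a a' : J₀ → 𝔤) (v v' : J₁ → 𝔤) : DiffPoly J F :=
  emb u f + der (emb u x)
    + (1 / 2 : F) • ∑ j, emb u (a j) * emb u (a' j)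
    + ∑ k, emb u (v' k) * emb u ⁅f, v k⁆
    + (1 / 2 : F) • ∑ k, emb u (v' k) * der (emb u (v k))

/-- `φ(a) = a + 1/2 ∑ [a, v_k] v^k`. -/
def genPhi (u : Module.Basis J F 𝔤) (v v' : J₁ → 𝔤) (a : 𝔤) : DiffPoly J F :=
  emb u a + (1 / 2 : F) • ∑ k, emb u ⁅a, v k⁆ * emb u (v' k)

/-- `ψ(w) = w + 1/3 ∑ [[w, v_h], v_k] v^h v^k + ∑ [w, v_k] v^k + ∂ [e, w]`. -/
def genPsi (u : Module.Basis J F 𝔤) (e : 𝔤) (v v' : J₁ → 𝔤) (w : 𝔤) : DiffPoly J F :=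
  emb u w
    + (1 / 3 : F) • ∑ h, ∑ k, emb u ⁅⁅w, v h⁆, v k⁆ * emb u (v' h) * emb u (v' k)
    + ∑ k, emb u ⁅w, v k⁆ * emb u (v' k)
    + der (emb u ⁅e, w⁆)

/-- `L̃ = L - 1/2 ∑ φ(c_i) φ(c^i)`, for dual bases `c_i`, `c^i` of `𝔤_0^f`. -/
def genLTilde (u : Module.Basis J F 𝔤) (x f : 𝔤) (a a' : J₀ → 𝔤) (v v' : J₁ → 𝔤)
    (c c' : K → 𝔤) : DiffPoly J F :=
  genL u x f a a' v v' - (1 / 2 : F) • ∑ i, genPhi u v v' (c i) * genPhi u v v' (c' i)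

end Lie

end

end ClassicalW

/-!
Everything rests on three facts about `V(𝔤)`: the `λ`-bracket given by the master formula obeys the
Leibniz rules and sesquilinearity, it is skew-symmetric (`lamBracket_skew`), and it satisfies the
Jacobi identity with an element of `𝔤` in the first place (`jacobi`). The Lie algebra enters
through the grading: a lowest root vector satisfies `[f, [f, y]] ∈ F f` for all `y`, hence
`𝔤 = F f ⊕ 𝔤_{-1/2} ⊕ 𝔤_0 ⊕ 𝔤_{1/2} ⊕ F e`, with `𝔤_0 = 𝔤_0^f ⊕ F x` and with bijections `ad e`,
`ad f` between `𝔤_{-1/2}` and `𝔤_{1/2}` (`isMinimalGrading`).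

That `L`, `φ(b)`, `ψ(w)` lie in `W` is a direct computation of `ρ {p _λ ·}` for `p ∈ 𝔤_{1/2}` and
`p = e`, using expansions in the dual bases (`DualBases.genL_mem` and its companions). They generate
`W` for the following reason (`DualBases.adjoin_genSet_eq`). Modulo lower terms, `L`, `φ(b)`, `ψ(w)`
are `f`, `b`, `w`, so together with `x` and `𝔤_{1/2}` they generate the differential algebra
`V(𝔤_{≤ 1/2})`. The coefficients of `ρ {e _λ ·}` and `ρ {v _λ ·}`, `v ∈ 𝔤_{1/2}`, are derivations
which vanish on the generators and for which the remaining variables `x⁽ⁿ⁾`, `v⁽ⁿ⁾` form a system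
of slices `E_i y_j = δ_{ij}`. In characteristic `0`, the elements killed by such derivations
are those that do not involve the `y_j` (`mem_of_derivation_eq_zero`).

The `λ`-brackets are not computed from the expressions of the generators. Let `σ` be the
homomorphism of differential algebras `V(𝔤) → W` with `f ↦ L̃`, `w ↦ ψ(w)`, `b ↦ φ(b)`, `x ↦ 0`,
`𝔤_{1/2} ↦ 0` and `e ↦ (f | e)`. It satisfies `σ ρ = σ` and is the identity on the generators, hence
on `W`. Since `W` is closed under `ρ {· _λ ·}` by the Jacobi identity
(`IsMinimalGrading.coeff_rhoBracket_mem`), `ρ {g _λ h} = σ {g _λ h}` for `g, h ∈ W`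
(`DualBases.rhoBracket_eq_retract`). On the right-hand side, all summands of the Leibniz rule with
a factor in `𝔤_{1/2}` disappear, as does `σ {g _λ v}` for `g ∈ W` and `v ∈ 𝔤_{1/2}`. Together with
skew-symmetry this reduces each bracket of generators to brackets of elements of `𝔤`.

Finally, the eigenvectors for `L` in `W` are closed under products and derivatives, and they
include `L + 2 (x | x) z`, `φ(b)` and `ψ(w)`, so they span `W`.
-/

open scoped Polynomial

namespace ClassicalW

set_option linter.unusedSectionVars false

/-! ### The operator `∂ + λ` -/

section DifferentialAlgebra

variable {F J : Type*} [Field F]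

/-- An `F`-linear map of `V` applied to the coefficients of an element of `V[λ]`. -/
noncomputable def coeffMap (D : DiffPoly J F →ₗ[F] DiffPoly J F) :
    (DiffPoly J F)[X] →ₗ[F] (DiffPoly J F)[X] :=
  Polynomial.lsum (fun n => ((Polynomial.monomial n).restrictScalars F) ∘ₗ D)

@[simp]
lemma coeffMap_monomial (D : DiffPoly J F →ₗ[F] DiffPoly J F) (n : ℕ) (a : DiffPoly J F) :
    coeffMap D (Polynomial.monomial n a) = Polynomial.monomial n (D a) := by
  simp [coeffMap, Polynomial.lsum_apply]

@[simp]
lemma coeffMap_C (D : DiffPoly J F →ₗ[F] DiffPoly J F) (a : DiffPoly J F) :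
    coeffMap D (Polynomial.C a) = Polynomial.C (D a) := by
  rw [← Polynomial.monomial_zero_left, coeffMap_monomial, Polynomial.monomial_zero_left]

lemma coeff_coeffMap (D : DiffPoly J F →ₗ[F] DiffPoly J F) (p : (DiffPoly J F)[X]) (n : ℕ) :
    (coeffMap D p).coeff n = D (p.coeff n) := by
  induction p using Polynomial.induction_on' with
  | add p q hp hq => simp [hp, hq]
  | monomial k a =>
    rw [coeffMap_monomial, Polynomial.coeff_monomial, Polynomial.coeff_monomial]
    split_ifs <;> simp

lemma coeffMap_X_mul (D : DiffPoly J F →ₗ[F] DiffPoly J F) (p : (DiffPoly J F)[X]) :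
    coeffMap D (Polynomial.X * p) = Polynomial.X * coeffMap D p := by
  ext1 n
  cases n <;> simp [coeff_coeffMap]

lemma coeffMap_C_mul (D : Derivation F (DiffPoly J F) (DiffPoly J F)) (a : DiffPoly J F)
    (p : (DiffPoly J F)[X]) :
    coeffMap D.toLinearMap (Polynomial.C a * p) =
      Polynomial.C (D a) * p + Polynomial.C a * coeffMap D.toLinearMap p := by
  ext1 n
  rw [coeff_coeffMap, Polynomial.coeff_add, Polynomial.coeff_C_mul, Polynomial.coeff_C_mul,
    Polynomial.coeff_C_mul, coeff_coeffMap, Derivation.coeFn_coe, Derivation.leibniz, smul_eq_mul,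
    smul_eq_mul]
  ring

lemma lamDer_apply (p : (DiffPoly J F)[X]) :
    lamDer p = coeffMap (der (F := F) (J := J)).toLinearMap p + Polynomial.X * p := rfl

@[simp]
lemma lamDer_C (a : DiffPoly J F) :
    lamDer (Polynomial.C a) = Polynomial.C (der a) + Polynomial.C a * Polynomial.X := by
  rw [lamDer_apply, coeffMap_C, mul_comm, Derivation.coeFn_coe]

lemma lamDer_X_mul (p : (DiffPoly J F)[X]) :
    lamDer (Polynomial.X * p) = Polynomial.X * lamDer p := by
  rw [lamDer_apply, lamDer_apply, coeffMap_X_mul]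
  ring

lemma lamDer_mul_X (p : (DiffPoly J F)[X]) :
    lamDer (p * Polynomial.X) = lamDer p * Polynomial.X := by
  rw [mul_comm, lamDer_X_mul, mul_comm]

lemma lamDer_mul_X_pow (p : (DiffPoly J F)[X]) (n : ℕ) :
    lamDer (p * Polynomial.X ^ n) = lamDer p * Polynomial.X ^ n := by
  induction n with
  | zero => simp
  | succ n ih => rw [pow_succ, ← mul_assoc, lamDer_mul_X, ih, mul_assoc]

lemma lamDer_C_mul (a : DiffPoly J F) (p : (DiffPoly J F)[X]) :
    lamDer (Polynomial.C a * p) =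
      Polynomial.C (der a) * p + Polynomial.C a * lamDer p := by
  rw [lamDer_apply, lamDer_apply, coeffMap_C_mul]
  ring

@[simp]
lemma der_C (c : F) : der (J := J) (MvPolynomial.C c) = 0 := MvPolynomial.derivation_C _ c

lemma lamDer_cst_mul (c : F) (p : (DiffPoly J F)[X]) : lamDer (cst c * p) = cst c * lamDer p := by
  rw [cst, lamDer_C_mul, der_C, map_zero, zero_mul, zero_add]

lemma lamDer_cst (c : F) : lamDer (cst (J := J) c) = cst c * Polynomial.X := by
  rw [cst, lamDer_C, der_C, map_zero, zero_add]

lemma cst_mul_eq_smul (c : F) (p : (DiffPoly J F)[X]) : cst c * p = c • p := by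
  rw [cst, ← MvPolynomial.algebraMap_eq]
  exact (Algebra.smul_def c p).symm

lemma coeffMap_der_lamDer (p : (DiffPoly J F)[X]) :
    coeffMap (der (F := F) (J := J)).toLinearMap (lamDer p) =
      lamDer (coeffMap (der (F := F) (J := J)).toLinearMap p) := by
  rw [lamDer_apply, lamDer_apply, map_add, coeffMap_X_mul]

@[simp]
lemma der_X (j : J) (n : ℕ) :
    der (F := F) (MvPolynomial.X (j, n)) = MvPolynomial.X (j, n + 1) :=
  MvPolynomial.mkDerivation_X _ _ _

lemma iterate_der_X (j : J) (n : ℕ) :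
    (⇑(der (F := F) (J := J)))^[n] (MvPolynomial.X (j, 0)) = MvPolynomial.X (j, n) := by
  induction n with
  | zero => rfl
  | succ n ih => rw [Function.iterate_succ_apply', ih, der_X]

/-- Induction for differential polynomials: it suffices to treat constants and the variables
`u_j`, provided the property passes to sums, products and derivatives. -/
lemma diffPoly_induction {P : DiffPoly J F → Prop} (g : DiffPoly J F)
    (hC : ∀ c, P (MvPolynomial.C c)) (hX : ∀ j, P (MvPolynomial.X (j, 0)))
    (hadd : ∀ g h, P g → P h → P (g + h)) (hmul : ∀ g h, P g → P h → P (g * h))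
    (hder : ∀ g, P g → P (der g)) : P g := by
  have hX' : ∀ j n, P (MvPolynomial.X (j, n)) := fun j n => by
    induction n with
    | zero => exact hX j
    | succ n ih => rw [← der_X]; exact hder _ ih
  induction g using MvPolynomial.induction_on with
  | C c => exact hC c
  | add p q hp hq => exact hadd _ _ hp hq
  | mul_X p n hp => exact hmul _ _ hp (hX' n.1 n.2)

/-! ### The adjoint of a differential operator -/

/-- The substitution `λ ↦ -λ - ∂` with `∂` acting to the right, `∑ pₙ λⁿ ↦ ∑ (-λ - ∂)ⁿ pₙ`. It
takes the symbol of a differential operator to that of its formal adjoint. -/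
noncomputable def adj : (DiffPoly J F)[X] →ₗ[F] (DiffPoly J F)[X] :=
  Polynomial.lsum (fun n =>
    ((-lamDer) ^ n) ∘ₗ (Polynomial.CAlgHom (R := F) (A := DiffPoly J F)).toLinearMap)

lemma adj_monomial (n : ℕ) (a : DiffPoly J F) :
    adj (Polynomial.monomial n a) = ((-lamDer) ^ n) (Polynomial.C a) := by
  simp [adj, Polynomial.lsum_apply]

@[simp]
lemma adj_C (a : DiffPoly J F) : adj (Polynomial.C a) = Polynomial.C a := by
  rw [← Polynomial.monomial_zero_left, adj_monomial]; rfl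

lemma adj_X_mul (p : (DiffPoly J F)[X]) : adj (Polynomial.X * p) = -lamDer (adj p) := by
  induction p using Polynomial.induction_on' with
  | add p q hp hq => rw [mul_add, map_add, hp, hq, map_add, map_add, neg_add]
  | monomial n a =>
    rw [Polynomial.X_mul_monomial, adj_monomial, adj_monomial, pow_succ', Module.End.mul_apply]
    rfl

lemma adj_mul_X (p : (DiffPoly J F)[X]) : adj (p * Polynomial.X) = -lamDer (adj p) := by
  rw [mul_comm, adj_X_mul]

lemma neg_lamDer_pow_coeffMap (n : ℕ) (p : (DiffPoly J F)[X]) :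
    ((-lamDer) ^ n) (coeffMap (der (F := F) (J := J)).toLinearMap p) =
      coeffMap (der (F := F) (J := J)).toLinearMap (((-lamDer) ^ n) p) := by
  induction n with
  | zero => rfl
  | succ n ih =>
    rw [pow_succ', Module.End.mul_apply, Module.End.mul_apply, ih, LinearMap.neg_apply,
      LinearMap.neg_apply, map_neg, coeffMap_der_lamDer]

lemma adj_coeffMap (p : (DiffPoly J F)[X]) :
    adj (coeffMap (der (F := F) (J := J)).toLinearMap p) =
      coeffMap (der (F := F) (J := J)).toLinearMap (adj p) := by
  induction p using Polynomial.induction_on' with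
  | add p q hp hq => rw [map_add, map_add, hp, hq, map_add, map_add]
  | monomial n a =>
    rw [coeffMap_monomial, adj_monomial, adj_monomial, ← neg_lamDer_pow_coeffMap, coeffMap_C]

lemma adj_lamDer (p : (DiffPoly J F)[X]) : adj (lamDer p) = -(Polynomial.X * adj p) := by
  rw [lamDer_apply, map_add, adj_coeffMap, adj_X_mul, lamDer_apply]
  ring

lemma lamDer_pow_X_mul (n : ℕ) (p : (DiffPoly J F)[X]) :
    (lamDer ^ n) (Polynomial.X * p) = Polynomial.X * (lamDer ^ n) p := by
  induction n with
  | zero => rfl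
  | succ n ih => rw [pow_succ', Module.End.mul_apply, ih, lamDer_X_mul]; rfl

lemma neg_lamDer_pow_X_mul (n : ℕ) (p : (DiffPoly J F)[X]) :
    ((-lamDer) ^ n) (Polynomial.X * p) = Polynomial.X * ((-lamDer) ^ n) p := by
  induction n with
  | zero => rfl
  | succ n ih =>
    rw [pow_succ', Module.End.mul_apply, ih, Module.End.mul_apply, LinearMap.neg_apply,
      lamDer_X_mul, LinearMap.neg_apply]
    ring

/-- The formal adjoint of `a ∘ (-∂)ᵐ ∘ b` is `b ∘ ∂ᵐ ∘ a`. -/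
lemma adj_mul_neg_lamDer_pow (m : ℕ) (a b : DiffPoly J F) :
    adj (Polynomial.C a * ((-lamDer) ^ m) (Polynomial.C b)) =
      Polynomial.C b * (lamDer ^ m) (Polynomial.C a) := by
  induction m generalizing a with
  | zero =>
    rw [pow_zero, pow_zero, Module.End.one_apply, Module.End.one_apply, ← map_mul, adj_C, map_mul,
      mul_comm]
  | succ m ih =>
    have h1 : Polynomial.C a * ((-lamDer) ^ (m + 1)) (Polynomial.C b) =
        Polynomial.C (der a) * ((-lamDer) ^ m) (Polynomial.C b) -
          lamDer (Polynomial.C a * ((-lamDer) ^ m) (Polynomial.C b)) := by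
      rw [lamDer_C_mul, pow_succ', Module.End.mul_apply, LinearMap.neg_apply]
      ring
    rw [h1, map_sub, adj_lamDer, ih, ih, pow_succ, Module.End.mul_apply, lamDer_C, map_add,
      mul_comm (Polynomial.C a), lamDer_pow_X_mul]
    ring

/-- The formal adjoint of `a ∘ ∂ⁿ ∘ w ∘ (-∂)ᵐ ∘ b` is `b ∘ ∂ᵐ ∘ w ∘ (-∂)ⁿ ∘ a`. -/
lemma adj_mul_lamDer_pow (n m : ℕ) (a b w : DiffPoly J F) :
    adj (Polynomial.C a * (lamDer ^ n) (Polynomial.C w * ((-lamDer) ^ m) (Polynomial.C b))) =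
      Polynomial.C b * (lamDer ^ m) (Polynomial.C w * ((-lamDer) ^ n) (Polynomial.C a)) := by
  induction n generalizing a with
  | zero =>
    rw [pow_zero, pow_zero, Module.End.one_apply, Module.End.one_apply, ← mul_assoc, ← map_mul,
      adj_mul_neg_lamDer_pow, mul_comm a w, map_mul]
  | succ n ih =>
    set q := (lamDer ^ n) (Polynomial.C w * ((-lamDer) ^ m) (Polynomial.C b)) with hq
    have h1 : Polynomial.C a * (lamDer ^ (n + 1))
          (Polynomial.C w * ((-lamDer) ^ m) (Polynomial.C b)) =
        lamDer (Polynomial.C a * q) - Polynomial.C (der a) * q := by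
      rw [lamDer_C_mul, pow_succ', Module.End.mul_apply, ← hq]
      ring
    have h2 : Polynomial.C w * ((-lamDer) ^ (n + 1)) (Polynomial.C a) =
        -(Polynomial.C w * ((-lamDer) ^ n) (Polynomial.C (der a))
          + Polynomial.X * (Polynomial.C w * ((-lamDer) ^ n) (Polynomial.C a))) := by
      rw [pow_succ, Module.End.mul_apply, LinearMap.neg_apply, lamDer_C, map_neg, map_add,
        mul_comm (Polynomial.C a), neg_lamDer_pow_X_mul]
      ring
    rw [h1, map_sub, adj_lamDer, ih, ih, h2, map_neg, map_add, lamDer_pow_X_mul]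
    ring

/-! ### Homomorphisms of differential algebras -/

/-- The homomorphism of differential algebras with `u_j ↦ y_j`. -/
noncomputable def diffHom (y : J → DiffPoly J F) : DiffPoly J F →ₐ[F] DiffPoly J F :=
  MvPolynomial.aeval fun p : J × ℕ => (⇑(der (F := F) (J := J)))^[p.2] (y p.1)

@[simp]
lemma diffHom_X_zero (y : J → DiffPoly J F) (j : J) :
    diffHom y (MvPolynomial.X (j, 0)) = y j := by
  simp [diffHom]

@[simp]
lemma diffHom_C (y : J → DiffPoly J F) (c : F) :
    diffHom y (MvPolynomial.C c) = MvPolynomial.C c := by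
  simp [diffHom, MvPolynomial.algebraMap_eq]

lemma diffHom_der (y : J → DiffPoly J F) (g : DiffPoly J F) :
    diffHom y (der g) = der (diffHom y g) := by
  induction g using MvPolynomial.induction_on with
  | C c => simp
  | add p q hp hq => simp only [map_add, hp, hq]
  | mul_X p n hp =>
    have hX : diffHom y (der (MvPolynomial.X n)) = der (diffHom y (MvPolynomial.X n)) := by
      obtain ⟨j, n⟩ := n
      simp [diffHom, Function.iterate_succ_apply', -Function.iterate_succ]
    simp only [Derivation.leibniz, map_add, map_mul, smul_eq_mul, hp, hX]

lemma diffHom_iterate_der (y : J → DiffPoly J F) (g : DiffPoly J F) (n : ℕ) :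
    diffHom y ((⇑(der (F := F) (J := J)))^[n] g) =
      (⇑(der (F := F) (J := J)))^[n] (diffHom y g) := by
  induction n with
  | zero => rfl
  | succ n ih => rw [Function.iterate_succ_apply', diffHom_der, ih, Function.iterate_succ_apply']

/-- A homomorphism of differential algebras applied to the coefficients of an element of `V[λ]`. -/
noncomputable abbrev diffHomPoly (y : J → DiffPoly J F) :
    (DiffPoly J F)[X] →+* (DiffPoly J F)[X] :=
  Polynomial.mapRingHom (diffHom y : DiffPoly J F →+* DiffPoly J F)

lemma diffHomPoly_cst (y : J → DiffPoly J F) (c : F) : diffHomPoly y (cst c) = cst c := by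
  simp [cst]

lemma diffHomPoly_C (y : J → DiffPoly J F) (g : DiffPoly J F) :
    diffHomPoly y (Polynomial.C g) = Polynomial.C (diffHom y g) := by
  simp

lemma diffHomPoly_smul (y : J → DiffPoly J F) (c : F) (p : (DiffPoly J F)[X]) :
    diffHomPoly y (c • p) = c • diffHomPoly y p := by
  rw [← cst_mul_eq_smul, map_mul, diffHomPoly_cst, cst_mul_eq_smul]

lemma diffHomPoly_lamDer (y : J → DiffPoly J F) (p : (DiffPoly J F)[X]) :
    diffHomPoly y (lamDer p) = lamDer (diffHomPoly y p) := by
  ext1 n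
  cases n <;>
  simp [lamDer_apply, coeff_coeffMap, diffHom_der]

lemma diffHomPoly_neg_lamDer_pow (y : J → DiffPoly J F) (n : ℕ) (p : (DiffPoly J F)[X]) :
    diffHomPoly y (((-lamDer) ^ n) p) = ((-lamDer) ^ n) (diffHomPoly y p) := by
  induction n with
  | zero => rfl
  | succ n ih =>
    rw [pow_succ', Module.End.mul_apply, LinearMap.neg_apply, map_neg, diffHomPoly_lamDer, ih]
    rfl

lemma diffHomPoly_adj (y : J → DiffPoly J F) (p : (DiffPoly J F)[X]) :
    diffHomPoly y (adj p) = adj (diffHomPoly y p) := by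
  induction p using Polynomial.induction_on' with
  | add p q hp hq => rw [map_add, map_add, hp, hq, map_add, map_add]
  | monomial n a =>
    rw [adj_monomial, diffHomPoly_neg_lamDer_pow, diffHomPoly_C, Polynomial.coe_mapRingHom,
      Polynomial.map_monomial, adj_monomial]
    rfl

/-! ### Shifts of the spectral parameter -/

lemma taylor_lamDer (c : F) (p : (DiffPoly J F)[X]) :
    Polynomial.taylor (MvPolynomial.C c) (lamDer p) =
      lamDer (Polynomial.taylor (MvPolynomial.C c) p)
        + c • Polynomial.taylor (MvPolynomial.C c) p := by
  have key : ∀ q : (DiffPoly J F)[X], Polynomial.taylor (MvPolynomial.C c)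
      (coeffMap (der (F := F) (J := J)).toLinearMap q) =
      coeffMap (der (F := F) (J := J)).toLinearMap (Polynomial.taylor (MvPolynomial.C c) q) := by
    intro q
    induction q using Polynomial.induction_on with
    | C a => simp
    | add p q hp hq => simp only [map_add, hp, hq]
    | monomial n a ih =>
      have h1 : Polynomial.C a * Polynomial.X ^ (n + 1)
        = Polynomial.X * (Polynomial.C a * Polynomial.X ^ n) := by ring
      rw [h1, coeffMap_X_mul, Polynomial.taylor_mul, Polynomial.taylor_mul, ih,
        Polynomial.taylor_X, add_mul, add_mul, map_add, coeffMap_X_mul, coeffMap_C_mul]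
      simp
  rw [lamDer_apply, lamDer_apply, map_add, key, Polynomial.taylor_mul, Polynomial.taylor_X,
    ← cst_mul_eq_smul, cst]
  ring

lemma adj_taylor (c : F) (p : (DiffPoly J F)[X]) :
    Polynomial.taylor (MvPolynomial.C c) (adj (Polynomial.taylor (MvPolynomial.C c) p)) =
      adj p := by
  induction p using Polynomial.induction_on with
  | C a => simp
  | add p q hp hq => simp only [map_add, hp, hq]
  | monomial n a ih =>
    have h1 : Polynomial.C a * Polynomial.X ^ (n + 1)
      = Polynomial.X * (Polynomial.C a * Polynomial.X ^ n) := by ring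
    rw [h1, Polynomial.taylor_mul, Polynomial.taylor_X, add_mul, map_add, adj_X_mul, map_add,
      map_neg, taylor_lamDer, ih, adj_X_mul]
    have h2 := cst_mul_eq_smul c
      (Polynomial.taylor (MvPolynomial.C c) (Polynomial.C a * Polynomial.X ^ n))
    rw [cst] at h2
    rw [h2, map_smul, ← cst_mul_eq_smul, ← cst_mul_eq_smul, cst,
      Polynomial.taylor_mul (MvPolynomial.C c) (Polynomial.C _), ih, Polynomial.taylor_C]
    ring

end DifferentialAlgebra

/-! ### Properties of the affine `λ`-bracket -/

section AffineBracket

variable {F 𝔤 J : Type*} [Field F] [LieRing 𝔤] [LieAlgebra F 𝔤]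
  (B : LinearMap.BilinForm F 𝔤) (u : Module.Basis J F 𝔤) (s : 𝔤) (z : F)

/-- Induction on elements of `𝔤` in terms of a basis. -/
lemma basis_induction {P : 𝔤 → Prop} (a : 𝔤) (basis : ∀ j, P (u j))
    (add : ∀ a b, P a → P b → P (a + b)) (smul : ∀ (r : F) a, P a → P (r • a))
    (zero : P 0) : P a := by
  have ha : a ∈ Submodule.span F (Set.range u) := by rw [u.span_eq]; trivial
  induction ha using Submodule.span_induction with
  | mem y hy => obtain ⟨j, rfl⟩ := hy; exact basis j
  | zero => exact zero
  | add a b _ _ ha hb => exact add a b ha hb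
  | smul r a _ ha => exact smul r a ha

@[simp]
lemma emb_basis (j : J) : emb u (u j) = MvPolynomial.X (j, 0) := by
  simp [emb]

lemma genOp_apply (i j : J) (p : (DiffPoly J F)[X]) :
    genOp B u s z i j p =
      Polynomial.C (emb u ⁅u i, u j⁆ + MvPolynomial.C (z * B s ⁅u i, u j⁆)) * p
        + B (u i) (u j) • lamDer p := by
  rw [map_add]; rfl

@[simp]
lemma lamBracket_C (g : DiffPoly J F) (c : F) :
    lamBracket B u s z g (MvPolynomial.C c) = 0 := by
  simp [lamBracket]

lemma lamBracket_smul (g h : DiffPoly J F) (c : F) :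
    lamBracket B u s z g (c • h) = c • lamBracket B u s z g h := by
  rw [MvPolynomial.smul_eq_C_mul, lamBracket_mul, lamBracket_C, mul_zero, add_zero,
    ← cst_mul_eq_smul, cst]

lemma lamBracket_sum {ι : Type*} (t : Finset ι) (g : DiffPoly J F) (h : ι → DiffPoly J F) :
    lamBracket B u s z g (∑ i ∈ t, h i) = ∑ i ∈ t, lamBracket B u s z g (h i) := by
  classical
  induction t using Finset.induction_on with
  | empty => simpa using lamBracket_C B u s z g 0
  | insert a t ha ih => rw [Finset.sum_insert ha, Finset.sum_insert ha, lamBracket_add, ih]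

lemma lamBracket_X (g : DiffPoly J F) (j : J) (n : ℕ) :
    lamBracket B u s z g (MvPolynomial.X (j, n)) =
      (lamDer ^ n) (∑ p ∈ g.vars,
        genOp B u s z p.1 j (((-lamDer) ^ p.2) (Polynomial.C (MvPolynomial.pderiv p g)))) := by
  rw [lamBracket, MvPolynomial.vars_X, Finset.sum_singleton, map_sum]
  refine Finset.sum_congr rfl fun p _ => ?_
  rw [MvPolynomial.pderiv_X_self, map_one, one_mul]

/-- Sesquilinearity in the second argument, `{g _λ ∂h} = (λ + ∂) {g _λ h}`. -/
lemma lamBracket_der (g h : DiffPoly J F) :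
    lamBracket B u s z g (der h) = lamDer (lamBracket B u s z g h) := by
  induction h using MvPolynomial.induction_on with
  | C c => simpa using lamBracket_C B u s z g 0
  | add p q hp hq => rw [map_add, lamBracket_add, hp, hq, lamBracket_add, map_add]
  | mul_X p n hp =>
    obtain ⟨j, n⟩ := n
    have hX : lamBracket B u s z g (der (MvPolynomial.X (j, n))) =
        lamDer (lamBracket B u s z g (MvPolynomial.X (j, n))) := by
      rw [der_X, lamBracket_X, lamBracket_X, pow_succ', Module.End.mul_apply]
    rw [Derivation.leibniz, smul_eq_mul, smul_eq_mul, lamBracket_add, lamBracket_mul,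
      lamBracket_mul, lamBracket_mul, hp, hX, map_add, lamDer_C_mul, lamDer_C_mul]
    ring

/-- Skew-symmetry of the summands of the master formula: the operator with symbol `H_{ij}` is minus
the formal adjoint of the one with symbol `H_{ji}`. -/
lemma adj_genOp (hB : B.IsSymm) (n m : ℕ) (i j : J) (a b : DiffPoly J F) :
    adj (Polynomial.C a *
        (lamDer ^ n) (genOp B u s z i j (((-lamDer) ^ m) (Polynomial.C b)))) =
      -(Polynomial.C b *
        (lamDer ^ m) (genOp B u s z j i (((-lamDer) ^ n) (Polynomial.C a)))) := by
  have h1 : ∀ (k l : ℕ) (c : DiffPoly J F),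
      (lamDer ^ k) (lamDer (((-lamDer) ^ l) (Polynomial.C c))) =
        (lamDer ^ (k + 1)) (Polynomial.C 1 * ((-lamDer) ^ l) (Polynomial.C c)) := by
    intro k l c
    rw [map_one, one_mul, pow_succ, Module.End.mul_apply]
  have h2 : adj (Polynomial.C a *
        (lamDer ^ n) (lamDer (((-lamDer) ^ m) (Polynomial.C b)))) =
      -(Polynomial.C b *
        (lamDer ^ m) (lamDer (((-lamDer) ^ n) (Polynomial.C a)))) := by
    rw [h1, adj_mul_lamDer_pow, map_one, one_mul, pow_succ', Module.End.mul_apply,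
      LinearMap.neg_apply, map_neg]
    ring
  have h3 : emb u ⁅u j, u i⁆ + MvPolynomial.C (z * B s ⁅u j, u i⁆) =
      -(emb u ⁅u i, u j⁆ + MvPolynomial.C (z * B s ⁅u i, u j⁆)) := by
    rw [← lie_skew (u j) (u i), map_neg, map_neg, mul_neg, map_neg]
    ring
  rw [genOp_apply, genOp_apply, h3]
  generalize emb u ⁅u i, u j⁆ + MvPolynomial.C (z * B s ⁅u i, u j⁆) = w
  have h4 : B (u j) (u i) = B (u i) (u j) := hB.eq (u j) (u i)
  have h5 : Polynomial.C (-w) * ((-lamDer) ^ n) (Polynomial.C a) =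
      -(Polynomial.C w * ((-lamDer) ^ n) (Polynomial.C a)) := by
    rw [map_neg]
    ring
  rw [map_add, map_add, mul_add, mul_add, map_add, map_smul, map_smul,
    mul_smul_comm, mul_smul_comm, map_smul, h2, adj_mul_lamDer_pow, h4, h5, map_neg, smul_neg]
  ring

/-- Skew-symmetry of the `λ`-bracket, `{h _λ g} = -{g _{-λ-∂} h}`. -/
lemma lamBracket_skew (hB : B.IsSymm) (g h : DiffPoly J F) :
    lamBracket B u s z h g = -adj (lamBracket B u s z g h) := by
  rw [lamBracket, lamBracket, map_sum, Finset.sum_comm, ← Finset.sum_neg_distrib]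
  refine Finset.sum_congr rfl fun q _ => ?_
  rw [map_sum, ← Finset.sum_neg_distrib]
  refine Finset.sum_congr rfl fun p _ => ?_
  rw [adj_genOp B u s z hB, neg_neg]

lemma lamBracket_add_left (hB : B.IsSymm) (g h k : DiffPoly J F) :
    lamBracket B u s z (g + h) k = lamBracket B u s z g k + lamBracket B u s z h k := by
  rw [lamBracket_skew B u s z hB k, lamBracket_skew B u s z hB k g,
    lamBracket_skew B u s z hB k h, lamBracket_add, map_add, neg_add]

lemma lamBracket_smul_left (hB : B.IsSymm) (g h : DiffPoly J F) (c : F) :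
    lamBracket B u s z (c • g) h = c • lamBracket B u s z g h := by
  rw [lamBracket_skew B u s z hB h, lamBracket_skew B u s z hB h g, lamBracket_smul, map_smul,
    smul_neg]

/-- The `λ`-bracket of two elements of `𝔤`, `[a, b] + (a | b) λ + z (s | [a, b])`. -/
lemma lamBracket_emb (hB : B.IsSymm) (a b : 𝔤) :
    lamBracket B u s z (emb u a) (emb u b) =
      Polynomial.C (emb u ⁅a, b⁆ + MvPolynomial.C (z * B s ⁅a, b⁆))
        + cst (B a b) * Polynomial.X := by
  have hCs : ∀ (r : F) (y : 𝔤), MvPolynomial.C (σ := J × ℕ) (z * B s (r • y)) =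
      r • MvPolynomial.C (z * B s y) := by
    intro r y
    rw [map_smul, smul_eq_mul, MvPolynomial.smul_eq_C_mul, ← map_mul]
    congr 1; ring
  have hcst : ∀ r t : F, cst (J := J) (r * t) = r • cst t := by
    intro r t
    rw [← cst_mul_eq_smul, cst, cst, cst, ← map_mul, ← map_mul]
  induction a using basis_induction u with
  | zero =>
    rw [map_zero, ← zero_smul F (0 : DiffPoly J F), lamBracket_smul_left B u s z hB]
    simp [cst]
  | smul r a ha =>
    rw [map_smul, lamBracket_smul_left B u s z hB, ha, smul_lie, map_smul, hCs, map_smul,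
      LinearMap.smul_apply, smul_eq_mul, hcst, ← smul_add, ← Polynomial.smul_C, smul_mul_assoc,
      smul_add]
  | add a a' ha ha' =>
    rw [map_add, lamBracket_add_left B u s z hB, ha, ha', add_lie]
    simp only [map_add, mul_add, LinearMap.add_apply, cst]
    ring
  | basis i =>
    induction b using basis_induction u with
    | zero =>
      rw [map_zero, ← zero_smul F (0 : DiffPoly J F), lamBracket_smul]
      simp [cst]
    | smul r a ha =>
      rw [map_smul, lamBracket_smul, ha, lie_smul, map_smul, hCs, map_smul,
        smul_eq_mul, hcst, ← smul_add, ← Polynomial.smul_C, smul_mul_assoc,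
        smul_add]
    | add a a' ha ha' =>
      rw [map_add, lamBracket_add, ha, ha', lie_add]
      simp only [map_add, mul_add, cst]
      ring
    | basis j =>
      rw [emb_basis, emb_basis, lamBracket_X, MvPolynomial.vars_X, Finset.sum_singleton,
        MvPolynomial.pderiv_X_self, genOp_apply]
      simp only [pow_zero, Module.End.one_apply, map_one, mul_one]
      rw [← map_one Polynomial.C, lamDer_C, Derivation.map_one_eq_zero, ← cst_mul_eq_smul]
      simp

end AffineBracket

/-! ### The Jacobi identity -/

section Jacobi

variable {F 𝔤 J : Type*} [Field F] [LieRing 𝔤] [LieAlgebra F 𝔤]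
  (B : LinearMap.BilinForm F 𝔤) (u : Module.Basis J F 𝔤) (s : 𝔤) (z : F)

lemma eval_lamDer (c : F) (p : (DiffPoly J F)[X]) :
    (lamDer p).eval (MvPolynomial.C c) =
      der (p.eval (MvPolynomial.C c)) + c • p.eval (MvPolynomial.C c) := by
  induction p using Polynomial.induction_on with
  | C a =>
    rw [lamDer_C, MvPolynomial.smul_eq_C_mul, Polynomial.eval_add, Polynomial.eval_C_mul,
      Polynomial.eval_X, Polynomial.eval_C, Polynomial.eval_C]
    ring
  | add p q hp hq => simp only [map_add, Polynomial.eval_add, hp, hq, smul_add]; ring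
  | monomial n a ih =>
    rw [pow_succ, ← mul_assoc, lamDer_mul_X, Polynomial.eval_mul, ih,
      Polynomial.eval_mul (p := _ * _), Polynomial.eval_X,
      Derivation.leibniz der (Polynomial.eval _ (_ * _)), der_C, smul_zero, zero_add, smul_eq_mul,
      MvPolynomial.smul_eq_C_mul, MvPolynomial.smul_eq_C_mul]
    ring

/-- The derivation `h ↦ {g _c h}` of `V`, the `λ`-bracket evaluated at a scalar `λ = c`. -/
noncomputable def bracketAt (g : DiffPoly J F) (c : F) :
    Derivation F (DiffPoly J F) (DiffPoly J F) :=
  Derivation.mk'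
    { toFun := fun h => (lamBracket B u s z g h).eval (MvPolynomial.C c)
      map_add' := fun h k => by rw [lamBracket_add, Polynomial.eval_add]
      map_smul' := fun r h => by
        rw [lamBracket_smul, Polynomial.eval_smul, RingHom.id_apply] }
    (fun h k => by
      simp [lamBracket_mul])

lemma bracketAt_apply (g h : DiffPoly J F) (c : F) :
    bracketAt B u s z g c h = (lamBracket B u s z g h).eval (MvPolynomial.C c) := rfl

lemma bracketAt_der (g h : DiffPoly J F) (c : F) :
    bracketAt B u s z g c (der h) =
      der (bracketAt B u s z g c h) + c • bracketAt B u s z g c h := by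
  rw [bracketAt_apply, lamBracket_der, eval_lamDer, bracketAt_apply]

variable {c : F} {D : Derivation F (DiffPoly J F) (DiffPoly J F)}

lemma coeffMap_lamDer (hD : ∀ h, D (der h) = der (D h) + c • D h) (p : (DiffPoly J F)[X]) :
    coeffMap D.toLinearMap (lamDer p) =
      lamDer (coeffMap D.toLinearMap p) + c • coeffMap D.toLinearMap p := by
  ext1 n
  rw [coeff_coeffMap, lamDer_apply, lamDer_apply]
  cases n with
  | zero =>
    simp only [Polynomial.coeff_add, Polynomial.coeff_smul, coeff_coeffMap, Derivation.coeFn_coe,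
      Polynomial.mul_coeff_zero, Polynomial.coeff_X_zero, zero_mul, add_zero, hD]
  | succ n =>
    simp only [Polynomial.coeff_add, Polynomial.coeff_smul, coeff_coeffMap, Derivation.coeFn_coe,
      Polynomial.coeff_X_mul, map_add, hD]
    ring

lemma coeffMap_adj (hD : ∀ h, D (der h) = der (D h) + c • D h) (p : (DiffPoly J F)[X]) :
    coeffMap D.toLinearMap (adj p) =
      Polynomial.taylor (MvPolynomial.C c) (adj (coeffMap D.toLinearMap p)) := by
  induction p using Polynomial.induction_on with
  | C a => simp
  | add p q hp hq => simp only [map_add, hp, hq]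
  | monomial n a ih =>
    have h1 : Polynomial.C a * Polynomial.X ^ (n + 1)
      = Polynomial.X * (Polynomial.C a * Polynomial.X ^ n) := by ring
    rw [h1, adj_X_mul, map_neg, coeffMap_lamDer hD, ih, coeffMap_X_mul, adj_X_mul, map_neg,
      taylor_lamDer]

/-- Let `D` be a derivation with `D ∂ = (∂ + c) D`, such as `{a _c ·}`. The identity
`D {g _λ h} = {g _λ D h} + {k _{λ+c} h}` holds for all `h` if it holds for the `u_j`. -/
lemma jacobi_of_generators (hD : ∀ h, D (der h) = der (D h) + c • D h) (g k : DiffPoly J F)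
    (hX : ∀ j, coeffMap D.toLinearMap (lamBracket B u s z g (MvPolynomial.X (j, 0))) =
      lamBracket B u s z g (D (MvPolynomial.X (j, 0)))
        + Polynomial.taylor (MvPolynomial.C c) (lamBracket B u s z k (MvPolynomial.X (j, 0))))
    (h : DiffPoly J F) :
    coeffMap D.toLinearMap (lamBracket B u s z g h) =
      lamBracket B u s z g (D h)
        + Polynomial.taylor (MvPolynomial.C c) (lamBracket B u s z k h) := by
  induction h using diffPoly_induction with
  | hC r =>
    rw [lamBracket_C, lamBracket_C, MvPolynomial.derivation_C, map_zero, map_zero, add_zero,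
      ← MvPolynomial.C_0, lamBracket_C]
  | hX j => exact hX j
  | hadd h k hh hk =>
    simp only [map_add, lamBracket_add, hh, hk]
    ring
  | hmul h k hh hk =>
    simp only [lamBracket_mul, map_add, coeffMap_C_mul, hh, hk, Derivation.leibniz, smul_eq_mul,
      lamBracket_add, Polynomial.taylor_mul, Polynomial.taylor_C]
    ring
  | hder h hh =>
    rw [lamBracket_der, coeffMap_lamDer hD, hh, hD, lamBracket_add, lamBracket_der, lamBracket_der,
      lamBracket_smul, taylor_lamDer, map_add, smul_add]
    ring

variable (c)

lemma bracketAt_emb (hB : B.IsSymm) (a b : 𝔤) :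
    bracketAt B u s z (emb u a) c (emb u b) =
      emb u ⁅a, b⁆ + MvPolynomial.C (z * B s ⁅a, b⁆ + c * B a b) := by
  rw [bracketAt_apply, lamBracket_emb B u s z hB, map_add MvPolynomial.C, map_mul _ c]
  simp [cst]
  ring

lemma jacobi_emb_emb (hB : B.IsSymm) (hBinv : ∀ a b c : 𝔤, B ⁅a, b⁆ c = B a ⁅b, c⁆)
    (a b : 𝔤) (h : DiffPoly J F) :
    coeffMap (bracketAt B u s z (emb u a) c).toLinearMap (lamBracket B u s z (emb u b) h) =
      lamBracket B u s z (emb u b) (bracketAt B u s z (emb u a) c h)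
        + Polynomial.taylor (MvPolynomial.C c) (lamBracket B u s z (emb u ⁅a, b⁆) h) := by
  refine jacobi_of_generators B u s z (bracketAt_der B u s z _ · c) _ _ (fun j => ?_) h
  have h1 : B b ⁅a, u j⁆ = -B ⁅a, b⁆ (u j) := by
    rw [← hBinv, ← lie_skew, map_neg, LinearMap.neg_apply]
  have h2 : B a ⁅b, u j⁆ = B ⁅a, b⁆ (u j) := (hBinv _ _ _).symm
  have h3 : ⁅b, ⁅a, u j⁆⁆ = ⁅a, ⁅b, u j⁆⁆ - ⁅⁅a, b⁆, u j⁆ := by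
    rw [leibniz_lie a b (u j)]; abel
  have h4 : ∀ r : F, coeffMap (bracketAt B u s z (emb u a) c).toLinearMap
      (cst r * Polynomial.X) = 0 := by
    intro r
    rw [mul_comm, coeffMap_X_mul, cst, coeffMap_C, Derivation.coeFn_coe,
      MvPolynomial.derivation_C, map_zero, mul_zero]
  rw [← emb_basis u j, lamBracket_emb B u s z hB, lamBracket_emb B u s z hB,
    bracketAt_emb B u s z c hB, map_add (coeffMap _), h4, coeffMap_C, Derivation.coeFn_coe,
    map_add, MvPolynomial.derivation_C, bracketAt_emb B u s z c hB, lamBracket_add, lamBracket_C,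
    lamBracket_emb B u s z hB, h1, h2, h3]
  simp only [cst, Polynomial.taylor_mul, map_add, Polynomial.taylor_C, Polynomial.taylor_X, map_sub,
    map_neg, map_mul, mul_sub, map_zero]
  ring

/-- The Jacobi identity `{a _c {g _λ h}} = {g _λ {a _c h}} + {{a _c g} _{λ+c} h}` for `a ∈ 𝔤` and
a scalar `c`. -/
lemma jacobi (hB : B.IsSymm) (hBinv : ∀ a b c : 𝔤, B ⁅a, b⁆ c = B a ⁅b, c⁆)
    (a : 𝔤) (g h : DiffPoly J F) :
    coeffMap (bracketAt B u s z (emb u a) c).toLinearMap (lamBracket B u s z g h) =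
      lamBracket B u s z g (bracketAt B u s z (emb u a) c h)
        + Polynomial.taylor (MvPolynomial.C c)
            (lamBracket B u s z (bracketAt B u s z (emb u a) c g) h) := by
  have hD := (bracketAt_der B u s z (emb u a) · c)
  refine jacobi_of_generators B u s z hD _ _ (fun j => ?_) h
  -- By skew-symmetry, the case `h ∈ 𝔤` follows from the case where `g ∈ 𝔤`.
  rw [← emb_basis u j, lamBracket_skew B u s z hB (emb u (u j)) g, map_neg, coeffMap_adj hD,
    jacobi_emb_emb B u s z c hB hBinv, map_add, map_add, adj_taylor, bracketAt_emb B u s z c hB,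
    lamBracket_add, lamBracket_C, lamBracket_skew B u s z hB (emb u ⁅a, u j⁆) g,
    lamBracket_skew B u s z hB (emb u (u j)) (bracketAt B u s z (emb u a) c g), map_neg]
  ring

end Jacobi

/-! ### Minimal nilpotent elements -/

section MinimalNilpotent

lemma eq_zero_of_mem_closure_of_neg_mem_closure {F V ι : Type*} [Field F] [CharZero F]
    [AddCommGroup V] [Module F V] {v : ι → V} {s : Set ι} (hs : LinearIndepOn F v s) {y : V}
    (hy : y ∈ AddSubmonoid.closure (v '' s)) (hy' : -y ∈ AddSubmonoid.closure (v '' s)) :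
    y = 0 := by
  have hli : LinearIndepOn F id (v '' s) := hs.id_image
  -- a linear form equal to `1` on the independent vectors counts the summands
  let ℓ : V →ₗ[F] F := (Module.Basis.extend hli).constr F fun _ => (1 : F)
  have hℓ : ∀ w ∈ v '' s, ℓ w = 1 := by
    intro w hw
    have h1 := (Module.Basis.extend hli).constr_basis F (fun _ => (1 : F))
      ⟨w, Module.Basis.subset_extend hli hw⟩
    rwa [Module.Basis.extend_apply_self] at h1
  have key : ∀ w ∈ AddSubmonoid.closure (v '' s), ∃ n : ℕ, ℓ w = n ∧ (n = 0 → w = 0) := by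
    intro w hw
    induction hw using AddSubmonoid.closure_induction with
    | mem w hw => exact ⟨1, by simp [hℓ w hw], by simp⟩
    | zero => exact ⟨0, by simp, fun _ => rfl⟩
    | add a b _ _ ha hb =>
      obtain ⟨n, hn, hn'⟩ := ha
      obtain ⟨m, hm, hm'⟩ := hb
      refine ⟨n + m, by rw [map_add, hn, hm, Nat.cast_add], fun h => ?_⟩
      rw [hn' (by omega), hm' (by omega), add_zero]
  obtain ⟨n, hn, hn'⟩ := key y hy
  obtain ⟨m, hm, -⟩ := key (-y) hy'
  rw [map_neg, hn] at hm
  have h3 : ((n + m : ℕ) : F) = 0 := by rw [Nat.cast_add, ← hm, add_neg_cancel]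
  rw [Nat.cast_eq_zero] at h3
  exact hn' (by omega)

variable {F 𝔤 : Type*} [Field F] [IsAlgClosed F] [CharZero F]
    [LieRing 𝔤] [LieAlgebra F 𝔤] [FiniteDimensional F 𝔤] [LieAlgebra.IsSimple F 𝔤]

/-- `(ad f)² 𝔤 ⊆ F f` for a minimal nilpotent element `f`. -/
lemma IsMinimalNilpotent.exists_lie_lie_eq_smul {f : 𝔤} (hf : IsMinimalNilpotent F f) (y : 𝔤) :
    ∃ c : F, ⁅f, ⁅f, y⁆⁆ = c • f := by
  obtain ⟨H, _, b, θ, hθ, hfθ, hf0⟩ := hf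
  have hθ0 : (θ : LieModule.Weight F H 𝔤).IsNonZero := by
    exact LieSubalgebra.isNonZero_coe_root θ
  suffices hle : (⊤ : Submodule F 𝔤) ≤
      (Submodule.span F {f}).comap ((LieAlgebra.ad F 𝔤 f) ∘ₗ (LieAlgebra.ad F 𝔤 f)) by
    obtain ⟨c, hc⟩ := Submodule.mem_span_singleton.1 (hle (Submodule.mem_top (x := y)))
    exact ⟨c, hc.symm⟩
  have htop := congrArg LieSubmodule.toSubmodule (LieModule.iSup_genWeightSpace_eq_top' F H 𝔤)
  rw [LieSubmodule.iSup_toSubmodule, LieSubmodule.top_toSubmodule] at htop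
  rw [← htop]
  refine iSup_le fun χ y hy => ?_
  change ⁅f, ⁅f, y⁆⁆ ∈ Submodule.span F {f}
  have hmem : ⁅f, ⁅f, y⁆⁆ ∈ LieAlgebra.rootSpace H
      (((θ : LieModule.Weight F H 𝔤) : H → F) + ((θ : LieModule.Weight F H 𝔤) + χ)) :=
    LieAlgebra.lie_mem_genWeightSpace_of_mem_genWeightSpace hfθ
      (LieAlgebra.lie_mem_genWeightSpace_of_mem_genWeightSpace hfθ hy)
  by_cases hbot : LieAlgebra.rootSpace H
      (((θ : LieModule.Weight F H 𝔤) : H → F) + ((θ : LieModule.Weight F H 𝔤) + χ)) = ⊥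
  · rw [hbot, LieSubmodule.mem_bot] at hmem
    rw [hmem]
    exact zero_mem _
  -- If `χ` and `γ = χ + 2 θ` are roots, then `-χ - θ` and `γ - θ = χ + θ` are both sums of simple
  -- roots, so `γ = θ`. If one of them is zero, the other one is `±2 θ`, which is not a root.
  let γ : LieModule.Weight F H 𝔤 := ⟨_, hbot⟩
  have hγ : (γ : H → F) =
    ((θ : LieModule.Weight F H 𝔤) : H → F) + ((θ : LieModule.Weight F H 𝔤) + χ) := rfl
  have hsm := LieAlgebra.IsKilling.eq_neg_one_or_eq_zero_or_eq_one_of_eq_smul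
    (θ : LieModule.Weight F H 𝔤)
  have hχ0 : χ.IsNonZero := by
    intro h0
    have h0' : (χ : H → F) = 0 := h0
    have h2 := hsm γ hθ0 2 (by rw [hγ, h0', add_zero, two_smul])
    norm_num at h2
  have hγ0 : γ.IsNonZero := by
    intro h0
    have h0' : (γ : H → F) = 0 := h0
    have h2 := hsm χ hθ0 (-2) (by
      rw [hγ, ← add_assoc, ← two_smul F] at h0'
      rw [neg_smul, eq_neg_of_add_eq_zero_right h0'])
    norm_num at h2
  have hχ' : (-χ).IsNonZero := LieModule.Weight.IsNonZero.neg hχ0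
  have h1 := hθ ⟨-χ, by simpa using hχ'⟩
  have h2 := hθ ⟨γ, by simpa using hγ0⟩
  simp only [LieAlgebra.IsKilling.rootSystem_root_apply] at h1 h2
  have h3 : (LieModule.Weight.toLinear F H 𝔤 γ) - LieModule.Weight.toLinear F H 𝔤 θ =
      -(LieModule.Weight.toLinear F H 𝔤 (-χ) - LieModule.Weight.toLinear F H 𝔤 θ) := by
    ext t
    have h4 := congrFun hγ t
    simp only [Pi.add_apply] at h4
    simp [h4]
  rw [h3] at h2
  have h5 := eq_zero_of_mem_closure_of_neg_mem_closure b.linearIndepOn_root h1 h2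
  have h6 : (γ : H → F) = (θ : LieModule.Weight F H 𝔤) := by
    rw [h5, neg_zero, sub_eq_zero] at h3
    ext t
    exact LinearMap.congr_fun h3 t
  rw [← hγ, h6] at hmem
  obtain ⟨c, hc⟩ := (finrank_eq_one_iff_of_nonzero' (⟨f, hfθ⟩ : LieAlgebra.rootSpace H
    (θ : LieModule.Weight F H 𝔤)) (by simpa using hf0)).1
    (LieAlgebra.IsKilling.finrank_rootSpace_eq_one _ hθ0) ⟨_, hmem⟩
  exact Submodule.mem_span_singleton.2 ⟨c, by simpa using congrArg Subtype.val hc⟩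

end MinimalNilpotent

/-! ### The grading defined by a minimal nilpotent element -/

section Grading

variable {F 𝔤 : Type*} [Field F] [LieRing 𝔤] [LieAlgebra F 𝔤] {x : 𝔤}

lemma mem_grade {i : ℚ} {a : 𝔤} : a ∈ grade F x i ↔ ⁅x, a⁆ = (i : F) • a := by
  rw [grade, Module.End.mem_eigenspace_iff, LieAlgebra.ad_apply]

variable [CharZero F]

lemma lie_mem_grade {i j k : ℚ} {a b : 𝔤} (ha : a ∈ grade F x i) (hb : b ∈ grade F x j)
    (h : i + j = k) : ⁅a, b⁆ ∈ grade F x k := by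
  rw [mem_grade] at *
  rw [leibniz_lie, ha, hb, smul_lie, lie_smul, ← add_smul, ← h, Rat.cast_add]

lemma bilin_eq_zero {B : LinearMap.BilinForm F 𝔤} (hBinv : ∀ a b c : 𝔤, B ⁅a, b⁆ c = B a ⁅b, c⁆)
    {i j : ℚ} {a b : 𝔤} (ha : a ∈ grade F x i) (hb : b ∈ grade F x j) (h : i + j ≠ 0) :
    B a b = 0 := by
  rw [mem_grade] at *
  have h1 := hBinv a x b
  rw [← lie_skew, ha, hb, map_neg, LinearMap.neg_apply, map_smul, LinearMap.smul_apply, map_smul,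
    smul_eq_mul, smul_eq_mul] at h1
  have h2 : ((i + j : ℚ) : F) * B a b = 0 := by
    rw [Rat.cast_add]
    linear_combination -h1
  exact (mul_eq_zero.1 h2).resolve_left (by exact_mod_cast h)

variable {J : Type*} {u : Module.Basis J F 𝔤} {deg : J → ℚ}

lemma eq_zero_of_bilin_eq_zero {B : LinearMap.BilinForm F 𝔤} (hB : B.Nondegenerate)
    (hBinv : ∀ a b c : 𝔤, B ⁅a, b⁆ c = B a ⁅b, c⁆) (hdeg : ∀ j, u j ∈ grade F x (deg j))
    {i : ℚ} {a : 𝔤} (ha : a ∈ grade F x i) (h : ∀ b ∈ grade F x (-i), B a b = 0) : a = 0 := by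
  have h1 : B a = 0 := u.ext fun j => by
    by_cases hj : deg j = -i
    · exact h _ (hj ▸ hdeg j)
    · exact bilin_eq_zero hBinv ha (hdeg j) fun h2 => hj (by linarith)
  exact hB.1 a fun b => by rw [h1, LinearMap.zero_apply]

lemma repr_eq_zero (hdeg : ∀ j, u j ∈ grade F x (deg j)) {i : ℚ} {a : 𝔤} (ha : a ∈ grade F x i)
    {j : J} (hj : deg j ≠ i) : u.repr a j = 0 := by
  have h1 : (u.coord j) ∘ₗ (LieAlgebra.ad F 𝔤 x : 𝔤 →ₗ[F] 𝔤) = (deg j : F) • u.coord j := by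
    classical
    refine u.ext fun k => ?_
    simp only [LinearMap.comp_apply, LieAlgebra.ad_apply, mem_grade.1 (hdeg k), map_smul,
      LinearMap.smul_apply, Module.Basis.coord_apply, Module.Basis.repr_self, smul_eq_mul]
    by_cases hk : k = j
    · rw [hk]
    · rw [Finsupp.single_eq_of_ne (Ne.symm hk), mul_zero, mul_zero]
  have h2 := LinearMap.congr_fun h1 a
  simp only [LinearMap.comp_apply, LieAlgebra.ad_apply, mem_grade.1 ha, map_smul,
    LinearMap.smul_apply, Module.Basis.coord_apply, smul_eq_mul] at h2
  have h3 : ((i : F) - (deg j : F)) * u.repr a j = 0 := by rw [sub_mul, h2, sub_self]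
  exact (mul_eq_zero.1 h3).resolve_left (sub_ne_zero.2 (by exact_mod_cast hj.symm))

/-- Two linear maps that agree on the basis vectors of degree `i` agree on `𝔤_i`. -/
lemma eqOn_grade (hdeg : ∀ j, u j ∈ grade F x (deg j)) {M : Type*} [AddCommGroup M] [Module F M]
    {S T : 𝔤 →ₗ[F] M} {i : ℚ} (h : ∀ j, deg j = i → S (u j) = T (u j)) {a : 𝔤}
    (ha : a ∈ grade F x i) : S a = T a := by
  rw [← u.linearCombination_repr a, Finsupp.linearCombination_apply, Finsupp.sum, map_sum,
    map_sum]
  refine Finset.sum_congr rfl fun j _ => ?_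
  by_cases hj : deg j = i
  · rw [map_smul, map_smul, h j hj]
  · rw [repr_eq_zero hdeg ha hj, zero_smul, map_zero, map_zero]

/-- The grading `𝔤 = F f ⊕ 𝔤_{-1/2} ⊕ 𝔤_0 ⊕ 𝔤_{1/2} ⊕ F e` given by an `𝔰𝔩₂`-triple `(e, 2x, f)`,
together with a symmetric invariant bilinear form for which `(e | f) ≠ 0`. -/
structure IsMinimalGrading (B : LinearMap.BilinForm F 𝔤) (e x f : 𝔤) : Prop where
  symm : B.IsSymm
  inv : ∀ a b c : 𝔤, B ⁅a, b⁆ c = B a ⁅b, c⁆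
  lie_x_e : ⁅x, e⁆ = e
  lie_x_f : ⁅x, f⁆ = -f
  lie_e_f : ⁅e, f⁆ = (2 : F) • x
  bilin_e_f : B e f ≠ 0
  grade_eq_bot : ∀ i : ℚ, i ≠ -1 → i ≠ -1 / 2 → i ≠ 0 → i ≠ 1 / 2 → i ≠ 1 → grade F x i = ⊥
  grade_one : ∀ a ∈ grade F x 1, ∃ c : F, a = c • e
  grade_neg_one : ∀ a ∈ grade F x (-1), ∃ c : F, a = c • f

section sl2

variable [FiniteDimensional F 𝔤] {e f : 𝔤}

lemma _root_.IsSl2Triple.exists_nat_of_lie_f_eq_zero (hsl2 : IsSl2Triple ((2 : F) • x) e f)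
    {i : ℚ} {a : 𝔤} (ha : a ∈ grade F x i) (ha0 : a ≠ 0) (hfa : ⁅f, a⁆ = 0) :
    ∃ n : ℕ, i = -n / 2 := by
  have P : IsSl2Triple.HasPrimitiveVectorWith hsl2.symm a (-(2 * i) : F) :=
    ⟨ha0, by rw [neg_lie, smul_lie, mem_grade.1 ha, smul_smul, neg_smul], hfa⟩
  obtain ⟨n, hn⟩ := P.exists_nat
  refine ⟨n, ?_⟩
  have h1 : -(2 * i) = (n : ℚ) := by exact_mod_cast hn
  linarith

/-- In an `𝔰𝔩₂`-module, a weight vector killed by `f²` has weight at most `2`. -/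
lemma _root_.IsSl2Triple.exists_nat_of_lie_f_lie_f_eq_zero
    (hsl2 : IsSl2Triple ((2 : F) • x) e f) (hf : f ∈ grade F x (-1))
    {i : ℚ} {a : 𝔤} (ha : a ∈ grade F x i) (ha0 : a ≠ 0) (hfa : ⁅f, ⁅f, a⁆⁆ = 0) :
    ∃ n : ℕ, i = 1 - n / 2 := by
  by_cases h0 : ⁅f, a⁆ = 0
  · obtain ⟨n, rfl⟩ := hsl2.exists_nat_of_lie_f_eq_zero ha ha0 h0
    exact ⟨n + 2, by push_cast; ring⟩
  · obtain ⟨n, hn⟩ := hsl2.exists_nat_of_lie_f_eq_zero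
      (lie_mem_grade hf ha (k := i - 1) (by ring)) h0 hfa
    exact ⟨n, by linarith⟩

/-- If `(ad f)² 𝔤 ⊆ F f`, then the `ad x`-eigenvalues are `±1`, each with multiplicity one, `±1/2`
and `0`. -/
lemma isMinimalGrading {B : LinearMap.BilinForm F 𝔤} (hB : B.Nondegenerate) (hBs : B.IsSymm)
    (hBinv : ∀ a b c : 𝔤, B ⁅a, b⁆ c = B a ⁅b, c⁆) (hdeg : ∀ j, u j ∈ grade F x (deg j))
    (hsl2 : IsSl2Triple ((2 : F) • x) e f) (hf : ∀ y, ∃ c : F, ⁅f, ⁅f, y⁆⁆ = c • f) :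
    IsMinimalGrading B e x f := by
  have h2F : (2 : F) ≠ 0 := two_ne_zero
  have hxe : ⁅x, e⁆ = e := by
    have h1 := hsl2.lie_h_e_smul F
    rw [smul_lie] at h1
    exact smul_right_injective _ h2F h1
  have hxf : ⁅x, f⁆ = -f := by
    have h1 := hsl2.lie_lie_smul_f F
    rw [smul_lie, ← smul_neg] at h1
    exact smul_right_injective _ h2F h1
  have he1 : e ∈ grade F x 1 := by rw [mem_grade, hxe]; simp
  have hf1 : f ∈ grade F x (-1) := by rw [mem_grade, hxf]; simp
  -- The weight of `[f, [f, a]] ∈ F f` is `-1` only if `a` has weight `1`.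
  have hsq : ∀ {i : ℚ} {a : 𝔤}, i ≠ 1 → a ∈ grade F x i → ⁅f, ⁅f, a⁆⁆ = 0 := by
    intro i a hi ha
    obtain ⟨c, hc⟩ := hf a
    have h1 := lie_mem_grade hf1 (lie_mem_grade hf1 ha rfl) rfl
    rw [hc, mem_grade, lie_smul, hxf, smul_smul, smul_neg, ← neg_smul, ← sub_eq_zero, ← sub_smul,
      smul_eq_zero_iff_left hsl2.f_ne_zero] at h1
    have h3 : ((1 - i : ℚ) : F) * c = 0 := by
      push_cast at h1 ⊢
      linear_combination h1
    have h4 : c = 0 := (mul_eq_zero.1 h3).resolve_left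
      (by exact_mod_cast sub_ne_zero.2 hi.symm)
    rw [hc, h4, zero_smul]
  have hle : ∀ {i : ℚ} {a : 𝔤}, a ∈ grade F x i → a ≠ 0 → ∃ n : ℕ, i = 1 - n / 2 := by
    intro i a ha ha0
    by_cases hi : i = 1
    · exact ⟨0, by simp [hi]⟩
    · exact hsl2.exists_nat_of_lie_f_lie_f_eq_zero hf1 ha ha0 (hsq hi ha)
  have hbot : ∀ i : ℚ, i ≠ -1 → i ≠ -1 / 2 → i ≠ 0 → i ≠ 1 / 2 → i ≠ 1 → grade F x i = ⊥ := by
    intro i h1 h2 h3 h4 h5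
    rw [Submodule.eq_bot_iff]
    intro a ha
    by_contra ha0
    obtain ⟨n, hn⟩ := hle ha ha0
    have h6 : ¬∀ b ∈ grade F x (-i), B a b = 0 := fun h =>
      ha0 (eq_zero_of_bilin_eq_zero hB hBinv hdeg ha h)
    push Not at h6
    obtain ⟨b, hb, hb0⟩ := h6
    -- The weights `i` and `-i` are both of the form `1 - n / 2`.
    obtain ⟨m, hm⟩ := hle hb (by rintro rfl; simp at hb0)
    have h7 : n + m = 4 := by
      have : (n : ℚ) + m = 4 := by linarith
      exact_mod_cast this
    have h8 : n ≤ 4 := by omega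
    interval_cases n
    · exact h5 (by rw [hn]; norm_num)
    · exact h4 (by rw [hn]; norm_num)
    · exact h3 (by rw [hn]; norm_num)
    · exact h2 (by rw [hn]; norm_num)
    · exact h1 (by rw [hn]; norm_num)
  have hone : ∀ a ∈ grade F x 1, ∃ c : F, a = c • e := by
    intro a ha
    obtain ⟨c, hc⟩ := hf a
    refine ⟨-(c / 2), ?_⟩
    -- `[f, [f, e]] = -2 f`, so `y` is killed by `(ad f)²`.
    set y := a + (c / 2) • e with hy
    have hy1 : y ∈ grade F x 1 := add_mem ha (Submodule.smul_mem _ _ he1)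
    have hfy : ⁅f, ⁅f, y⁆⁆ = 0 := by
      have h1 : ⁅f, e⁆ = -((2 : F) • x) := by rw [← lie_skew, hsl2.lie_e_f]
      have h2 : ⁅f, x⁆ = f := by rw [← lie_skew, hxf, neg_neg]
      rw [hy, lie_add, lie_add, hc, lie_smul, lie_smul, h1, lie_neg, lie_smul, h2, smul_neg,
        smul_smul, div_mul_cancel₀ c h2F, add_neg_cancel]
    suffices hy0 : y = 0 by
      rw [neg_smul]
      exact eq_neg_of_add_eq_zero_left hy0
    have hfy1 : ⁅f, y⁆ ∈ grade F x 0 := lie_mem_grade hf1 hy1 (by norm_num)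
    have hey : ⁅e, y⁆ = 0 := by
      have h1 : ⁅e, y⁆ ∈ grade F x 2 := lie_mem_grade he1 hy1 (by norm_num)
      rw [hbot 2 (by norm_num) (by norm_num) (by norm_num) (by norm_num) (by norm_num)] at h1
      exact h1
    have hefy : ⁅e, ⁅f, y⁆⁆ = 0 := by
      by_cases h0 : ⁅f, y⁆ = 0
      · rw [h0, lie_zero]
      -- `[f, y]` is a lowest weight vector of weight `0`
      have P : IsSl2Triple.HasPrimitiveVectorWith hsl2.symm ⁅f, y⁆ (0 : F) :=
        ⟨h0, by rw [neg_lie, smul_lie, mem_grade.1 hfy1]; simp, hfy⟩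
      simpa using P.pow_toEnd_f_eq_zero_of_eq_nat (n := 0) (by simp)
    have h2 : (2 : F) • y = 0 := by
      have h3 : ⁅⁅e, f⁆, y⁆ = (2 : F) • y := by
        rw [hsl2.lie_e_f, smul_lie, mem_grade.1 hy1, Rat.cast_one, one_smul]
      rw [← h3, lie_lie, hefy, hey, lie_zero, sub_zero]
    exact (smul_eq_zero.1 h2).resolve_left h2F
  -- `f` pairs non-trivially with some element of `𝔤_1 = F e`.
  have hef : B e f ≠ 0 := by
    intro h0
    refine hsl2.f_ne_zero (eq_zero_of_bilin_eq_zero hB hBinv hdeg hf1 fun b hb => ?_)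
    rw [neg_neg] at hb
    obtain ⟨c, rfl⟩ := hone b hb
    have h1 : B f e = B e f := hBs.eq f e
    rw [map_smul, h1, h0, smul_zero]
  refine ⟨hBs, hBinv, hxe, hxf, hsl2.lie_e_f, hef, hbot, hone, fun a ha => ⟨B e a / B e f, ?_⟩⟩
  rw [← sub_eq_zero]
  refine eq_zero_of_bilin_eq_zero hB hBinv hdeg
    (sub_mem ha (Submodule.smul_mem _ _ hf1)) fun b hb => ?_
  rw [neg_neg] at hb
  obtain ⟨c, rfl⟩ := hone b hb
  have h1 : B f e = B e f := hBs.eq f e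
  have h2 : B a e = B e a := hBs.eq a e
  rw [map_smul, map_sub, LinearMap.sub_apply, map_smul, LinearMap.smul_apply, h1, h2, smul_eq_mul,
    smul_eq_mul, div_mul_cancel₀ _ hef, sub_self, mul_zero]

end sl2

end Grading

/-! ### The centralizer of `f` in `𝔤_0` and dual bases -/

section MinimalGrading

variable {F 𝔤 : Type*} [Field F] [LieRing 𝔤] [LieAlgebra F 𝔤] [CharZero F]
  {B : LinearMap.BilinForm F 𝔤} {e x f : 𝔤}

namespace IsMinimalGrading

variable (M : IsMinimalGrading B e x f)
include M

lemma e_mem : e ∈ grade F x 1 := by rw [mem_grade, M.lie_x_e]; simp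

lemma f_mem : f ∈ grade F x (-1) := by rw [mem_grade, M.lie_x_f]; simp

omit M in
lemma x_mem : x ∈ grade F x 0 := by rw [mem_grade]; simp

lemma bilin_comm (a b : 𝔤) : B a b = B b a := M.symm.eq a b

lemma bilin_e_f_eq : B e f = 2 * B x x := by
  have h1 := M.inv x e f
  rwa [M.lie_x_e, M.lie_e_f, map_smul, smul_eq_mul] at h1

lemma bilin_x_x_ne_zero : B x x ≠ 0 := by
  intro h
  exact M.bilin_e_f (by rw [M.bilin_e_f_eq, h, mul_zero])

lemma eq_zero_of_one_lt {i : ℚ} {a : 𝔤} (ha : a ∈ grade F x i) (hi : 1 < i) : a = 0 := by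
  rwa [M.grade_eq_bot i (by linarith) (by linarith) (by linarith) (by linarith) (by linarith)]
    at ha

lemma eq_zero_of_lt_neg_one {i : ℚ} {a : 𝔤} (ha : a ∈ grade F x i) (hi : i < -1) : a = 0 := by
  rwa [M.grade_eq_bot i (by linarith) (by linarith) (by linarith) (by linarith) (by linarith)]
    at ha

lemma lie_f_e : ⁅f, e⁆ = -((2 : F) • x) := by rw [← lie_skew, M.lie_e_f]

lemma lie_f_x : ⁅f, x⁆ = f := by rw [← lie_skew, M.lie_x_f, neg_neg]

lemma lie_e_x : ⁅e, x⁆ = -e := by rw [← lie_skew, M.lie_x_e]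

lemma lie_f_lie_e {w : 𝔤} (hw : w ∈ grade F x (-1 / 2)) : ⁅f, ⁅e, w⁆⁆ = w := by
  have h0 : ⁅f, w⁆ = 0 := M.eq_zero_of_lt_neg_one (lie_mem_grade M.f_mem hw rfl) (by norm_num)
  rw [leibniz_lie, h0, lie_zero, add_zero, M.lie_f_e, neg_lie, smul_lie, mem_grade.1 hw, smul_smul,
    ← neg_smul]
  norm_num

lemma lie_e_lie_f {w : 𝔤} (hw : w ∈ grade F x (1 / 2)) : ⁅e, ⁅f, w⁆⁆ = w := by
  have h0 : ⁅e, w⁆ = 0 := M.eq_zero_of_one_lt (lie_mem_grade M.e_mem hw rfl) (by norm_num)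
  rw [leibniz_lie, h0, lie_zero, add_zero, M.lie_e_f, smul_lie, mem_grade.1 hw, smul_smul]
  norm_num

lemma lie_eq_smul_e {w y : 𝔤} (hw : w ∈ grade F x (1 / 2)) (hy : y ∈ grade F x (1 / 2)) :
    ⁅w, y⁆ = (B f ⁅w, y⁆ / B e f) • e := by
  obtain ⟨r, hr⟩ := M.grade_one _ (lie_mem_grade hw hy (by norm_num))
  rw [hr, map_smul, M.bilin_comm f e, smul_eq_mul, mul_div_cancel_right₀ _ M.bilin_e_f]

lemma lie_eq_smul_f {w y : 𝔤} (hw : w ∈ grade F x (-1 / 2)) (hy : y ∈ grade F x (-1 / 2)) :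
    ⁅w, y⁆ = (B e ⁅w, y⁆ / (2 * B x x)) • f := by
  obtain ⟨r, hr⟩ := M.grade_neg_one _ (lie_mem_grade hw hy (by norm_num))
  rw [hr, map_smul, smul_eq_mul, ← M.bilin_e_f_eq, mul_div_cancel_right₀ _ M.bilin_e_f]

omit M [CharZero F] in
lemma mem_centralizer {b : 𝔤} :
    b ∈ gradeZeroCentralizer F x f ↔ b ∈ grade F x 0 ∧ ⁅f, b⁆ = 0 := by
  rw [gradeZeroCentralizer, Submodule.mem_inf, LinearMap.mem_ker, LieAlgebra.ad_apply]

lemma bilin_x_centralizer {b : 𝔤} (hb : b ∈ gradeZeroCentralizer F x f) : B x b = 0 := by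
  have h1 := M.inv e f b
  rw [M.lie_e_f, (mem_centralizer.1 hb).2, map_zero, map_smul, LinearMap.smul_apply] at h1
  exact (smul_eq_zero.1 h1).resolve_left two_ne_zero

lemma lie_e_centralizer {b : 𝔤} (hb : b ∈ gradeZeroCentralizer F x f) : ⁅e, b⁆ = 0 := by
  obtain ⟨r, hr⟩ := M.grade_one _
    (lie_mem_grade M.e_mem (mem_centralizer.1 hb).1 (by norm_num))
  have h1 := M.inv f e b
  rw [hr, M.lie_f_e, map_neg, map_smul, LinearMap.neg_apply, LinearMap.smul_apply,
    M.bilin_x_centralizer hb, smul_zero, neg_zero, map_smul, M.bilin_comm, smul_eq_mul] at h1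
  rw [hr, (mul_eq_zero.1 h1.symm).resolve_right M.bilin_e_f, zero_smul]

lemma sharp_mem {b : 𝔤} (hb : b ∈ grade F x 0) : sharp B x b ∈ gradeZeroCentralizer F x f := by
  refine mem_centralizer.2 ⟨sub_mem hb (Submodule.smul_mem _ _ x_mem), ?_⟩
  obtain ⟨r, hr⟩ := M.grade_neg_one _ (lie_mem_grade M.f_mem hb (by norm_num))
  have h1 := M.inv e f b
  rw [hr, M.lie_e_f, map_smul, map_smul, LinearMap.smul_apply, M.bilin_e_f_eq, smul_eq_mul,
    smul_eq_mul, M.bilin_comm x b] at h1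
  have h2 : B b x = r * B x x := by
    have h3 : (2 : F) ≠ 0 := two_ne_zero
    apply mul_left_cancel₀ h3
    linear_combination h1
  rw [sharp, h2, mul_div_cancel_right₀ _ M.bilin_x_x_ne_zero, lie_sub, lie_smul, hr, M.lie_f_x,
    sub_self]

lemma sharp_of_mem {b : 𝔤} (hb : b ∈ gradeZeroCentralizer F x f) : sharp B x b = b := by
  rw [sharp, M.bilin_comm, M.bilin_x_centralizer hb, zero_div, zero_smul, sub_zero]

lemma sharp_x : sharp B x x = 0 := by
  rw [sharp, div_self M.bilin_x_x_ne_zero, one_smul, sub_self]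

/-- For `w ∈ 𝔤_{-1/2}` and `y ∈ 𝔤_{1/2}`, `(w | y) = ω₊([e, w], y)`. -/
lemma bilin_eq_omegaPlus {w : 𝔤} (hw : w ∈ grade F x (-1 / 2)) (y : 𝔤) :
    B w y = B f ⁅⁅e, w⁆, y⁆ := by
  conv_lhs => rw [← M.lie_f_lie_e hw, M.inv]

lemma lie_mem_centralizer {b b₁ : 𝔤} (hb : b ∈ gradeZeroCentralizer F x f)
    (hb₁ : b₁ ∈ gradeZeroCentralizer F x f) : ⁅b, b₁⁆ ∈ gradeZeroCentralizer F x f := by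
  rw [mem_centralizer] at *
  refine ⟨lie_mem_grade hb.1 hb₁.1 (by norm_num), ?_⟩
  rw [leibniz_lie, hb.2, hb₁.2, zero_lie, lie_zero, add_zero]

/-- Elements of `𝔤_0^f` preserve `ω₊`. -/
lemma omegaPlus_lie {b w y : 𝔤} (hb : b ∈ gradeZeroCentralizer F x f) :
    B f ⁅w, ⁅b, y⁆⁆ = -B f ⁅⁅b, w⁆, y⁆ := by
  have h1 : B f ⁅b, ⁅w, y⁆⁆ = 0 := by
    rw [← M.inv, (mem_centralizer.1 hb).2, map_zero, LinearMap.zero_apply]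
  rw [leibniz_lie b w y, map_add] at h1
  linear_combination h1

end IsMinimalGrading

/-- The dual bases of `𝔤_0`, of `𝔤_{1/2}` with respect to `ω₊` and of `𝔤_0^f`, through the
expansions of vectors that they provide. -/
structure DualBases {J₀ J₁ K : Type*} [Fintype J₀] [Fintype J₁] [Fintype K]
    (B : LinearMap.BilinForm F 𝔤) (e x f : 𝔤) (a a' : J₀ → 𝔤) (v v' : J₁ → 𝔤) (c c' : K → 𝔤) :
    Prop extends IsMinimalGrading B e x f where
  a_mem : ∀ j, a j ∈ grade F x 0
  a_mem' : ∀ j, a' j ∈ grade F x 0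
  v_mem : ∀ k, v k ∈ grade F x (1 / 2)
  v_mem' : ∀ k, v' k ∈ grade F x (1 / 2)
  c_mem : ∀ i, c i ∈ gradeZeroCentralizer F x f
  c_mem' : ∀ i, c' i ∈ gradeZeroCentralizer F x f
  expand_a : ∀ y ∈ grade F x 0, ∑ j, B y (a' j) • a j = y
  expand_a' : ∀ y ∈ grade F x 0, ∑ j, B y (a j) • a' j = y
  expand_v : ∀ y ∈ grade F x (1 / 2), ∑ k, B f ⁅y, v' k⁆ • v k = y
  expand_v' : ∀ y ∈ grade F x (1 / 2), ∑ k, B f ⁅y, v k⁆ • v' k = -y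
  expand_c : ∀ y ∈ gradeZeroCentralizer F x f, ∑ i, B y (c' i) • c i = y
  expand_c' : ∀ y ∈ gradeZeroCentralizer F x f, ∑ i, B y (c i) • c' i = y

omit [CharZero F] in
lemma expand_of_basis {ι : Type*} [Fintype ι] [DecidableEq ι] {E : Submodule F 𝔤}
    (p : Module.Basis ι F E) {q : ι → 𝔤} (β : 𝔤 →ₗ[F] 𝔤 →ₗ[F] F)
    (h : ∀ i j, β (p i) (q j) = if i = j then 1 else 0) {y : 𝔤} (hy : y ∈ E) :
    ∑ i, β y (q i) • (p i : 𝔤) = y := by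
  have h1 : y = ∑ i, p.repr ⟨y, hy⟩ i • (p i : 𝔤) := by
    have h2 := congrArg Subtype.val (p.sum_repr ⟨y, hy⟩)
    rw [Submodule.coe_sum] at h2
    exact h2.symm
  have h3 : ∀ i, β y (q i) = p.repr ⟨y, hy⟩ i := by
    intro i
    conv_lhs => rw [h1]
    rw [map_sum, LinearMap.sum_apply, Finset.sum_eq_single i]
    · rw [map_smul, LinearMap.smul_apply, h, if_pos rfl, smul_eq_mul, mul_one]
    · intro j _ hj
      rw [map_smul, LinearMap.smul_apply, h, if_neg hj, smul_zero]
    · intro hi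
      exact absurd (Finset.mem_univ i) hi
  simp_rw [h3]
  exact h1.symm

lemma dualBases {J₀ J₁ K : Type*} [Fintype J₀] [Fintype J₁] [Fintype K] [DecidableEq J₀]
    [DecidableEq J₁] [DecidableEq K] (M : IsMinimalGrading B e x f)
    (a a' : Module.Basis J₀ F (grade F x 0))
    (haa' : ∀ i j, B (a i) (a' j) = if i = j then 1 else 0)
    (v v' : Module.Basis J₁ F (grade F x (1 / 2)))
    (hvv' : ∀ h k, omegaPlus B f (v h) (v' k) = if h = k then 1 else 0)
    (c c' : Module.Basis K F (gradeZeroCentralizer F x f))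
    (hcc' : ∀ i j, B (c i) (c' j) = if i = j then 1 else 0) :
    DualBases B e x f (fun j => (a j : 𝔤)) (fun j => (a' j : 𝔤)) (fun k => (v k : 𝔤))
      (fun k => (v' k : 𝔤)) (fun i => (c i : 𝔤)) (fun i => (c' i : 𝔤)) where
  toIsMinimalGrading := M
  a_mem j := (a j).2
  a_mem' j := (a' j).2
  v_mem k := (v k).2
  v_mem' k := (v' k).2
  c_mem i := (c i).2
  c_mem' i := (c' i).2
  expand_a y hy := expand_of_basis a B haa' hy
  expand_a' y hy := expand_of_basis a' B
    (fun i j => by rw [M.bilin_comm, haa']; simp only [eq_comm]) hy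
  expand_v y hy := by
    let ω : 𝔤 →ₗ[F] 𝔤 →ₗ[F] F := LinearMap.mk₂ F (fun a b => B f ⁅a, b⁆)
      (by simp) (by simp) (by simp) (by simp)
    exact expand_of_basis v ω hvv' hy
  expand_v' y hy := by
    let ω : 𝔤 →ₗ[F] 𝔤 →ₗ[F] F := LinearMap.mk₂ F (fun a b => -B f ⁅a, b⁆)
      (by simp [add_comm]) (by simp) (by simp [add_comm]) (by simp)
    have h1 := expand_of_basis v' (q := fun k => (v k : 𝔤)) ω (fun i j => by
      rw [LinearMap.mk₂_apply, ← lie_skew, map_neg, neg_neg]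
      exact (hvv' j i).trans (by simp only [eq_comm])) hy
    conv_rhs => rw [← h1]
    rw [← Finset.sum_neg_distrib]
    refine Finset.sum_congr rfl fun k _ => ?_
    rw [LinearMap.mk₂_apply, neg_smul, neg_neg]
  expand_c y hy := expand_of_basis c B hcc' hy
  expand_c' y hy := expand_of_basis c' B
    (fun i j => by rw [M.bilin_comm, hcc']; simp only [eq_comm]) hy

namespace DualBases

variable {J₀ J₁ K : Type*} [Fintype J₀] [Fintype J₁] [Fintype K]
  {a a' : J₀ → 𝔤} {v v' : J₁ → 𝔤} {c c' : K → 𝔤} (M : DualBases B e x f a a' v v' c c')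
  {V : Type*}
include M

section Module

variable [AddCommGroup V] [Module F V] (T : 𝔤 →ₗ[F] V)

lemma sum_a {y : 𝔤} (hy : y ∈ grade F x 0) : ∑ j, B y (a' j) • T (a j) = T y := by
  simpa only [map_sum, map_smul] using congrArg T (M.expand_a y hy)

lemma sum_a' {y : 𝔤} (hy : y ∈ grade F x 0) : ∑ j, B y (a j) • T (a' j) = T y := by
  simpa only [map_sum, map_smul] using congrArg T (M.expand_a' y hy)

lemma sum_v {y : 𝔤} (hy : y ∈ grade F x (1 / 2)) : ∑ k, B f ⁅y, v' k⁆ • T (v k) = T y := by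
  simpa only [map_sum, map_smul] using congrArg T (M.expand_v y hy)

lemma sum_v' {y : 𝔤} (hy : y ∈ grade F x (1 / 2)) : ∑ k, B f ⁅y, v k⁆ • T (v' k) = -T y := by
  simpa only [map_sum, map_smul, map_neg] using congrArg T (M.expand_v' y hy)

lemma sum_c {y : 𝔤} (hy : y ∈ gradeZeroCentralizer F x f) :
    ∑ i, B y (c' i) • T (c i) = T y := by
  simpa only [map_sum, map_smul] using congrArg T (M.expand_c y hy)

lemma sum_c' {y : 𝔤} (hy : y ∈ gradeZeroCentralizer F x f) :
    ∑ i, B y (c i) • T (c' i) = T y := by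
  simpa only [map_sum, map_smul] using congrArg T (M.expand_c' y hy)

end Module

section Algebra

variable [CommRing V] [Algebra F V] (T S : 𝔤 →ₗ[F] V)

/-- The tensor `∑ v_k ⊗ v^k` is skew-symmetric. -/
lemma sum_v_mul_v' : ∑ k, T (v k) * S (v' k) = -∑ k, T (v' k) * S (v k) := by
  have h1 : ∀ k, T (v k) = -∑ h, B f ⁅v k, v h⁆ • T (v' h) := fun k => by
    rw [M.sum_v' T (M.v_mem k), neg_neg]
  simp_rw [h1, neg_mul, Finset.sum_mul]
  rw [Finset.sum_neg_distrib, neg_inj, Finset.sum_comm]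
  refine Finset.sum_congr rfl fun h _ => ?_
  rw [← neg_neg (S (v h)), ← M.sum_v' S (M.v_mem h), mul_neg, Finset.mul_sum]
  refine Eq.trans ?_ (Finset.sum_neg_distrib _)
  refine Finset.sum_congr rfl fun k _ => ?_
  rw [← lie_skew, map_neg, neg_smul, neg_mul, smul_mul_assoc, mul_smul_comm]

lemma sum_v'_mul_v : ∑ k, T (v' k) * T (v k) = 0 := by
  have h1 := M.sum_v_mul_v' T T
  have h2 : ∑ k, T (v k) * T (v' k) = ∑ k, T (v' k) * T (v k) :=
    Finset.sum_congr rfl fun k _ => mul_comm _ _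
  rw [h2] at h1
  have h3 : (2 : F) • ∑ k, T (v' k) * T (v k) = 0 := by
    rw [two_smul]
    nth_rewrite 1 [h1]
    exact neg_add_cancel _
  exact (smul_eq_zero.1 h3).resolve_left two_ne_zero

lemma sum_a_mul_a' : ∑ j, T (a j) * S (a' j) = ∑ j, T (a' j) * S (a j) := by
  have h1 : ∀ j, T (a j) = ∑ i, B (a j) (a i) • T (a' i) := fun j =>
    (M.sum_a' T (M.a_mem j)).symm
  have h2 : ∀ j, S (a j) = ∑ i, B (a j) (a i) • S (a' i) := fun j =>
    (M.sum_a' S (M.a_mem j)).symm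
  simp_rw [h1, Finset.sum_mul]
  rw [Finset.sum_comm]
  refine Finset.sum_congr rfl fun i _ => ?_
  rw [h2 i, Finset.mul_sum]
  refine Finset.sum_congr rfl fun j _ => ?_
  rw [M.bilin_comm, smul_mul_assoc, mul_smul_comm]

lemma sum_c_mul_c' : ∑ i, T (c i) * S (c' i) = ∑ i, T (c' i) * S (c i) := by
  have h1 : ∀ j, T (c j) = ∑ i, B (c j) (c i) • T (c' i) := fun j =>
    (M.sum_c' T (M.c_mem j)).symm
  have h2 : ∀ j, S (c j) = ∑ i, B (c j) (c i) • S (c' i) := fun j =>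
    (M.sum_c' S (M.c_mem j)).symm
  simp_rw [h1, Finset.sum_mul]
  rw [Finset.sum_comm]
  refine Finset.sum_congr rfl fun i _ => ?_
  rw [h2 i, Finset.mul_sum]
  refine Finset.sum_congr rfl fun j _ => ?_
  rw [M.bilin_comm, smul_mul_assoc, mul_smul_comm]

/-- `∑ a_j ⊗ a^j = ∑ c_i ⊗ c^i + (x | x)⁻¹ x ⊗ x`; the last summand drops out under a linear map
that vanishes at `x`. -/
lemma sum_a_eq_sum_c (hT : T x = 0) : ∑ j, T (a j) * S (a' j) = ∑ i, T (c i) * S (c' i) := by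
  have h1 : ∀ j, T (a j) = ∑ i, B (c' i) (a j) • T (c i) := by
    intro j
    have h2 : T (a j) = T (sharp B x (a j)) := by
      rw [sharp, map_sub, map_smul, hT, smul_zero, sub_zero]
    rw [h2, ← M.sum_c T (M.sharp_mem (M.a_mem j))]
    refine Finset.sum_congr rfl fun i _ => ?_
    rw [sharp, map_sub, map_smul, LinearMap.sub_apply, LinearMap.smul_apply,
      M.bilin_x_centralizer (M.c_mem' i), smul_zero, sub_zero, M.bilin_comm]
  simp_rw [h1, Finset.sum_mul]
  rw [Finset.sum_comm]
  refine Finset.sum_congr rfl fun i _ => ?_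
  rw [← M.sum_a' S (IsMinimalGrading.mem_centralizer.1 (M.c_mem' i)).1, Finset.mul_sum]
  refine Finset.sum_congr rfl fun j _ => ?_
  rw [smul_mul_assoc, mul_smul_comm]

end Algebra

end DualBases

end MinimalGrading

/-! ### The `λ`-bracket followed by a differential homomorphism -/

section HomBracket

variable {F 𝔤 J : Type*} [Field F] [LieRing 𝔤] [LieAlgebra F 𝔤]
  (B : LinearMap.BilinForm F 𝔤) (u : Module.Basis J F 𝔤) (s : 𝔤) (z : F) (y : J → DiffPoly J F)

/-- The `λ`-bracket `χ {g _λ h}`, where `χ` is the homomorphism of differential algebras with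
`χ u_j = y_j`. -/
noncomputable def homBracket (g h : DiffPoly J F) : (DiffPoly J F)[X] :=
  diffHomPoly y (lamBracket B u s z g h)

lemma homBracket_add (g h k : DiffPoly J F) :
    homBracket B u s z y g (h + k) = homBracket B u s z y g h + homBracket B u s z y g k := by
  rw [homBracket, lamBracket_add, map_add]; rfl

lemma homBracket_mul (g h k : DiffPoly J F) :
    homBracket B u s z y g (h * k) =
      Polynomial.C (diffHom y h) * homBracket B u s z y g k
        + Polynomial.C (diffHom y k) * homBracket B u s z y g h := by
  rw [homBracket, lamBracket_mul, map_add, map_mul, map_mul, diffHomPoly_C, diffHomPoly_C]; rfl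

lemma homBracket_smul (g h : DiffPoly J F) (c : F) :
    homBracket B u s z y g (c • h) = c • homBracket B u s z y g h := by
  rw [homBracket, lamBracket_smul, diffHomPoly_smul]; rfl

lemma homBracket_sum {ι : Type*} (t : Finset ι) (g : DiffPoly J F) (h : ι → DiffPoly J F) :
    homBracket B u s z y g (∑ i ∈ t, h i) = ∑ i ∈ t, homBracket B u s z y g (h i) := by
  rw [homBracket, lamBracket_sum, map_sum]; rfl

lemma homBracket_der (g h : DiffPoly J F) :
    homBracket B u s z y g (der h) = lamDer (homBracket B u s z y g h) := by
  rw [homBracket, lamBracket_der, diffHomPoly_lamDer]; rfl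

lemma homBracket_C (g : DiffPoly J F) (c : F) :
    homBracket B u s z y g (MvPolynomial.C c) = 0 := by
  rw [homBracket, lamBracket_C, map_zero]

lemma homBracket_skew (hB : B.IsSymm) (g h : DiffPoly J F) :
    homBracket B u s z y h g = -adj (homBracket B u s z y g h) := by
  rw [homBracket, lamBracket_skew B u s z hB, map_neg, diffHomPoly_adj]; rfl

lemma homBracket_emb (hB : B.IsSymm) (a b : 𝔤) :
    homBracket B u s z y (emb u a) (emb u b) =
      Polynomial.C (diffHom y (emb u ⁅a, b⁆)) + cst (z * B s ⁅a, b⁆)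
        + cst (B a b) * Polynomial.X := by
  rw [homBracket, lamBracket_emb B u s z hB, map_add, diffHomPoly_C,
    map_mul (diffHomPoly y), diffHomPoly_cst, map_add, map_add, diffHom_C]
  simp [cst]

variable {J₀ J₁ K : Type*} [Fintype J₀] [Fintype J₁] [Fintype K]

lemma homBracket_genPhi (v v' : J₁ → 𝔤) (g : DiffPoly J F) (b : 𝔤) :
    homBracket B u s z y g (genPhi u v v' b) =
      homBracket B u s z y g (emb u b) + (1 / 2 : F) • ∑ k,
        (Polynomial.C (diffHom y (emb u ⁅b, v k⁆)) * homBracket B u s z y g (emb u (v' k))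
        + Polynomial.C (diffHom y (emb u (v' k))) * homBracket B u s z y g (emb u ⁅b, v k⁆)) := by
  simp only [genPhi, homBracket_add, homBracket_smul, homBracket_sum, homBracket_mul]

lemma homBracket_genPsi (e : 𝔤) (v v' : J₁ → 𝔤) (g : DiffPoly J F) (w : 𝔤) :
    homBracket B u s z y g (genPsi u e v v' w) =
      homBracket B u s z y g (emb u w)
      + (1 / 3 : F) • ∑ h, ∑ k,
        (Polynomial.C (diffHom y (emb u ⁅⁅w, v h⁆, v k⁆) * diffHom y (emb u (v' h)))
            * homBracket B u s z y g (emb u (v' k))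
          + Polynomial.C (diffHom y (emb u (v' k))) *
            (Polynomial.C (diffHom y (emb u ⁅⁅w, v h⁆, v k⁆)) *
                homBracket B u s z y g (emb u (v' h))
              + Polynomial.C (diffHom y (emb u (v' h))) *
                homBracket B u s z y g (emb u ⁅⁅w, v h⁆, v k⁆)))
      + ∑ k, (Polynomial.C (diffHom y (emb u ⁅w, v k⁆)) * homBracket B u s z y g (emb u (v' k))
        + Polynomial.C (diffHom y (emb u (v' k))) * homBracket B u s z y g (emb u ⁅w, v k⁆))
      + lamDer (homBracket B u s z y g (emb u ⁅e, w⁆)) := by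
  simp only [genPsi, homBracket_add, homBracket_smul, homBracket_sum, homBracket_mul,
    homBracket_der, map_mul (diffHom y)]

lemma homBracket_genL (x f : 𝔤) (a a' : J₀ → 𝔤) (v v' : J₁ → 𝔤) (g : DiffPoly J F) :
    homBracket B u s z y g (genL u x f a a' v v') =
      homBracket B u s z y g (emb u f) + lamDer (homBracket B u s z y g (emb u x))
      + (1 / 2 : F) • ∑ j,
        (Polynomial.C (diffHom y (emb u (a j))) * homBracket B u s z y g (emb u (a' j))
          + Polynomial.C (diffHom y (emb u (a' j))) * homBracket B u s z y g (emb u (a j)))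
      + ∑ k, (Polynomial.C (diffHom y (emb u (v' k))) * homBracket B u s z y g (emb u ⁅f, v k⁆)
          + Polynomial.C (diffHom y (emb u ⁅f, v k⁆)) * homBracket B u s z y g (emb u (v' k)))
      + (1 / 2 : F) • ∑ k,
        (Polynomial.C (diffHom y (emb u (v' k))) *
            lamDer (homBracket B u s z y g (emb u (v k)))
          + Polynomial.C (der (diffHom y (emb u (v k)))) *
            homBracket B u s z y g (emb u (v' k))) := by
  simp only [genL, homBracket_add, homBracket_smul, homBracket_sum, homBracket_mul,
    homBracket_der, diffHom_der]

lemma C_mul_cst (g : DiffPoly J F) (r : F) :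
    Polynomial.C g * cst r = Polynomial.C (r • g) := by
  rw [mul_comm, cst_mul_eq_smul, Polynomial.smul_C]

@[simp]
lemma cst_zero : cst (J := J) (0 : F) = 0 := by simp [cst]

lemma cst_neg (r : F) : cst (J := J) (-r) = -cst r := by simp [cst]

end HomBracket

section Rho

variable {F 𝔤 J : Type*} [Field F] [CharZero F] [LieRing 𝔤] [LieAlgebra F 𝔤]
  {B : LinearMap.BilinForm F 𝔤} {e x f : 𝔤} {u : Module.Basis J F 𝔤} {deg : J → ℚ}

/-- The images `ρ(u_j)`. -/
noncomputable def rhoGen (B : LinearMap.BilinForm F 𝔤) (u : Module.Basis J F 𝔤) (deg : J → ℚ)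
    (f : 𝔤) (j : J) : DiffPoly J F :=
  (if deg j ≤ 1 / 2 then MvPolynomial.X (j, 0) else 0) + MvPolynomial.C (B f (u j))

lemma rhoBracket_eq_homBracket (s : 𝔤) (z : F) (g h : DiffPoly J F) :
    rhoBracket B u deg f s z g h = homBracket B u s z (rhoGen B u deg f) g h := rfl

lemma diffHom_emb_eq (y : J → DiffPoly J F) (hdeg : ∀ j, u j ∈ grade F x (deg j)) {i : ℚ}
    (T : 𝔤 →ₗ[F] DiffPoly J F) (hT : ∀ j, deg j = i → y j = T (u j)) {a : 𝔤}
    (ha : a ∈ grade F x i) : diffHom y (emb u a) = T a := by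
  refine eqOn_grade hdeg (S := (diffHom y).toLinearMap ∘ₗ emb u) (T := T) (fun j hj => ?_) ha
  rw [LinearMap.comp_apply, emb_basis, AlgHom.toLinearMap_apply, diffHom_X_zero, hT j hj]

lemma IsMinimalGrading.rhoGen_of_le (M : IsMinimalGrading B e x f)
    (hdeg : ∀ j, u j ∈ grade F x (deg j)) {j : J} (hj : deg j ≤ 1 / 2) :
    rhoGen B u deg f j = MvPolynomial.X (j, 0) := by
  rw [rhoGen, if_pos hj, bilin_eq_zero M.inv M.f_mem (hdeg j) (by linarith), map_zero, add_zero]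

lemma IsMinimalGrading.rho_emb (M : IsMinimalGrading B e x f)
    (hdeg : ∀ j, u j ∈ grade F x (deg j)) {i : ℚ} (hi : i ≤ 1 / 2) {a : 𝔤}
    (ha : a ∈ grade F x i) : diffHom (rhoGen B u deg f) (emb u a) = emb u a := by
  refine diffHom_emb_eq _ hdeg (emb u) (fun j hj => ?_) ha
  rw [M.rhoGen_of_le hdeg (hj.trans_le hi), emb_basis]

lemma rho_emb_one (hdeg : ∀ j, u j ∈ grade F x (deg j)) {a : 𝔤}
    (ha : a ∈ grade F x 1) : diffHom (rhoGen B u deg f) (emb u a) = MvPolynomial.C (B f a) := by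
  refine diffHom_emb_eq _ hdeg ((Algebra.linearMap F (DiffPoly J F)) ∘ₗ (B f)) (fun j hj => ?_) ha
  rw [rhoGen, if_neg (by rw [hj]; norm_num), zero_add]
  rfl

lemma IsMinimalGrading.rho_of_mem_VLeHalf (M : IsMinimalGrading B e x f)
    (hdeg : ∀ j, u j ∈ grade F x (deg j)) {g : DiffPoly J F} (hg : g ∈ VLeHalf F deg) :
    diffHom (rhoGen B u deg f) g = g := by
  rw [VLeHalf, MvPolynomial.supported] at hg
  induction hg using Algebra.adjoin_induction with
  | mem g hg =>
    obtain ⟨⟨j, n⟩, hj, rfl⟩ := hg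
    rw [← iterate_der_X, diffHom_iterate_der, diffHom_X_zero, M.rhoGen_of_le hdeg hj]
  | algebraMap r => exact AlgHom.commutes _ r
  | add p q _ _ hp hq => rw [map_add, hp, hq]
  | mul p q _ _ hp hq => rw [map_mul, hp, hq]

lemma X_mem_VLeHalf {j : J} {n : ℕ} (hj : deg j ≤ 1 / 2) :
    MvPolynomial.X (j, n) ∈ VLeHalf F deg :=
  MvPolynomial.X_mem_supported.2 hj

lemma der_mem_VLeHalf {g : DiffPoly J F} (hg : g ∈ VLeHalf F deg) : der g ∈ VLeHalf F deg := by
  rw [VLeHalf, MvPolynomial.supported] at hg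
  induction hg using Algebra.adjoin_induction with
  | mem g hg =>
    obtain ⟨⟨j, n⟩, hj, rfl⟩ := hg
    rw [der_X]
    exact X_mem_VLeHalf hj
  | algebraMap r =>
    rw [MvPolynomial.algebraMap_eq, der_C]
    exact zero_mem _
  | add p q _ _ hp hq => rw [map_add]; exact add_mem hp hq
  | mul p q hp' hq' hp hq =>
    rw [Derivation.leibniz]
    exact add_mem (mul_mem hp' hq) (mul_mem hq' hp)

lemma emb_mem_VLeHalf (hdeg : ∀ j, u j ∈ grade F x (deg j)) {i : ℚ} (hi : i ≤ 1 / 2) {a : 𝔤}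
    (ha : a ∈ grade F x i) : emb u a ∈ VLeHalf F deg := by
  let q := (Subalgebra.toSubmodule (VLeHalf F deg)).mkQ
  have h1 := eqOn_grade hdeg (S := q ∘ₗ emb u) (T := 0) (fun j hj => by
    rw [LinearMap.comp_apply, emb_basis, LinearMap.zero_apply]
    exact (Submodule.Quotient.mk_eq_zero _).2 (X_mem_VLeHalf (hj.trans_le hi))) ha
  exact (Submodule.Quotient.mk_eq_zero _).1 h1

lemma rho_mem_VLeHalf (g : DiffPoly J F) : diffHom (rhoGen B u deg f) g ∈ VLeHalf F deg := by
  induction g using diffPoly_induction with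
  | hC c => rw [diffHom_C]; exact Subalgebra.algebraMap_mem _ c
  | hX j =>
    rw [diffHom_X_zero, rhoGen]
    refine add_mem ?_ (Subalgebra.algebraMap_mem _ _)
    split_ifs with hj
    · exact X_mem_VLeHalf hj
    · exact zero_mem _
  | hadd g h hg hh => rw [map_add]; exact add_mem hg hh
  | hmul g h hg hh => rw [map_mul]; exact mul_mem hg hh
  | hder g hg => rw [diffHom_der]; exact der_mem_VLeHalf hg

/-- Membership in `W` needs to be tested only on `𝔤_{1/2}` and `e`. -/
lemma IsMinimalGrading.mem_WAlg (M : IsMinimalGrading B e x f) {z : F} {g : DiffPoly J F}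
    (hg : g ∈ VLeHalf F deg)
    (hv : ∀ p ∈ grade F x (1 / 2), homBracket B u e z (rhoGen B u deg f) (emb u p) g = 0)
    (he : homBracket B u e z (rhoGen B u deg f) (emb u e) g = 0) :
    g ∈ WAlg B u deg x f e z := by
  have hlin : ∀ (r : F) (a : 𝔤), homBracket B u e z (rhoGen B u deg f) (emb u (r • a)) g =
      r • homBracket B u e z (rhoGen B u deg f) (emb u a) g := by
    intro r a
    rw [homBracket, map_smul, lamBracket_smul_left B u e z M.symm, diffHomPoly_smul]; rfl
  refine ⟨hg, fun a ha => ?_⟩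
  rw [rhoBracket_eq_homBracket]
  rw [gradeGeHalf] at ha
  induction ha using Submodule.iSup_induction' with
  | mem i a ha =>
    by_cases hi : 1 / 2 ≤ i
    · rw [iSup_pos hi] at ha
      by_cases h1 : i = 1 / 2
      · subst h1
        exact hv a ha
      · by_cases h2 : i = 1
        · subst h2
          obtain ⟨r, rfl⟩ := M.grade_one a ha
          rw [hlin, he, smul_zero]
        · rw [M.grade_eq_bot i (by linarith) (by linarith) (by linarith) h1 h2,
            Submodule.mem_bot] at ha
          rw [ha, ← zero_smul F e, hlin, zero_smul]
    · rw [iSup_neg hi, Submodule.mem_bot] at ha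
      rw [ha, ← zero_smul F e, hlin, zero_smul]
  | zero => rw [← zero_smul F e, hlin, zero_smul]
  | add a b _ _ ha hb =>
    rw [map_add, homBracket, lamBracket_add_left B u e z M.symm, map_add]
    exact (congrArg₂ (· + ·) ha hb).trans (add_zero 0)

end Rho

/-! ### The generators belong to the W-algebra -/

section Membership

variable {F 𝔤 J : Type*} [Field F] [CharZero F] [LieRing 𝔤] [LieAlgebra F 𝔤]
  {B : LinearMap.BilinForm F 𝔤} {e x f : 𝔤} {u : Module.Basis J F 𝔤} {deg : J → ℚ}
  (z : F) (hdeg : ∀ j, u j ∈ grade F x (deg j))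

/-- `{a _λ b}_{z,ρ}` for `a, b ∈ 𝔤`. -/
local notation "⟪" a ", " b "⟫" => homBracket B u e z (rhoGen B u deg f) (emb u a) (emb u b)

section Table

variable (M : IsMinimalGrading B e x f) {w y : 𝔤}
include M hdeg

lemma IsMinimalGrading.rho_half_half (hw : w ∈ grade F x (1 / 2)) (hy : y ∈ grade F x (1 / 2)) :
    ⟪w, y⟫ = cst (B f ⁅w, y⁆) := by
  have h1 : ⁅w, y⁆ ∈ grade F x 1 := lie_mem_grade hw hy (by norm_num)
  rw [homBracket_emb _ _ _ _ _ M.symm, rho_emb_one hdeg h1,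
    bilin_eq_zero M.inv M.e_mem h1 (by norm_num), bilin_eq_zero M.inv hw hy (by norm_num)]
  simp [cst]

lemma IsMinimalGrading.rho_half_zero (hw : w ∈ grade F x (1 / 2)) (hy : y ∈ grade F x 0) :
    ⟪w, y⟫ = Polynomial.C (emb u ⁅w, y⁆) := by
  have h1 : ⁅w, y⁆ ∈ grade F x (1 / 2) := lie_mem_grade hw hy (by norm_num)
  rw [homBracket_emb _ _ _ _ _ M.symm, M.rho_emb hdeg le_rfl h1,
    bilin_eq_zero M.inv M.e_mem h1 (by norm_num), bilin_eq_zero M.inv hw hy (by norm_num)]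
  simp

lemma IsMinimalGrading.rho_half_neg_half (hw : w ∈ grade F x (1 / 2))
    (hy : y ∈ grade F x (-1 / 2)) :
    ⟪w, y⟫ = Polynomial.C (emb u ⁅w, y⁆) + cst (B w y) * Polynomial.X := by
  have h1 : ⁅w, y⁆ ∈ grade F x 0 := lie_mem_grade hw hy (by norm_num)
  rw [homBracket_emb _ _ _ _ _ M.symm, M.rho_emb hdeg (by norm_num) h1,
    bilin_eq_zero M.inv M.e_mem h1 (by norm_num)]
  simp

lemma IsMinimalGrading.rho_half_f (hw : w ∈ grade F x (1 / 2)) :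
    ⟪w, f⟫ = Polynomial.C (emb u ⁅w, f⁆) := by
  have h1 : ⁅w, f⁆ ∈ grade F x (-1 / 2) := lie_mem_grade hw M.f_mem (by norm_num)
  rw [homBracket_emb _ _ _ _ _ M.symm, M.rho_emb hdeg (by norm_num) h1,
    bilin_eq_zero M.inv M.e_mem h1 (by norm_num), bilin_eq_zero M.inv hw M.f_mem (by norm_num)]
  simp

lemma IsMinimalGrading.rho_e_half (hy : y ∈ grade F x (1 / 2)) : ⟪e, y⟫ = 0 := by
  have h1 : ⁅e, y⁆ = 0 := M.eq_zero_of_one_lt (lie_mem_grade M.e_mem hy rfl) (by norm_num)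
  rw [homBracket_emb _ _ _ _ _ M.symm, h1, bilin_eq_zero M.inv M.e_mem hy (by norm_num)]
  simp

lemma IsMinimalGrading.rho_e_zero (hy : y ∈ grade F x 0) : ⟪e, y⟫ = cst (B f ⁅e, y⁆) := by
  have h1 : ⁅e, y⁆ ∈ grade F x 1 := lie_mem_grade M.e_mem hy (by norm_num)
  rw [homBracket_emb _ _ _ _ _ M.symm, rho_emb_one hdeg h1,
    bilin_eq_zero M.inv M.e_mem hy (by norm_num), bilin_eq_zero M.inv M.e_mem h1 (by norm_num)]
  simp [cst]

lemma IsMinimalGrading.rho_e_neg_half (hy : y ∈ grade F x (-1 / 2)) :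
    ⟪e, y⟫ = Polynomial.C (emb u ⁅e, y⁆) := by
  have h1 : ⁅e, y⁆ ∈ grade F x (1 / 2) := lie_mem_grade M.e_mem hy (by norm_num)
  rw [homBracket_emb _ _ _ _ _ M.symm, M.rho_emb hdeg le_rfl h1,
    bilin_eq_zero M.inv M.e_mem hy (by norm_num), bilin_eq_zero M.inv M.e_mem h1 (by norm_num)]
  simp

lemma IsMinimalGrading.rho_e_f :
    ⟪e, f⟫ = Polynomial.C ((2 : F) • emb u x) + cst (B e f) * Polynomial.X := by
  rw [homBracket_emb _ _ _ _ _ M.symm, M.lie_e_f, map_smul (emb u), map_smul (diffHom _),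
    M.rho_emb hdeg (by norm_num) IsMinimalGrading.x_mem, map_smul (B e),
    bilin_eq_zero M.inv M.e_mem IsMinimalGrading.x_mem (by norm_num)]
  simp

end Table

variable {J₀ J₁ K : Type*} [Fintype J₀] [Fintype J₁] [Fintype K]
  {a a' : J₀ → 𝔤} {v v' : J₁ → 𝔤} {c c' : K → 𝔤} (M : DualBases B e x f a a' v v' c c')

include M hdeg

namespace DualBases

lemma genPhi_mem {b : 𝔤} (hb : b ∈ gradeZeroCentralizer F x f) :
    genPhi u v v' b ∈ WAlg B u deg x f e z := by
  have hb0 := (IsMinimalGrading.mem_centralizer.1 hb).1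
  have hbv : ∀ k, ⁅b, v k⁆ ∈ grade F x (1 / 2) := fun k =>
    lie_mem_grade hb0 (M.v_mem k) (by norm_num)
  refine M.mem_WAlg ?_ (fun p hp => ?_) ?_
  · refine add_mem (emb_mem_VLeHalf hdeg (by norm_num) hb0)
      (Subalgebra.smul_mem _ (sum_mem fun k _ => mul_mem ?_ ?_) _)
    · exact emb_mem_VLeHalf hdeg le_rfl (hbv k)
    · exact emb_mem_VLeHalf hdeg le_rfl (M.v_mem' k)
  · have h1 : ∑ k, B f ⁅p, v' k⁆ • emb u ⁅b, v k⁆ = emb u ⁅b, p⁆ :=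
      M.sum_v (emb u ∘ₗ (LieAlgebra.ad F 𝔤 b : 𝔤 →ₗ[F] 𝔤)) hp
    have h2 : ∑ k, B f ⁅p, ⁅b, v k⁆⁆ • emb u (v' k) = emb u ⁅b, p⁆ := by
      simp_rw [M.omegaPlus_lie hb, neg_smul]
      rw [Finset.sum_neg_distrib, M.sum_v' _ (lie_mem_grade hb0 hp (by norm_num)), neg_neg]
    have h3 : ∀ k, Polynomial.C (diffHom (rhoGen B u deg f) (emb u ⁅b, v k⁆)) * ⟪p, v' k⟫ +
        Polynomial.C (diffHom (rhoGen B u deg f) (emb u (v' k))) * ⟪p, ⁅b, v k⁆⟫ =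
        Polynomial.C (B f ⁅p, v' k⁆ • emb u ⁅b, v k⁆ + B f ⁅p, ⁅b, v k⁆⁆ • emb u (v' k)) := by
      intro k
      rw [M.rho_half_half z hdeg hp (M.v_mem' k), M.rho_half_half z hdeg hp (hbv k),
        M.rho_emb hdeg le_rfl (hbv k), M.rho_emb hdeg le_rfl (M.v_mem' k), C_mul_cst, C_mul_cst,
        map_add]
    rw [homBracket_genPhi, M.rho_half_zero z hdeg hp hb0]
    simp_rw [h3]
    rw [← map_sum, Finset.sum_add_distrib, h1, h2, Polynomial.smul_C, ← map_add, ← two_smul F,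
      smul_smul, ← lie_skew, map_neg]
    norm_num
  · rw [homBracket_genPhi, M.rho_e_zero z hdeg hb0, M.lie_e_centralizer hb]
    simp [M.rho_e_half z hdeg (M.v_mem' _), M.rho_e_half z hdeg (hbv _)]

/-- The cubic terms of `{p _λ ψ(w)}_ρ` for `p ∈ 𝔤_{1/2}`. -/
lemma sum_cubic {w p : 𝔤} (hw : w ∈ grade F x (-1 / 2)) (hp : p ∈ grade F x (1 / 2)) :
    ∑ h, ∑ k, (B f ⁅p, v' k⁆ • (emb u ⁅⁅w, v h⁆, v k⁆ * emb u (v' h))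
        + (B f ⁅p, v' h⁆ • (emb u ⁅⁅w, v h⁆, v k⁆ * emb u (v' k))
          + B f ⁅p, ⁅⁅w, v h⁆, v k⁆⁆ • (emb u (v' h) * emb u (v' k)))) =
      (3 : F) • ∑ k, emb u ⁅⁅w, v k⁆, p⁆ * emb u (v' k) := by
  set T := ∑ k, emb u ⁅⁅w, v k⁆, p⁆ * emb u (v' k) with hT
  have hew : ⁅e, w⁆ ∈ grade F x (1 / 2) := lie_mem_grade M.e_mem hw (by norm_num)
  have hwv : ∀ k, ⁅w, v k⁆ ∈ grade F x 0 := fun k => lie_mem_grade hw (M.v_mem k) (by norm_num)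
  have h1 : ∑ h, ∑ k, B f ⁅p, v' k⁆ • (emb u ⁅⁅w, v h⁆, v k⁆ * emb u (v' h)) = T := by
    refine Finset.sum_congr rfl fun h _ => ?_
    have h2 := M.sum_v (emb u ∘ₗ (LieAlgebra.ad F 𝔤 ⁅w, v h⁆ : 𝔤 →ₗ[F] 𝔤)) hp
    simp only [LinearMap.comp_apply, LieAlgebra.ad_apply] at h2
    rw [← h2, Finset.sum_mul]
    exact Finset.sum_congr rfl fun k _ => (smul_mul_assoc _ _ _).symm
  -- `[[w, p], v_k]` and `[[w, v_k], p]` differ by `[w, [p, v_k]] ∈ F [e, w]`; the resulting extra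
  -- terms of this sum and the next one cancel.
  have h2 : ∑ h, ∑ k, B f ⁅p, v' h⁆ • (emb u ⁅⁅w, v h⁆, v k⁆ * emb u (v' k)) =
      T + (B e f)⁻¹ • (emb u ⁅e, w⁆ * emb u p) := by
    rw [Finset.sum_comm]
    have h3 : ∀ k, ∑ h, B f ⁅p, v' h⁆ • (emb u ⁅⁅w, v h⁆, v k⁆ * emb u (v' k)) =
        emb u ⁅⁅w, v k⁆, p⁆ * emb u (v' k)
          - (B e f)⁻¹ • (emb u ⁅e, w⁆ * (B f ⁅p, v k⁆ • emb u (v' k))) := by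
      intro k
      have h4 : emb u ⁅⁅w, p⁆, v k⁆ = ∑ h, B f ⁅p, v' h⁆ • emb u ⁅⁅w, v h⁆, v k⁆ := by
        conv_lhs => rw [← M.expand_v p hp]
        simp only [lie_sum, lie_smul, sum_lie, smul_lie, map_sum, map_smul]
      have h5 : ⁅⁅w, p⁆, v k⁆ = ⁅⁅w, v k⁆, p⁆ - (B f ⁅p, v k⁆ / B e f) • ⁅e, w⁆ := by
        have h6 : ⁅w, ⁅p, v k⁆⁆ = -((B f ⁅p, v k⁆ / B e f) • ⁅e, w⁆) := by
          rw [← lie_skew e w, smul_neg, neg_neg, ← lie_smul, ← M.lie_eq_smul_e hp (M.v_mem k)]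
        rw [leibniz_lie, ← lie_skew p ⁅w, v k⁆, ← sub_eq_add_neg, sub_eq_iff_eq_add] at h6
        rw [h6]
        abel
      have h6 : ∑ h, B f ⁅p, v' h⁆ • (emb u ⁅⁅w, v h⁆, v k⁆ * emb u (v' k)) =
          emb u ⁅⁅w, p⁆, v k⁆ * emb u (v' k) := by
        rw [h4, Finset.sum_mul]
        simp only [smul_mul_assoc]
      rw [h6, h5, map_sub, map_smul, sub_mul, mul_smul_comm, smul_mul_assoc, smul_smul,
        div_eq_inv_mul]
    simp_rw [h3]
    rw [Finset.sum_sub_distrib, ← hT, ← Finset.smul_sum, ← Finset.mul_sum, M.sum_v' (emb u) hp,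
      mul_neg, smul_neg, sub_neg_eq_add]
  have h3 : ∑ h, ∑ k, B f ⁅p, ⁅⁅w, v h⁆, v k⁆⁆ • (emb u (v' h) * emb u (v' k)) =
      T - (B e f)⁻¹ • (emb u ⁅e, w⁆ * emb u p) := by
    have h4 : ∀ h, ∑ k, B f ⁅p, ⁅⁅w, v h⁆, v k⁆⁆ • (emb u (v' h) * emb u (v' k)) =
        emb u ⁅⁅w, v h⁆, p⁆ * emb u (v' h)
          + (B e f)⁻¹ • ((B f ⁅⁅e, w⁆, v h⁆ • emb u (v' h)) * emb u p) := by
      intro h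
      have h5 : ∀ k, B f ⁅p, ⁅⁅w, v h⁆, v k⁆⁆ =
          -(B f ⁅⁅e, w⁆, v h⁆ / B e f) * B f ⁅p, v k⁆ - B f ⁅⁅⁅w, v h⁆, p⁆, v k⁆ := by
        intro k
        have h6 : B f ⁅⁅w, v h⁆, ⁅p, v k⁆⁆ = -(B f ⁅⁅e, w⁆, v h⁆ / B e f) * B f ⁅p, v k⁆ := by
          have h7 : ⁅⁅w, v h⁆, e⁆ = -⁅⁅e, w⁆, v h⁆ := by
            have h8 : ⁅e, v h⁆ = 0 :=
              M.eq_zero_of_one_lt (lie_mem_grade M.e_mem (M.v_mem h) rfl) (by norm_num)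
            rw [← lie_skew, leibniz_lie, h8, lie_zero, add_zero]
          rw [M.lie_eq_smul_e hp (M.v_mem k), lie_smul, map_smul, h7, map_neg, map_smul,
            M.bilin_comm f e, smul_eq_mul, smul_eq_mul, div_mul_cancel₀ _ M.bilin_e_f]
          ring
        rw [← h6, leibniz_lie ⁅w, v h⁆ p (v k), map_add]
        ring
      simp_rw [h5, sub_smul, Finset.sum_sub_distrib, mul_smul, ← Finset.smul_sum,
        ← mul_smul_comm _ (emb u (v' h)), ← Finset.mul_sum]
      rw [M.sum_v' (emb u) hp, M.sum_v' (emb u) (lie_mem_grade (hwv h) hp (by norm_num)),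
        mul_neg, mul_neg, smul_neg, neg_smul, neg_neg, sub_neg_eq_add, smul_mul_assoc, smul_smul,
        div_eq_inv_mul]
      ring
    simp_rw [h4]
    rw [Finset.sum_add_distrib, ← hT, ← Finset.smul_sum, ← Finset.sum_mul,
      M.sum_v' (emb u) hew, neg_mul, smul_neg, sub_eq_add_neg]
  simp_rw [Finset.sum_add_distrib]
  rw [h1, h2, h3]
  module

lemma genPsi_mem {w : 𝔤} (hw : w ∈ grade F x (-1 / 2)) :
    genPsi u e v v' w ∈ WAlg B u deg x f e z := by
  have hew : ⁅e, w⁆ ∈ grade F x (1 / 2) := lie_mem_grade M.e_mem hw (by norm_num)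
  have hwv : ∀ k, ⁅w, v k⁆ ∈ grade F x 0 := fun k => lie_mem_grade hw (M.v_mem k) (by norm_num)
  have hwvv : ∀ h k, ⁅⁅w, v h⁆, v k⁆ ∈ grade F x (1 / 2) := fun h k =>
    lie_mem_grade (hwv h) (M.v_mem k) (by norm_num)
  refine M.mem_WAlg ?_ (fun p hp => ?_) ?_
  · refine add_mem (add_mem (add_mem (emb_mem_VLeHalf hdeg (by norm_num) hw) ?_) ?_) ?_
    · exact Subalgebra.smul_mem _ (sum_mem fun h _ => sum_mem fun k _ => mul_mem (mul_mem
        (emb_mem_VLeHalf hdeg le_rfl (hwvv h k)) (emb_mem_VLeHalf hdeg le_rfl (M.v_mem' h)))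
        (emb_mem_VLeHalf hdeg le_rfl (M.v_mem' k))) _
    · exact sum_mem fun k _ => mul_mem (emb_mem_VLeHalf hdeg (by norm_num) (hwv k))
        (emb_mem_VLeHalf hdeg le_rfl (M.v_mem' k))
    · exact der_mem_VLeHalf (emb_mem_VLeHalf hdeg le_rfl hew)
  · have h1 : ∀ h k,
        Polynomial.C (diffHom (rhoGen B u deg f) (emb u ⁅⁅w, v h⁆, v k⁆)
              * diffHom (rhoGen B u deg f) (emb u (v' h))) * ⟪p, v' k⟫
          + Polynomial.C (diffHom (rhoGen B u deg f) (emb u (v' k))) *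
            (Polynomial.C (diffHom (rhoGen B u deg f) (emb u ⁅⁅w, v h⁆, v k⁆)) * ⟪p, v' h⟫
              + Polynomial.C (diffHom (rhoGen B u deg f) (emb u (v' h))) * ⟪p, ⁅⁅w, v h⁆, v k⁆⟫) =
        Polynomial.C (B f ⁅p, v' k⁆ • (emb u ⁅⁅w, v h⁆, v k⁆ * emb u (v' h))
          + (B f ⁅p, v' h⁆ • (emb u ⁅⁅w, v h⁆, v k⁆ * emb u (v' k))
          + B f ⁅p, ⁅⁅w, v h⁆, v k⁆⁆ • (emb u (v' h) * emb u (v' k)))) := by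
      intro h k
      rw [M.rho_half_half z hdeg hp (M.v_mem' k), M.rho_half_half z hdeg hp (M.v_mem' h),
        M.rho_half_half z hdeg hp (hwvv h k), M.rho_emb hdeg le_rfl (hwvv h k),
        M.rho_emb hdeg le_rfl (M.v_mem' h), M.rho_emb hdeg le_rfl (M.v_mem' k), C_mul_cst,
        C_mul_cst, C_mul_cst, ← Polynomial.C_add, ← Polynomial.C_mul, ← Polynomial.C_add]
      congr 2
      rw [mul_add, mul_smul_comm, mul_smul_comm, mul_comm (emb u (v' k)),
        mul_comm (emb u (v' k))]
    have h2 : ∀ k, Polynomial.C (diffHom (rhoGen B u deg f) (emb u ⁅w, v k⁆)) * ⟪p, v' k⟫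
          + Polynomial.C (diffHom (rhoGen B u deg f) (emb u (v' k))) * ⟪p, ⁅w, v k⁆⟫ =
        Polynomial.C (B f ⁅p, v' k⁆ • emb u ⁅w, v k⁆
          - emb u ⁅⁅w, v k⁆, p⁆ * emb u (v' k)) := by
      intro k
      rw [M.rho_half_half z hdeg hp (M.v_mem' k), M.rho_half_zero z hdeg hp (hwv k),
        M.rho_emb hdeg (by norm_num) (hwv k), M.rho_emb hdeg le_rfl (M.v_mem' k), C_mul_cst,
        ← map_mul, ← map_add, ← lie_skew p ⁅w, v k⁆, map_neg]
      congr 1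
      ring
    have h3 : ∑ k, B f ⁅p, v' k⁆ • emb u ⁅w, v k⁆ = emb u ⁅w, p⁆ :=
      M.sum_v (emb u ∘ₗ (LieAlgebra.ad F 𝔤 w : 𝔤 →ₗ[F] 𝔤)) hp
    have h4 : B f ⁅p, ⁅e, w⁆⁆ = -B p w := by
      rw [M.bilin_comm p w, M.bilin_eq_omegaPlus hw, ← lie_skew, map_neg]
    rw [homBracket_genPsi, M.rho_half_neg_half z hdeg hp hw, M.rho_half_half z hdeg hp hew,
      lamDer_cst, h4]
    simp_rw [h1, h2, ← map_sum]
    rw [M.sum_cubic hdeg hw hp, Finset.sum_sub_distrib, h3, Polynomial.smul_C, smul_smul,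
      ← lie_skew p w, map_neg, cst_neg]
    simp only [map_neg, map_sub]
    norm_num
    ring
  · have h1 : ∀ k, Polynomial.C (diffHom (rhoGen B u deg f) (emb u (v' k))) * ⟪e, ⁅w, v k⁆⟫ =
        Polynomial.C (B f ⁅⁅e, w⁆, v k⁆ • emb u (v' k)) := by
      intro k
      have h2 : ⁅e, v k⁆ = 0 :=
        M.eq_zero_of_one_lt (lie_mem_grade M.e_mem (M.v_mem k) rfl) (by norm_num)
      rw [M.rho_e_zero z hdeg (hwv k), M.rho_emb hdeg le_rfl (M.v_mem' k), C_mul_cst, leibniz_lie,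
        h2, lie_zero, add_zero]
    rw [homBracket_genPsi, M.rho_e_neg_half z hdeg hw, M.rho_e_half z hdeg hew]
    simp_rw [M.rho_e_half z hdeg (M.v_mem' _), M.rho_e_half z hdeg (hwvv _ _), h1]
    simp only [mul_zero, add_zero, zero_add, Finset.sum_const_zero, smul_zero, map_zero]
    rw [← map_sum, M.sum_v' (emb u) hew, ← map_add, add_neg_cancel, map_zero]

lemma genL_mem : genL u x f a a' v v' ∈ WAlg B u deg x f e z := by
  have hx : x ∈ grade F x 0 := IsMinimalGrading.x_mem
  have hfv : ∀ k, ⁅f, v k⁆ ∈ grade F x (-1 / 2) := fun k =>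
    lie_mem_grade M.f_mem (M.v_mem k) (by norm_num)
  refine M.mem_WAlg ?_ (fun p hp => ?_) ?_
  · refine add_mem (add_mem (add_mem (add_mem (emb_mem_VLeHalf hdeg (by norm_num) M.f_mem)
      (der_mem_VLeHalf (emb_mem_VLeHalf hdeg (by norm_num) hx))) ?_) ?_) ?_
    · exact Subalgebra.smul_mem _ (sum_mem fun j _ => mul_mem
        (emb_mem_VLeHalf hdeg (by norm_num) (M.a_mem j))
        (emb_mem_VLeHalf hdeg (by norm_num) (M.a_mem' j))) _
    · exact sum_mem fun k _ => mul_mem (emb_mem_VLeHalf hdeg le_rfl (M.v_mem' k))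
        (emb_mem_VLeHalf hdeg (by norm_num) (hfv k))
    · exact Subalgebra.smul_mem _ (sum_mem fun k _ => mul_mem
        (emb_mem_VLeHalf hdeg le_rfl (M.v_mem' k))
        (der_mem_VLeHalf (emb_mem_VLeHalf hdeg le_rfl (M.v_mem k)))) _
  · have h1 : ∀ j, Polynomial.C (diffHom (rhoGen B u deg f) (emb u (a j))) * ⟪p, a' j⟫
          + Polynomial.C (diffHom (rhoGen B u deg f) (emb u (a' j))) * ⟪p, a j⟫ =
        Polynomial.C (emb u (a j) * emb u ⁅p, a' j⁆ + emb u (a' j) * emb u ⁅p, a j⁆) := by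
      intro j
      rw [M.rho_half_zero z hdeg hp (M.a_mem j), M.rho_half_zero z hdeg hp (M.a_mem' j),
        M.rho_emb hdeg (by norm_num) (M.a_mem j), M.rho_emb hdeg (by norm_num) (M.a_mem' j),
        map_add, map_mul, map_mul]
    have h2 : ∀ k, Polynomial.C (diffHom (rhoGen B u deg f) (emb u (v' k))) * ⟪p, ⁅f, v k⁆⟫
          + Polynomial.C (diffHom (rhoGen B u deg f) (emb u ⁅f, v k⁆)) * ⟪p, v' k⟫ =
        Polynomial.C (emb u (v' k) * emb u ⁅p, ⁅f, v k⁆⁆ + B f ⁅p, v' k⁆ • emb u ⁅f, v k⁆)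
          - Polynomial.C (B f ⁅p, v k⁆ • emb u (v' k)) * Polynomial.X := by
      intro k
      have h3 : B p ⁅f, v k⁆ = -B f ⁅p, v k⁆ := by
        rw [← M.inv, ← lie_skew, map_neg, LinearMap.neg_apply, M.inv]
      rw [M.rho_half_neg_half z hdeg hp (hfv k), M.rho_half_half z hdeg hp (M.v_mem' k),
        M.rho_emb hdeg le_rfl (M.v_mem' k), M.rho_emb hdeg (by norm_num) (hfv k), C_mul_cst, h3,
        mul_add, ← mul_assoc, C_mul_cst, neg_smul, map_neg, map_add, map_mul]
      ring
    have h4 : ∀ k, Polynomial.C (diffHom (rhoGen B u deg f) (emb u (v' k))) *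
            lamDer ⟪p, v k⟫
          + Polynomial.C (der (diffHom (rhoGen B u deg f) (emb u (v k)))) * ⟪p, v' k⟫ =
        Polynomial.C (B f ⁅p, v k⁆ • emb u (v' k)) * Polynomial.X
          + Polynomial.C (B f ⁅p, v' k⁆ • der (emb u (v k))) := by
      intro k
      rw [M.rho_half_half z hdeg hp (M.v_mem' k), M.rho_half_half z hdeg hp (M.v_mem k),
        M.rho_emb hdeg le_rfl (M.v_mem' k), M.rho_emb hdeg le_rfl (M.v_mem k), C_mul_cst,
        lamDer_cst, ← mul_assoc, C_mul_cst]
    have h5 : ∑ k, B f ⁅p, v' k⁆ • emb u ⁅f, v k⁆ = emb u ⁅f, p⁆ :=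
      M.sum_v (emb u ∘ₗ (LieAlgebra.ad F 𝔤 f : 𝔤 →ₗ[F] 𝔤)) hp
    have h6 : ∑ k, B f ⁅p, v' k⁆ • der (emb u (v k)) = der (emb u p) :=
      M.sum_v ((der (F := F) (J := J)).toLinearMap ∘ₗ emb u) hp
    have h7 := M.sum_v' (emb u) hp
    have h8 : ∑ j, emb u (a j) * emb u ⁅p, a' j⁆ = ∑ j, emb u (a' j) * emb u ⁅p, a j⁆ :=
      M.sum_a_mul_a' (emb u) (emb u ∘ₗ (LieAlgebra.ad F 𝔤 p : 𝔤 →ₗ[F] 𝔤))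
    -- Expand `[p, [f, v_k]] ∈ 𝔤_0` in the basis `a^j` to compare with the terms `a_j a^j`.
    have h9 : ∑ k, emb u (v' k) * emb u ⁅p, ⁅f, v k⁆⁆ =
        -∑ j, emb u (a' j) * emb u ⁅p, a j⁆ := by
      have h10 : ∀ k, emb u ⁅p, ⁅f, v k⁆⁆ =
          ∑ j, B f ⁅⁅p, a j⁆, v k⁆ • emb u (a' j) := by
        intro k
        rw [← M.sum_a' (emb u) (lie_mem_grade hp (hfv k) (by norm_num))]
        refine Finset.sum_congr rfl fun j _ => ?_
        congr 1
        rw [M.bilin_comm, ← M.inv, M.bilin_comm, M.inv, ← lie_skew ⁅p, a j⁆ (v k),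
          ← lie_skew p (a j), lie_neg, neg_neg]
      simp_rw [h10, Finset.mul_sum]
      rw [Finset.sum_comm, ← Finset.sum_neg_distrib]
      refine Finset.sum_congr rfl fun j _ => ?_
      have h11 := M.sum_v' (emb u) (lie_mem_grade hp (M.a_mem j) (by norm_num) :
        ⁅p, a j⁆ ∈ grade F x (1 / 2))
      rw [← neg_eq_iff_eq_neg] at h11
      rw [← h11, mul_neg, neg_neg, Finset.mul_sum]
      exact Finset.sum_congr rfl fun k _ => by
        rw [mul_smul_comm, mul_smul_comm, mul_comm]
    have h12 : ⁅p, x⁆ = (-(1 / 2) : F) • p := by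
      rw [← lie_skew, mem_grade.1 hp, neg_smul]
      norm_num
    rw [homBracket_genL, M.rho_half_f z hdeg hp, M.rho_half_zero z hdeg hp hx, h12]
    simp_rw [h1, h2, h4]
    rw [Finset.sum_sub_distrib, Finset.sum_add_distrib, ← Finset.sum_mul, ← map_sum, ← map_sum,
      ← map_sum, ← map_sum, Finset.sum_add_distrib, Finset.sum_add_distrib, h5, h6, h7, h8, h9,
      ← lie_skew, lamDer_C]
    have h13 : -Polynomial.C (emb u p) * Polynomial.X =
        -(Polynomial.C (emb u p) * Polynomial.X) := by ring
    simp only [map_neg, map_add, map_smul, Derivation.map_smul, ← Polynomial.smul_C,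
      smul_mul_assoc, h13]
    module
  · have h1 : ∀ j, Polynomial.C (diffHom (rhoGen B u deg f) (emb u (a j))) * ⟪e, a' j⟫
          + Polynomial.C (diffHom (rhoGen B u deg f) (emb u (a' j))) * ⟪e, a j⟫ =
        Polynomial.C (-(2 : F) • (B x (a' j) • emb u (a j) + B x (a j) • emb u (a' j))) := by
      have h2 : ∀ y, B f ⁅e, y⁆ = -2 * B x y := by
        intro y
        rw [← M.inv, M.lie_f_e, map_neg, map_smul, LinearMap.neg_apply, LinearMap.smul_apply,
          smul_eq_mul]
        ring
      intro j
      rw [M.rho_e_zero z hdeg (M.a_mem j), M.rho_e_zero z hdeg (M.a_mem' j),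
        M.rho_emb hdeg (by norm_num) (M.a_mem j), M.rho_emb hdeg (by norm_num) (M.a_mem' j),
        C_mul_cst, C_mul_cst, h2, h2, ← map_add, smul_add, smul_smul, smul_smul]
    have h2 : ∀ k, Polynomial.C (diffHom (rhoGen B u deg f) (emb u (v' k))) * ⟪e, ⁅f, v k⁆⟫ =
        Polynomial.C (emb u (v' k) * emb u (v k)) := by
      intro k
      rw [M.rho_e_neg_half z hdeg (hfv k), M.lie_e_lie_f (M.v_mem k),
        M.rho_emb hdeg le_rfl (M.v_mem' k), map_mul]
    rw [homBracket_genL, M.rho_e_f z hdeg, M.rho_e_zero z hdeg hx, lamDer_cst, M.lie_e_x, map_neg,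
      M.bilin_comm f e, cst_neg]
    simp_rw [M.rho_e_half z hdeg (M.v_mem' _), M.rho_e_half z hdeg (M.v_mem _), h1, h2]
    simp only [map_zero, mul_zero, add_zero, Finset.sum_const_zero, smul_zero]
    rw [← map_sum, ← map_sum, M.sum_v'_mul_v (emb u), ← Finset.smul_sum, Finset.sum_add_distrib,
      M.sum_a (emb u) hx, M.sum_a' (emb u) hx, map_zero, add_zero, Polynomial.smul_C, smul_smul,
      ← two_smul F, smul_smul]
    have h3 : (1 / 2 * -2 * 2 : F) = -2 := by norm_num
    rw [h3, neg_smul, map_neg]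
    ring

end DualBases

end Membership

/-! ### Slices of derivations -/

section Slice

variable {F A ι : Type*} [Field F] [CharZero F] [CommRing A] [IsDomain A] [Algebra F A]
  {R : Subalgebra F A} {y : ι → A} {E : ι → Derivation F A A}

lemma derivation_aeval_eq_aeval_pderiv [DecidableEq ι] (hR : ∀ i, ∀ r ∈ R, E i r = 0)
    (hy : ∀ i j, E i (y j) = if i = j then 1 else 0) (p : MvPolynomial ι R) (i : ι) :
    E i (MvPolynomial.aeval y p) = MvPolynomial.aeval y (MvPolynomial.pderiv i p) := by
  induction p using MvPolynomial.induction_on with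
  | C r =>
    rw [MvPolynomial.aeval_C, MvPolynomial.pderiv_C, map_zero]
    exact hR i _ r.2
  | add p q hp hq => simp only [map_add, hp, hq]
  | mul_X p j hp =>
    simp only [map_mul, Derivation.leibniz, hp, hy, MvPolynomial.aeval_X, MvPolynomial.pderiv_X,
      smul_eq_mul, map_add, Pi.single_apply, eq_comm (a := i)]
    congr 2
    split_ifs <;> simp

lemma eq_C_of_pderiv_eq_zero {p : MvPolynomial ι R} (h : ∀ i, MvPolynomial.pderiv i p = 0) :
    p = MvPolynomial.C (p.coeff 0) := by
  classical
  ext1 m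
  rw [MvPolynomial.coeff_C]
  split_ifs with hm
  · rw [hm]
  · obtain ⟨i, hi⟩ : ∃ i, m i ≠ 0 := by
      by_contra! h0
      exact hm (Finsupp.ext fun i => (h0 i).symm)
    have h1 := congrArg (MvPolynomial.coeff (m - Finsupp.single i 1)) (h i)
    have h2 : Finsupp.single i 1 ≤ m := Finsupp.single_le_iff.2 (Nat.one_le_iff_ne_zero.2 hi)
    rw [MvPolynomial.coeff_pderiv, tsub_add_cancel_of_le h2, MvPolynomial.coeff_zero] at h1
    refine (mul_eq_zero.1 h1).resolve_right ?_
    have : CharZero R := charZero_of_injective_algebraMap (algebraMap F R).injective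
    exact Nat.cast_add_one_ne_zero _

/-- If derivations `E_i` vanish on `R` and satisfy `E_i y_j = δ_{ij}`, then the `y_j` are
algebraically independent over `R`. -/
lemma aeval_injective_of_slice [DecidableEq ι] (hR : ∀ i, ∀ r ∈ R, E i r = 0)
    (hy : ∀ i j, E i (y j) = if i = j then 1 else 0) (p : MvPolynomial ι R)
    (hp : MvPolynomial.aeval y p = 0) : p = 0 := by
  suffices H : ∀ (n : ℕ) (p : MvPolynomial ι R), p.totalDegree ≤ n →
      MvPolynomial.aeval y p = 0 → p = 0 from H _ p le_rfl hp
  have hC : ∀ p : MvPolynomial ι R, (∀ i, MvPolynomial.pderiv i p = 0) →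
      MvPolynomial.aeval y p = 0 → p = 0 := by
    intro p h1 h2
    rw [eq_C_of_pderiv_eq_zero h1, MvPolynomial.aeval_C] at h2
    have h3 : p.coeff 0 = 0 := Subtype.ext h2
    rw [eq_C_of_pderiv_eq_zero h1, h3, map_zero]
  have hd : ∀ (p : MvPolynomial ι R) (i : ι) (m : ι →₀ ℕ),
      m ∈ (MvPolynomial.pderiv i p).support → m.degree + 1 ≤ p.totalDegree := by
    intro p i m hm
    rw [MvPolynomial.mem_support_iff, MvPolynomial.coeff_pderiv] at hm
    have h1 := MvPolynomial.le_totalDegree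
      (MvPolynomial.mem_support_iff.2 (left_ne_zero_of_mul hm))
    have h2 : (m + Finsupp.single i 1).degree = m.degree + 1 := by
      rw [map_add, Finsupp.degree_single]
    rw [← h2]
    exact h1
  intro n
  induction n with
  | zero =>
    intro p hp h0
    refine hC p (fun i => ?_) h0
    by_contra h1
    obtain ⟨m, hm⟩ := MvPolynomial.support_nonempty.2 h1
    have := hd p i m hm
    omega
  | succ n ih =>
    intro p hp h0
    refine hC p (fun i => ih _ ?_ ?_) h0
    · refine Finset.sup_le fun m hm => ?_
      have h1 := hd p i m hm
      have h2 : (m.sum fun _ e => e) = m.degree := rfl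
      omega
    · rw [← derivation_aeval_eq_aeval_pderiv hR hy, h0, map_zero]

/-- If derivations `E_i` vanish on `R` and satisfy `E_i y_j = δ_{ij}`, then an element of `R[y]`
killed by all `E_i` lies in `R`. -/
lemma mem_of_derivation_eq_zero [DecidableEq ι] (hR : ∀ i, ∀ r ∈ R, E i r = 0)
    (hy : ∀ i j, E i (y j) = if i = j then 1 else 0) {g : A}
    (hg : g ∈ Algebra.adjoin F ((R : Set A) ∪ Set.range y)) (hg0 : ∀ i, E i g = 0) : g ∈ R := by
  obtain ⟨p, rfl⟩ : ∃ p : MvPolynomial ι R, MvPolynomial.aeval y p = g := by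
    clear hg0
    induction hg using Algebra.adjoin_induction with
    | mem g hg =>
      rcases hg with hg | ⟨i, rfl⟩
      · exact ⟨MvPolynomial.C ⟨g, hg⟩, by rw [MvPolynomial.aeval_C]; rfl⟩
      · exact ⟨MvPolynomial.X i, MvPolynomial.aeval_X _ _⟩
    | algebraMap r =>
      exact ⟨MvPolynomial.C (algebraMap F R r), by rw [MvPolynomial.aeval_C]; rfl⟩
    | add g h _ _ hg hh =>
      obtain ⟨p, rfl⟩ := hg
      obtain ⟨q, rfl⟩ := hh
      exact ⟨p + q, map_add _ _ _⟩
    | mul g h _ _ hg hh =>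
      obtain ⟨p, rfl⟩ := hg
      obtain ⟨q, rfl⟩ := hh
      exact ⟨p * q, map_mul _ _ _⟩
  have h1 : ∀ i, MvPolynomial.pderiv i p = 0 := fun i =>
    aeval_injective_of_slice hR hy _ (by rw [← derivation_aeval_eq_aeval_pderiv hR hy, hg0])
  rw [eq_C_of_pderiv_eq_zero h1, MvPolynomial.aeval_C]
  exact (p.coeff 0).2

end Slice

/-! ### The W-algebra is generated by `L`, `φ` and `ψ` -/

section Generation

variable {F 𝔤 J : Type*} [Field F] [CharZero F] [LieRing 𝔤] [LieAlgebra F 𝔤]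
  {B : LinearMap.BilinForm F 𝔤} {e x f : 𝔤} {u : Module.Basis J F 𝔤} {deg : J → ℚ}

lemma der_mem_adjoin {S : Set (DiffPoly J F)} (hS : ∀ g ∈ S, der g ∈ Algebra.adjoin F S)
    {g : DiffPoly J F} (hg : g ∈ Algebra.adjoin F S) : der g ∈ Algebra.adjoin F S := by
  induction hg using Algebra.adjoin_induction with
  | mem g hg => exact hS g hg
  | algebraMap r =>
    rw [MvPolynomial.algebraMap_eq, der_C]
    exact zero_mem _
  | add p q _ _ hp hq => rw [map_add]; exact add_mem hp hq
  | mul p q hp' hq' hp hq =>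
    rw [Derivation.leibniz]
    exact add_mem (mul_mem hp' hq) (mul_mem hq' hp)

lemma iterate_der_mem {S : Subalgebra F (DiffPoly J F)} (hS : ∀ g ∈ S, der g ∈ S)
    {g : DiffPoly J F} (hg : g ∈ S) (n : ℕ) : (⇑(der (F := F) (J := J)))^[n] g ∈ S := by
  induction n with
  | zero => exact hg
  | succ n ih => rw [Function.iterate_succ_apply']; exact hS _ ih

/-- The derivation of `V` that agrees on `V(𝔤_{≤ 1/2})` with the coefficient of `λⁿ` in
`{a _λ ·}_{z,ρ}`. -/
noncomputable def rhoCoeffDer (B : LinearMap.BilinForm F 𝔤) (u : Module.Basis J F 𝔤)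
    (deg : J → ℚ) (f s : 𝔤) (z : F) (a : 𝔤) (n : ℕ) :
    Derivation F (DiffPoly J F) (DiffPoly J F) :=
  MvPolynomial.mkDerivation F fun p =>
    (homBracket B u s z (rhoGen B u deg f) (emb u a) (MvPolynomial.X p)).coeff n

lemma IsMinimalGrading.rhoCoeffDer_apply (M : IsMinimalGrading B e x f)
    (hdeg : ∀ j, u j ∈ grade F x (deg j)) (s : 𝔤) (z : F) (a : 𝔤) (n : ℕ) {g : DiffPoly J F}
    (hg : g ∈ VLeHalf F deg) :
    rhoCoeffDer B u deg f s z a n g =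
      (homBracket B u s z (rhoGen B u deg f) (emb u a) g).coeff n := by
  have hg' := hg
  rw [VLeHalf, MvPolynomial.supported] at hg'
  induction hg' using Algebra.adjoin_induction with
  | mem g hg' =>
    obtain ⟨⟨j, n⟩, hj, rfl⟩ := hg'
    exact MvPolynomial.mkDerivation_X _ _ _
  | algebraMap r =>
    rw [MvPolynomial.algebraMap_eq, homBracket_C, MvPolynomial.derivation_C, Polynomial.coeff_zero]
  | add p q hp' hq' hp hq =>
    rw [map_add, homBracket_add, Polynomial.coeff_add, hp hp', hq hq']
  | mul p q hp' hq' hp hq =>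
    rw [Derivation.leibniz, homBracket_mul, Polynomial.coeff_add, Polynomial.coeff_C_mul,
      Polynomial.coeff_C_mul, M.rho_of_mem_VLeHalf hdeg hp', M.rho_of_mem_VLeHalf hdeg hq',
      hp hp', hq hq', smul_eq_mul, smul_eq_mul]

lemma iterate_lamDer_cst (r : F) (n : ℕ) :
    (⇑(lamDer (F := F) (J := J)))^[n] (cst r) = cst r * Polynomial.X ^ n := by
  induction n with
  | zero => simp
  | succ n ih =>
    rw [Function.iterate_succ_apply', ih, lamDer_cst_mul, ← one_mul (Polynomial.X ^ n),
      lamDer_mul_X_pow, ← map_one Polynomial.C, lamDer_C, Derivation.map_one_eq_zero, pow_succ']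
    simp

lemma homBracket_iterate_der (s : 𝔤) (z : F) (y : J → DiffPoly J F) (g h : DiffPoly J F) (n : ℕ) :
    homBracket B u s z y g ((⇑(der (F := F) (J := J)))^[n] h) =
      (⇑(lamDer (F := F) (J := J)))^[n] (homBracket B u s z y g h) := by
  induction n with
  | zero => rfl
  | succ n ih =>
    rw [Function.iterate_succ_apply', homBracket_der, ih, Function.iterate_succ_apply']

lemma coeff_cst_mul_X_pow (r : F) (n m : ℕ) :
    (cst (J := J) r * Polynomial.X ^ n).coeff m = if m = n then MvPolynomial.C r else 0 := by
  rw [cst, Polynomial.coeff_C_mul, Polynomial.coeff_X_pow]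
  simp

variable {J₀ J₁ K : Type*} [Fintype J₀] [Fintype J₁] [Fintype K]
  {a a' : J₀ → 𝔤} {v v' : J₁ → 𝔤} {c c' : K → 𝔤}

/-- The generators of the W-algebra and their derivatives. -/
def genSet (u : Module.Basis J F 𝔤) (e x f : 𝔤) (a a' : J₀ → 𝔤) (v v' : J₁ → 𝔤) :
    Set (DiffPoly J F) :=
  {y : DiffPoly J F | ∃ n : ℕ, ∃ y₀ ∈ {genL u x f a a' v v'}
    ∪ genPhi u v v' '' (gradeZeroCentralizer F x f : Set 𝔤)
    ∪ genPsi u e v v' '' (grade F x (-1 / 2) : Set 𝔤),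
    y = (⇑(der (F := F) (J := J)))^[n] y₀}

lemma der_mem_adjoin_genSet {g : DiffPoly J F}
    (hg : g ∈ Algebra.adjoin F (genSet u e x f a a' v v')) :
    der g ∈ Algebra.adjoin F (genSet u e x f a a' v v') := by
  refine der_mem_adjoin ?_ hg
  rintro _ ⟨n, y, hy, rfl⟩
  exact Algebra.subset_adjoin ⟨n + 1, y, hy, (Function.iterate_succ_apply' _ _ _).symm⟩

lemma der_mem_WAlg {z : F} {g : DiffPoly J F} (hg : g ∈ WAlg B u deg x f e z) :
    der g ∈ WAlg B u deg x f e z := by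
  refine ⟨der_mem_VLeHalf hg.1, fun p hp => ?_⟩
  have h1 := hg.2 p hp
  rw [rhoBracket_eq_homBracket] at h1 ⊢
  rw [homBracket_der, h1, map_zero]

namespace DualBases

variable (M : DualBases B e x f a a' v v' c c') (z : F) (hdeg : ∀ j, u j ∈ grade F x (deg j))
include M hdeg

lemma adjoin_genSet_le :
    Algebra.adjoin F (genSet u e x f a a' v v') ≤ WAlg B u deg x f e z := by
  refine Algebra.adjoin_le ?_
  rintro _ ⟨n, y, hy, rfl⟩
  refine iterate_der_mem (fun _ => der_mem_WAlg) ?_ n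
  rcases hy with (rfl | ⟨b, hb, rfl⟩) | ⟨w, hw, rfl⟩
  · exact M.genL_mem z hdeg
  · exact M.genPhi_mem z hdeg hb
  · exact M.genPsi_mem z hdeg hw

/-- `V(𝔤_{≤ 1/2})` is generated by `L`, `φ(b)`, `ψ(w)`, `𝔤_{1/2}` and `x`: modulo polynomials in
lower terms, these generators are `f`, `b` and `w`. -/
lemma VLeHalf_le {Q : Subalgebra F (DiffPoly J F)} (hQ : ∀ g ∈ Q, der g ∈ Q)
    (hgen : Algebra.adjoin F (genSet u e x f a a' v v') ≤ Q) (hv : ∀ k, emb u (v k) ∈ Q)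
    (hx : emb u x ∈ Q) : VLeHalf F deg ≤ Q := by
  have hgen' : ∀ y₀ ∈ {genL u x f a a' v v'}
      ∪ genPhi u v v' '' (gradeZeroCentralizer F x f : Set 𝔤)
      ∪ genPsi u e v v' '' (grade F x (-1 / 2) : Set 𝔤), y₀ ∈ Q := fun y₀ hy₀ =>
    hgen (Algebra.subset_adjoin ⟨0, y₀, hy₀, rfl⟩)
  have hhalf : ∀ p ∈ grade F x (1 / 2), emb u p ∈ Q := by
    intro p hp
    rw [← M.sum_v (emb u) hp]
    exact sum_mem fun k _ => Subalgebra.smul_mem _ (hv k) _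
  have hcent : ∀ b ∈ gradeZeroCentralizer F x f, emb u b ∈ Q := by
    intro b hb
    have h1 : genPhi u v v' b ∈ Q := hgen' _ (Or.inl (Or.inr ⟨b, hb, rfl⟩))
    rw [genPhi] at h1
    refine (add_mem_cancel_right (Subalgebra.smul_mem _ (sum_mem fun k _ => ?_) _)).1 h1
    exact mul_mem (hhalf _ (lie_mem_grade (IsMinimalGrading.mem_centralizer.1 hb).1 (M.v_mem k)
      (by norm_num))) (hhalf _ (M.v_mem' k))
  have hzero : ∀ b ∈ grade F x 0, emb u b ∈ Q := by
    intro b hb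
    have h1 : b = sharp B x b + (B b x / B x x) • x := by rw [sharp, sub_add_cancel]
    rw [h1, map_add, map_smul]
    exact add_mem (hcent _ (M.sharp_mem hb)) (Subalgebra.smul_mem _ hx _)
  have hneg : ∀ w ∈ grade F x (-1 / 2), emb u w ∈ Q := by
    intro w hw
    have hwv : ∀ k, ⁅w, v k⁆ ∈ grade F x 0 := fun k =>
      lie_mem_grade hw (M.v_mem k) (by norm_num)
    have h1 : genPsi u e v v' w ∈ Q := hgen' _ (Or.inr ⟨w, hw, rfl⟩)
    rw [genPsi, add_assoc, add_assoc] at h1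
    refine (add_mem_cancel_right (add_mem (Subalgebra.smul_mem _ (sum_mem fun h _ =>
      sum_mem fun k _ => ?_) _) (add_mem (sum_mem fun k _ => ?_) (hQ _ ?_)))).1 h1
    · exact mul_mem (mul_mem (hhalf _ (lie_mem_grade (hwv h) (M.v_mem k) (by norm_num)))
        (hhalf _ (M.v_mem' h))) (hhalf _ (M.v_mem' k))
    · exact mul_mem (hzero _ (hwv k)) (hhalf _ (M.v_mem' k))
    · exact hhalf _ (lie_mem_grade M.e_mem hw (by norm_num))
  have hf : emb u f ∈ Q := by
    have h1 : genL u x f a a' v v' ∈ Q := hgen' _ (Or.inl (Or.inl rfl))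
    rw [genL, add_assoc, add_assoc, add_assoc] at h1
    refine (add_mem_cancel_right (add_mem (hQ _ hx) (add_mem (Subalgebra.smul_mem _
      (sum_mem fun j _ => ?_) _) (add_mem (sum_mem fun k _ => ?_) (Subalgebra.smul_mem _
      (sum_mem fun k _ => ?_) _))))).1 h1
    · exact mul_mem (hzero _ (M.a_mem j)) (hzero _ (M.a_mem' j))
    · exact mul_mem (hhalf _ (M.v_mem' k))
        (hneg _ (lie_mem_grade M.f_mem (M.v_mem k) (by norm_num)))
    · exact mul_mem (hhalf _ (M.v_mem' k)) (hQ _ (hhalf _ (M.v_mem k)))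
  refine Algebra.adjoin_le ?_
  rintro _ ⟨⟨j, n⟩, hj, rfl⟩
  change deg j ≤ 1 / 2 at hj
  rw [← iterate_der_X, ← emb_basis u]
  refine iterate_der_mem hQ ?_ n
  have hj' := hdeg j
  by_cases h1 : deg j = 1 / 2
  · exact hhalf _ (h1 ▸ hj')
  by_cases h2 : deg j = 0
  · exact hzero _ (h2 ▸ hj')
  by_cases h3 : deg j = -1 / 2
  · exact hneg _ (h3 ▸ hj')
  by_cases h4 : deg j = -1
  · rw [h4] at hj'
    obtain ⟨r, hr⟩ := M.grade_neg_one _ hj'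
    rw [hr, map_smul]
    exact Subalgebra.smul_mem _ hf _
  · rw [M.grade_eq_bot _ h4 h3 h2 h1 (by linarith), Submodule.mem_bot] at hj'
    exact absurd hj' (u.ne_zero j)

/-- `W` is generated by `L`, `φ(b)` and `ψ(w)`. The coefficients of `{e _λ ·}_ρ` and `{p _λ ·}_ρ`,
`p ∈ 𝔤_{1/2}`, are derivations which vanish on `W` and for which the remaining variables
`x⁽ⁿ⁾`, `v_k⁽ⁿ⁾` of `V(𝔤_{≤ 1/2})` are slices. -/
lemma adjoin_genSet_eq [DecidableEq J₁]
    (hvv' : ∀ h k, B f ⁅v h, v' k⁆ = if h = k then 1 else 0) :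
    Algebra.adjoin F (genSet u e x f a a' v v') = WAlg B u deg x f e z := by
  refine le_antisymm (M.adjoin_genSet_le z hdeg) fun g hg => ?_
  let G := Algebra.adjoin F (genSet u e x f a a' v v')
  let yv : J₁ × ℕ → DiffPoly J F := fun k => (⇑(der (F := F) (J := J)))^[k.2] (emb u (v k.1))
  let yx : ℕ → DiffPoly J F := fun n => (⇑(der (F := F) (J := J)))^[n] (emb u x)
  let R := Algebra.adjoin F ((G : Set (DiffPoly J F)) ∪ Set.range yv)
  let Q := Algebra.adjoin F ((R : Set (DiffPoly J F)) ∪ Set.range yx)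
  have hGR : G ≤ R := fun r hr => Algebra.subset_adjoin (Or.inl hr)
  have hRQ : R ≤ Q := fun r hr => Algebra.subset_adjoin (Or.inl hr)
  have hR : ∀ r ∈ R, der r ∈ R := fun r hr => by
    refine der_mem_adjoin ?_ hr
    rintro _ (hr | ⟨⟨k, n⟩, rfl⟩)
    · exact hGR (der_mem_adjoin_genSet hr)
    · exact Algebra.subset_adjoin (Or.inr ⟨⟨k, n + 1⟩, Function.iterate_succ_apply' _ _ _⟩)
  have hQ : ∀ r ∈ Q, der r ∈ Q := fun r hr => by
    refine der_mem_adjoin ?_ hr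
    rintro _ (hr | ⟨n, rfl⟩)
    · exact hRQ (hR _ hr)
    · exact Algebra.subset_adjoin (Or.inr ⟨n + 1, Function.iterate_succ_apply' _ _ _⟩)
  have hgQ : g ∈ Q := M.VLeHalf_le hdeg hQ (hGR.trans hRQ)
    (fun k => hRQ (Algebra.subset_adjoin (Or.inr ⟨(k, 0), rfl⟩)))
    (Algebra.subset_adjoin (Or.inr ⟨0, rfl⟩)) hg.1
  have hVv : ∀ k, yv k ∈ VLeHalf F deg := fun k =>
    iterate_der_mem (fun _ => der_mem_VLeHalf) (emb_mem_VLeHalf hdeg le_rfl (M.v_mem _)) _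
  have hVx : ∀ n, yx n ∈ VLeHalf F deg := fun n =>
    iterate_der_mem (fun _ => der_mem_VLeHalf)
      (emb_mem_VLeHalf hdeg (by norm_num) IsMinimalGrading.x_mem) _
  have hW0 : ∀ r ∈ WAlg B u deg x f e z, ∀ i : ℚ, 1 / 2 ≤ i → ∀ p ∈ grade F x i, ∀ n,
      rhoCoeffDer B u deg f e z p n r = 0 := by
    intro r hr i hi p hp n
    rw [M.rhoCoeffDer_apply hdeg _ _ _ _ hr.1, ← rhoBracket_eq_homBracket,
      hr.2 p (Submodule.mem_iSup_of_mem i (Submodule.mem_iSup_of_mem hi hp)),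
      Polynomial.coeff_zero]
  have hG0 := fun r (hr : r ∈ G) => hW0 r (M.adjoin_genSet_le z hdeg hr)
  -- `ρ {e _λ x⁽ⁿ⁾} = -(e | f) λⁿ`, so `g` does not involve the variables `x⁽ⁿ⁾`.
  have hgR : g ∈ R := by
    refine mem_of_derivation_eq_zero (R := R) (y := yx)
      (E := fun n => (-(B e f)⁻¹) • rhoCoeffDer B u deg f e z e n)
      (fun n r hr => ?_) (fun n m => ?_) hgQ (fun n => ?_)
    · have h1 : rhoCoeffDer B u deg f e z e n r = 0 := by
        induction hr using Algebra.adjoin_induction with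
        | mem r hr =>
          rcases hr with hr | ⟨k, rfl⟩
          · exact hG0 r hr 1 (by norm_num) e M.e_mem n
          · rw [M.rhoCoeffDer_apply hdeg _ _ _ _ (hVv k), homBracket_iterate_der,
              M.rho_e_half z hdeg (M.v_mem _), iterate_map_zero, Polynomial.coeff_zero]
        | algebraMap r => exact Derivation.map_algebraMap _ _
        | add p q _ _ hp hq => rw [map_add, hp, hq, add_zero]
        | mul p q _ _ hp hq => rw [Derivation.leibniz, hp, hq, smul_zero, smul_zero, add_zero]
      rw [Derivation.smul_apply, h1, smul_zero]
    · rw [Derivation.smul_apply, M.rhoCoeffDer_apply hdeg _ _ _ _ (hVx m), homBracket_iterate_der,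
        M.rho_e_zero z hdeg IsMinimalGrading.x_mem, iterate_lamDer_cst, coeff_cst_mul_X_pow,
        M.lie_e_x, map_neg, M.bilin_comm f e]
      split_ifs
      · rw [MvPolynomial.smul_eq_C_mul, ← map_mul, neg_mul_neg, inv_mul_cancel₀ M.bilin_e_f,
          map_one]
      · rw [smul_zero]
    · rw [Derivation.smul_apply, hW0 g hg 1 (by norm_num) e M.e_mem n, smul_zero]
  -- `ρ {-v^k _λ v_h⁽ⁿ⁾} = δ_{hk} λⁿ`, so `g` does not involve the variables `v_h⁽ⁿ⁾` either.
  have hv'mem : ∀ k, -v' k ∈ grade F x (1 / 2) := fun k => neg_mem (M.v_mem' k)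
  refine mem_of_derivation_eq_zero (R := G) (y := yv)
    (E := fun k => rhoCoeffDer B u deg f e z (-v' k.1) k.2)
    (fun k r hr => ?_) (fun k m => ?_) hgR (fun k => ?_)
  · exact hG0 r hr _ le_rfl _ (hv'mem _) _
  · rw [M.rhoCoeffDer_apply hdeg _ _ _ _ (hVv m), homBracket_iterate_der,
      M.rho_half_half z hdeg (hv'mem _) (M.v_mem _), iterate_lamDer_cst, coeff_cst_mul_X_pow,
      neg_lie, lie_skew, hvv']
    obtain ⟨k, n⟩ := k
    obtain ⟨h, m⟩ := m
    simp only [Prod.mk.injEq, eq_comm (a := h)]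
    by_cases h1 : n = m <;> by_cases h2 : k = h <;> simp [h1, h2]
  · exact hW0 g hg _ le_rfl _ (hv'mem _) _

end DualBases

end Generation

/-! ### The W-algebra is closed under the `λ`-bracket -/

section Closure

variable {F 𝔤 J : Type*} [Field F] [CharZero F] [LieRing 𝔤] [LieAlgebra F 𝔤]
  {B : LinearMap.BilinForm F 𝔤} {e x f : 𝔤} {u : Module.Basis J F 𝔤} {deg : J → ℚ} {z : F}

lemma coeff_homBracket (s : 𝔤) (y : J → DiffPoly J F) (g h : DiffPoly J F) (n : ℕ) :
    (homBracket B u s z y g h).coeff n = diffHom y ((lamBracket B u s z g h).coeff n) :=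
  Polynomial.coeff_map _ _

namespace IsMinimalGrading

variable (M : IsMinimalGrading B e x f) (hdeg : ∀ j, u j ∈ grade F x (deg j))
include M hdeg

lemma homBracket_rho_right {g : DiffPoly J F}
    (hg : ∀ j, 1 / 2 < deg j →
      homBracket B u e z (rhoGen B u deg f) g (MvPolynomial.X (j, 0)) = 0) (h : DiffPoly J F) :
    homBracket B u e z (rhoGen B u deg f) g (diffHom (rhoGen B u deg f) h) =
      homBracket B u e z (rhoGen B u deg f) g h := by
  induction h using diffPoly_induction with
  | hC r => rw [diffHom_C]
  | hX j =>
    rw [diffHom_X_zero, rhoGen, homBracket_add, homBracket_C, add_zero]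
    split_ifs with hj
    · rfl
    · rw [hg j (not_le.1 hj), ← MvPolynomial.C_0, homBracket_C]
  | hadd h k hh hk => rw [map_add, homBracket_add, homBracket_add, hh, hk]
  | hmul h k hh hk =>
    rw [map_mul, homBracket_mul, homBracket_mul, hh, hk,
      M.rho_of_mem_VLeHalf hdeg (rho_mem_VLeHalf h), M.rho_of_mem_VLeHalf hdeg (rho_mem_VLeHalf k)]
  | hder h hh => rw [diffHom_der, homBracket_der, homBracket_der, hh]

lemma homBracket_emb_rho_right {i : ℚ} (hi : 1 / 2 ≤ i) {p : 𝔤} (hp : p ∈ grade F x i)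
    (h : DiffPoly J F) :
    homBracket B u e z (rhoGen B u deg f) (emb u p) (diffHom (rhoGen B u deg f) h) =
      homBracket B u e z (rhoGen B u deg f) (emb u p) h := by
  refine M.homBracket_rho_right hdeg (fun j hj => ?_) h
  have h1 : ⁅p, u j⁆ = 0 := M.eq_zero_of_one_lt (lie_mem_grade hp (hdeg j) rfl) (by linarith)
  rw [← emb_basis u, homBracket_emb _ _ _ _ _ M.symm, h1,
    bilin_eq_zero M.inv hp (hdeg j) (by linarith)]
  simp

omit M hdeg in
lemma rho_emb_of_mem_WAlg {g : DiffPoly J F} (hg : g ∈ WAlg B u deg x f e z) {i : ℚ}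
    (hi : 1 / 2 ≤ i) {p : 𝔤} (hp : p ∈ grade F x i) :
    homBracket B u e z (rhoGen B u deg f) (emb u p) g = 0 :=
  hg.2 p (Submodule.mem_iSup_of_mem i (Submodule.mem_iSup_of_mem hi hp))

lemma homBracket_rho_right_of_mem_WAlg {g : DiffPoly J F} (hg : g ∈ WAlg B u deg x f e z)
    (h : DiffPoly J F) :
    homBracket B u e z (rhoGen B u deg f) g (diffHom (rhoGen B u deg f) h) =
      homBracket B u e z (rhoGen B u deg f) g h := by
  refine M.homBracket_rho_right hdeg (fun j hj => ?_) h
  rw [← emb_basis u, homBracket_skew _ _ _ _ _ M.symm (emb u (u j)),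
    rho_emb_of_mem_WAlg hg hj.le (hdeg j), map_zero, neg_zero]

/-- The coefficients of `{g _λ h}_ρ` belong to `W` for `g, h ∈ W`. By the Jacobi identity,
`ρ {a _c ρ {g _λ h}} = ρ {g _λ ρ {a _c h}} + ρ {ρ {a _c g} _{λ+c} h} = 0` for `a ∈ 𝔤_{≥ 1/2}` and
all scalars `c`. -/
lemma coeff_rhoBracket_mem {g h : DiffPoly J F} (hg : g ∈ WAlg B u deg x f e z)
    (hh : h ∈ WAlg B u deg x f e z) (n : ℕ) :
    (homBracket B u e z (rhoGen B u deg f) g h).coeff n ∈ WAlg B u deg x f e z := by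
  have hcoeff : ∀ q : (DiffPoly J F)[X],
      (diffHomPoly (rhoGen B u deg f) q).coeff n = diffHom (rhoGen B u deg f) (q.coeff n) :=
    fun q => Polynomial.coeff_map _ _
  have key : ∀ i : ℚ, 1 / 2 ≤ i → ∀ p ∈ grade F x i,
      homBracket B u e z (rhoGen B u deg f) (emb u p)
        ((homBracket B u e z (rhoGen B u deg f) g h).coeff n) = 0 := by
    intro i hi p hp
    rw [coeff_homBracket, M.homBracket_emb_rho_right hdeg hi hp]
    -- It suffices to evaluate `λ` at all scalars `c`.
    refine Polynomial.eq_zero_of_infinite_isRoot _ (Set.Infinite.mono ?_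
      (Set.infinite_range_of_injective (MvPolynomial.C_injective (J × ℕ) F)))
    rintro _ ⟨c, rfl⟩
    have heval : ∀ k : DiffPoly J F,
        diffHom (rhoGen B u deg f) (bracketAt B u e z (emb u p) c k) =
          (homBracket B u e z (rhoGen B u deg f) (emb u p) k).eval (MvPolynomial.C c) := by
      intro k
      have h1 := Polynomial.eval₂_hom (p := lamBracket B u e z (emb u p) k)
        (diffHom (rhoGen B u deg f) : DiffPoly J F →+* DiffPoly J F) (MvPolynomial.C c)
      rw [← Polynomial.eval_map, AlgHom.coe_toRingHom, diffHom_C] at h1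
      exact h1.symm
    have hD : ∀ k ∈ WAlg B u deg x f e z,
        diffHom (rhoGen B u deg f) (bracketAt B u e z (emb u p) c k) = 0 := by
      intro k hk
      rw [heval, rho_emb_of_mem_WAlg hk hi hp, Polynomial.eval_zero]
    have hzero : ∀ k : DiffPoly J F, homBracket B u e z (rhoGen B u deg f) k 0 = 0 := fun k => by
      rw [← MvPolynomial.C_0, homBracket_C]
    have h1 : homBracket B u e z (rhoGen B u deg f) g (bracketAt B u e z (emb u p) c h) = 0 := by
      rw [← M.homBracket_rho_right_of_mem_WAlg hdeg hg, hD h hh, hzero]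
    have h2 : homBracket B u e z (rhoGen B u deg f) (bracketAt B u e z (emb u p) c g) h = 0 := by
      rw [homBracket_skew _ _ _ _ _ M.symm h, ← M.homBracket_rho_right_of_mem_WAlg hdeg hh, hD g hg,
        hzero, map_zero, neg_zero]
    change Polynomial.eval _ _ = 0
    rw [← heval]
    have h3 := congrArg (fun q => (diffHomPoly (rhoGen B u deg f) q).coeff n)
      (jacobi B u e z c M.symm M.inv p g h)
    simp only [hcoeff, coeff_coeffMap, Derivation.coeFn_coe] at h3
    rw [h3, ← hcoeff, map_add (diffHomPoly _)]
    have h4 : diffHomPoly (rhoGen B u deg f) (Polynomial.taylor (MvPolynomial.C c)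
        (lamBracket B u e z (bracketAt B u e z (emb u p) c g) h)) =
        Polynomial.taylor (MvPolynomial.C c) (homBracket B u e z (rhoGen B u deg f)
          (bracketAt B u e z (emb u p) c g) h) := by
      have h5 := Polynomial.map_taylor (lamBracket B u e z (bracketAt B u e z (emb u p) c g) h)
        (MvPolynomial.C c) (diffHom (rhoGen B u deg f) : DiffPoly J F →+* DiffPoly J F)
      rwa [AlgHom.coe_toRingHom, diffHom_C] at h5
    rw [h4, h2, map_zero, add_zero]
    exact (congrArg (Polynomial.coeff · n) h1).trans (Polynomial.coeff_zero n)
  refine M.mem_WAlg ?_ (key _ le_rfl) (key 1 (by norm_num) e M.e_mem)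
  rw [coeff_homBracket]
  exact rho_mem_VLeHalf _

end IsMinimalGrading

end Closure

/-! ### The retraction onto the W-algebra -/

section Retraction

variable {F 𝔤 J : Type*} [Field F] [CharZero F] [LieRing 𝔤] [LieAlgebra F 𝔤]
  {J₀ J₁ K : Type*} [Fintype J₀] [Fintype J₁] [Fintype K]

lemma isLinearMap_genPhi (u : Module.Basis J F 𝔤) (v v' : J₁ → 𝔤) :
    IsLinearMap F (genPhi u v v') where
  map_add b₁ b₂ := by
    simp only [genPhi, map_add, add_lie, add_mul, Finset.sum_add_distrib, smul_add]
    abel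
  map_smul r b := by
    simp only [genPhi, map_smul, smul_lie, smul_mul_assoc, ← Finset.smul_sum, smul_add,
      smul_comm r]

lemma isLinearMap_genPsi (u : Module.Basis J F 𝔤) (e : 𝔤) (v v' : J₁ → 𝔤) :
    IsLinearMap F (genPsi u e v v') where
  map_add w₁ w₂ := by
    simp only [genPsi, map_add, add_lie, lie_add, add_mul, Finset.sum_add_distrib, smul_add]
    abel
  map_smul r w := by
    simp only [genPsi, map_smul, smul_lie, lie_smul, Derivation.map_smul, smul_mul_assoc,
      ← Finset.smul_sum, smul_add, smul_comm r]

/-- The linear map `b ↦ φ(b^♯)`. -/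
noncomputable def phiSharp (B : LinearMap.BilinForm F 𝔤) (u : Module.Basis J F 𝔤) (x : 𝔤)
    (v v' : J₁ → 𝔤) : 𝔤 →ₗ[F] DiffPoly J F :=
  IsLinearMap.mk' (fun b => genPhi u v v' (sharp B x b)) (by
    have h1 : IsLinearMap F (sharp B x) :=
      { map_add := fun b₁ b₂ => by
          simp only [sharp, map_add, LinearMap.add_apply, add_div, add_smul]
          abel
        map_smul := fun r b => by
          simp only [sharp, map_smul, LinearMap.smul_apply, smul_sub, smul_smul, smul_eq_mul,
            mul_div_assoc] }
    exact ((isLinearMap_genPhi u v v').mk'.comp h1.mk').isLinear)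

lemma phiSharp_apply (B : LinearMap.BilinForm F 𝔤) (u : Module.Basis J F 𝔤) (x : 𝔤)
    (v v' : J₁ → 𝔤) (b : 𝔤) : phiSharp B u x v v' b = genPhi u v v' (sharp B x b) := rfl

/-- The linear map `ψ`. -/
noncomputable def psiLin (u : Module.Basis J F 𝔤) (e : 𝔤) (v v' : J₁ → 𝔤) :
    𝔤 →ₗ[F] DiffPoly J F :=
  (isLinearMap_genPsi u e v v').mk'

lemma psiLin_apply (u : Module.Basis J F 𝔤) (e : 𝔤) (v v' : J₁ → 𝔤) (w : 𝔤) :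
    psiLin u e v v' w = genPsi u e v v' w := rfl

/-- The images of the `u_j` under the retraction `σ` of `V(𝔤)` onto `W`: the homomorphism of
differential algebras with `f ↦ L̃`, `w ↦ ψ(w)` for `w ∈ 𝔤_{-1/2}`, `b ↦ φ(b)` for `b ∈ 𝔤_0^f`,
`x ↦ 0`, `v ↦ 0` for `v ∈ 𝔤_{1/2}` and `e ↦ (f | e)`. -/
noncomputable def retractGen (B : LinearMap.BilinForm F 𝔤) (u : Module.Basis J F 𝔤)
    (deg : J → ℚ) (e x f : 𝔤) (a a' : J₀ → 𝔤) (v v' : J₁ → 𝔤) (c c' : K → 𝔤) (j : J) :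
    DiffPoly J F :=
  (if deg j = -1 then (B e (u j) / B e f) • genLTilde u x f a a' v v' c c'
    else if deg j = -1 / 2 then psiLin u e v v' (u j)
    else if deg j = 0 then phiSharp B u x v v' (u j) else 0)
  + MvPolynomial.C (B f (u j))

variable {B : LinearMap.BilinForm F 𝔤} {e x f : 𝔤} {u : Module.Basis J F 𝔤} {deg : J → ℚ}
  {a a' : J₀ → 𝔤} {v v' : J₁ → 𝔤} {c c' : K → 𝔤} {z : F}

/-- The retraction of `V(𝔤)` onto `W`. -/
local notation "σ" => diffHom (retractGen B u deg e x f a a' v v' c c')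

namespace DualBases

variable (M : DualBases B e x f a a' v v' c c') (hdeg : ∀ j, u j ∈ grade F x (deg j))
include M hdeg

lemma retract_half {p : 𝔤} (hp : p ∈ grade F x (1 / 2)) : σ (emb u p) = 0 := by
  refine diffHom_emb_eq _ hdeg 0 (fun j hj => ?_) hp
  rw [retractGen, if_neg (by rw [hj]; norm_num), if_neg (by rw [hj]; norm_num),
    if_neg (by rw [hj]; norm_num), bilin_eq_zero M.inv M.f_mem (hdeg j) (by rw [hj]; norm_num)]
  simp

lemma retract_zero {b : 𝔤} (hb : b ∈ grade F x 0) : σ (emb u b) = phiSharp B u x v v' b := by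
  refine diffHom_emb_eq _ hdeg _ (fun j hj => ?_) hb
  rw [retractGen, if_neg (by rw [hj]; norm_num), if_neg (by rw [hj]; norm_num),
    if_pos hj, bilin_eq_zero M.inv M.f_mem (hdeg j) (by rw [hj]; norm_num), map_zero, add_zero]

lemma retract_neg_half {w : 𝔤} (hw : w ∈ grade F x (-1 / 2)) :
    σ (emb u w) = genPsi u e v v' w := by
  refine diffHom_emb_eq _ hdeg (psiLin u e v v') (fun j hj => ?_) hw
  rw [retractGen, if_neg (by rw [hj]; norm_num), if_pos hj,
    bilin_eq_zero M.inv M.f_mem (hdeg j) (by rw [hj]; norm_num), map_zero, add_zero]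

lemma retract_f : σ (emb u f) = genLTilde u x f a a' v v' c c' := by
  have h1 := diffHom_emb_eq (retractGen B u deg e x f a a' v v' c c') hdeg
    (((B e f)⁻¹ • B e).smulRight (genLTilde u x f a a' v v' c c')) (fun j hj => ?_) M.f_mem
  · rw [h1, LinearMap.smulRight_apply, LinearMap.smul_apply, smul_eq_mul,
      inv_mul_cancel₀ M.bilin_e_f, one_smul]
  · rw [retractGen, if_pos hj, bilin_eq_zero M.inv M.f_mem (hdeg j) (by rw [hj]; norm_num),
      map_zero, add_zero, LinearMap.smulRight_apply, LinearMap.smul_apply, smul_eq_mul,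
      div_eq_inv_mul]

omit hdeg in
lemma phiSharp_of_mem {b : 𝔤} (hb : b ∈ gradeZeroCentralizer F x f) :
    phiSharp B u x v v' b = genPhi u v v' b := by
  rw [phiSharp_apply, M.sharp_of_mem hb]

omit hdeg in
lemma phiSharp_x : phiSharp B u x v v' x = 0 := by
  rw [phiSharp_apply, M.sharp_x]
  exact (isLinearMap_genPhi u v v').map_zero

lemma retract_x : σ (emb u x) = 0 := by
  rw [M.retract_zero hdeg IsMinimalGrading.x_mem, M.phiSharp_x]

lemma retract_centralizer {b : 𝔤} (hb : b ∈ gradeZeroCentralizer F x f) :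
    σ (emb u b) = genPhi u v v' b := by
  rw [M.retract_zero hdeg (IsMinimalGrading.mem_centralizer.1 hb).1, M.phiSharp_of_mem hb]

/-- `σ ρ = σ`. -/
lemma retract_rho (g : DiffPoly J F) : σ (diffHom (rhoGen B u deg f) g) = σ g := by
  induction g using diffPoly_induction with
  | hC r => rw [diffHom_C]
  | hX j =>
    rw [diffHom_X_zero, diffHom_X_zero, rhoGen, map_add, diffHom_C]
    split_ifs with hj
    · rw [diffHom_X_zero, bilin_eq_zero M.inv M.f_mem (hdeg j) (by linarith), map_zero, add_zero]
    · rw [map_zero, retractGen, if_neg (by intro h; rw [h] at hj; norm_num at hj),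
        if_neg (by intro h; rw [h] at hj; norm_num at hj),
        if_neg (by intro h; rw [h] at hj; norm_num at hj)]
  | hadd h k hh hk => rw [map_add, map_add, hh, hk, map_add]
  | hmul h k hh hk => rw [map_mul, map_mul, hh, hk, map_mul]
  | hder h hh => rw [diffHom_der, diffHom_der, hh, diffHom_der]

lemma retract_genPhi {b : 𝔤} (hb : b ∈ gradeZeroCentralizer F x f) :
    σ (genPhi u v v' b) = genPhi u v v' b := by
  have h1 := M.retract_centralizer hdeg hb
  conv_lhs => rw [genPhi]
  simp only [map_add, map_smul, map_sum, map_mul, h1, M.retract_half hdeg (M.v_mem' _), mul_zero,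
    Finset.sum_const_zero, smul_zero, add_zero]

lemma retract_genPsi {w : 𝔤} (hw : w ∈ grade F x (-1 / 2)) :
    σ (genPsi u e v v' w) = genPsi u e v v' w := by
  have h1 := M.retract_neg_half hdeg hw
  conv_lhs => rw [genPsi]
  simp only [map_add, map_smul, map_sum, map_mul, h1, M.retract_half hdeg (M.v_mem' _), mul_zero,
    Finset.sum_const_zero, smul_zero, add_zero, diffHom_der,
    M.retract_half hdeg (lie_mem_grade M.e_mem hw (by norm_num) : ⁅e, w⁆ ∈ grade F x (1 / 2)),
    map_zero]

lemma retract_genL : σ (genL u x f a a' v v') = genL u x f a a' v v' := by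
  have h2 := M.sum_a_eq_sum_c (V := DiffPoly J F)
    ((σ).toLinearMap ∘ₗ emb u) ((σ).toLinearMap ∘ₗ emb u) (M.retract_x hdeg)
  simp only [LinearMap.comp_apply, AlgHom.toLinearMap_apply,
    M.retract_centralizer hdeg (M.c_mem _), M.retract_centralizer hdeg (M.c_mem' _)] at h2
  conv_lhs => rw [genL]
  simp only [map_add, map_smul, map_sum, map_mul, M.retract_f hdeg, M.retract_x hdeg, h2,
    M.retract_half hdeg (M.v_mem' _), zero_mul,
    Finset.sum_const_zero, smul_zero, add_zero, diffHom_der, map_zero]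
  rw [genLTilde, sub_add_cancel]

/-- The elements of `𝔤_{≥ 1/2}` commute with `W` modulo the kernel of `σ`. -/
lemma retract_emb_of_mem {g : DiffPoly J F} (hg : g ∈ WAlg B u deg x f e z) {i : ℚ}
    (hi : 1 / 2 ≤ i) {p : 𝔤} (hp : p ∈ grade F x i) :
    homBracket B u e z (retractGen B u deg e x f a a' v v' c c') g (emb u p) = 0 := by
  have h1 : homBracket B u e z (retractGen B u deg e x f a a' v v' c c') (emb u p) g = 0 := by
    ext1 n
    rw [coeff_homBracket, ← M.retract_rho hdeg, ← coeff_homBracket,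
      IsMinimalGrading.rho_emb_of_mem_WAlg hg hi hp, Polynomial.coeff_zero, map_zero]
  rw [homBracket_skew _ _ _ _ _ M.symm, h1, map_zero, neg_zero]

variable [DecidableEq J₁] (hvv' : ∀ h k, B f ⁅v h, v' k⁆ = if h = k then 1 else 0)
include hvv'

/-- `σ` is the identity on `W`, since it fixes the generators. -/
lemma retract_of_mem {g : DiffPoly J F} (hg : g ∈ WAlg B u deg x f e z) : σ g = g := by
  rw [← M.adjoin_genSet_eq z hdeg hvv'] at hg
  induction hg using Algebra.adjoin_induction with
  | mem g hg =>
    obtain ⟨n, y, hy, rfl⟩ := hg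
    rw [diffHom_iterate_der]
    congr 1
    rcases hy with (rfl | ⟨b, hb, rfl⟩) | ⟨w, hw, rfl⟩
    · exact M.retract_genL hdeg
    · exact M.retract_genPhi hdeg hb
    · exact M.retract_genPsi hdeg hw
  | algebraMap r => exact AlgHom.commutes _ r
  | add p q _ _ hp hq => rw [map_add, hp, hq]
  | mul p q _ _ hp hq => rw [map_mul, hp, hq]

/-- The `λ`-bracket of `W` may be computed with the retraction `σ` in place of `ρ`. -/
lemma rhoBracket_eq_retract {g h : DiffPoly J F} (hg : g ∈ WAlg B u deg x f e z)
    (hh : h ∈ WAlg B u deg x f e z) :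
    rhoBracket B u deg f e z g h =
      homBracket B u e z (retractGen B u deg e x f a a' v v' c c') g h := by
  rw [rhoBracket_eq_homBracket]
  ext1 n
  rw [← M.retract_of_mem hdeg hvv' (M.coeff_rhoBracket_mem hdeg hg hh n), coeff_homBracket,
    coeff_homBracket, M.retract_rho hdeg]

end DualBases

end Retraction

/-! ### The `λ`-brackets of the generators -/

section Brackets

variable {F 𝔤 J : Type*} [Field F] [CharZero F] [LieRing 𝔤] [LieAlgebra F 𝔤]
  {J₀ J₁ K : Type*} [Fintype J₀] [Fintype J₁] [Fintype K]

lemma neg_adj_derLam (r Δ : F) (g : DiffPoly J F) :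
    -adj (derLam r Δ g) = derLam (Δ - r) Δ g := by
  rw [derLam, derLam, map_add, adj_mul_X, adj_C, adj_C, lamDer_C, sub_smul, map_sub,
    Derivation.map_smul]
  ring

lemma adj_cst (r : F) : adj (cst (J := J) r) = cst r := adj_C _

lemma adj_cst_mul_X (r : F) :
    adj (cst (J := J) r * Polynomial.X) = -(cst r * Polynomial.X) := by
  rw [adj_mul_X, adj_cst, lamDer_cst]

lemma lamDer_cst_mul_X (r : F) :
    lamDer (cst (J := J) r * Polynomial.X) = cst r * Polynomial.X ^ 2 := by
  rw [lamDer_mul_X, lamDer_cst]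
  ring

lemma adj_cst_mul_X_sq (r : F) :
    adj (cst (J := J) r * Polynomial.X ^ 2) = cst r * Polynomial.X ^ 2 := by
  rw [pow_two, ← mul_assoc, adj_mul_X, adj_cst_mul_X, map_neg, neg_neg, lamDer_cst_mul_X]
  ring

lemma derLam_zero_left (Δ : F) (g : DiffPoly J F) :
    derLam 0 Δ g = Polynomial.C (Δ • g) * Polynomial.X := by
  rw [derLam, zero_smul, map_zero, zero_add]

variable {B : LinearMap.BilinForm F 𝔤} {e x f : 𝔤} {u : Module.Basis J F 𝔤} {deg : J → ℚ}
  {a a' : J₀ → 𝔤} {v v' : J₁ → 𝔤} {c c' : K → 𝔤} {z : F}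

/-- The retraction of `V(𝔤)` onto `W`. -/
local notation "σ" => diffHom (retractGen B u deg e x f a a' v v' c c')

/-- The `λ`-bracket of `V(𝔤)` followed by the retraction onto `W`. -/
local notation "⟪" g ", " h "⟫" =>
  homBracket B u e z (retractGen B u deg e x f a a' v v' c c') g h

namespace DualBases

variable (M : DualBases B e x f a a' v v' c c') (hdeg : ∀ j, u j ∈ grade F x (deg j))
include M

/-- The tensor `∑ c_i ⊗ [b, c^i]` is skew-symmetric. -/
lemma sum_c_mul_lie {V : Type*} [CommRing V] [Algebra F V] (T : 𝔤 →ₗ[F] V) {b : 𝔤}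
    (hb : b ∈ gradeZeroCentralizer F x f) : ∑ i, T (c i) * T ⁅b, c' i⁆ = 0 := by
  have h1 : ∑ i, T (c i) * T ⁅b, c' i⁆ =
      ∑ i, ∑ j, B ⁅b, c' i⁆ (c' j) • (T (c i) * T (c j)) := by
    refine Finset.sum_congr rfl fun i _ => ?_
    rw [← M.sum_c T (M.lie_mem_centralizer hb (M.c_mem' i)), Finset.mul_sum]
    exact Finset.sum_congr rfl fun j _ => mul_smul_comm _ _ _
  have h2 : ∑ i, T (c i) * T ⁅b, c' i⁆ = -∑ i, T (c i) * T ⁅b, c' i⁆ := by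
    conv_lhs => rw [h1, Finset.sum_comm]
    rw [h1, ← Finset.sum_neg_distrib]
    refine Finset.sum_congr rfl fun i _ => ?_
    rw [← Finset.sum_neg_distrib]
    refine Finset.sum_congr rfl fun j _ => ?_
    rw [← lie_skew, map_neg, LinearMap.neg_apply, M.inv, M.bilin_comm, neg_smul, mul_comm]
  have h3 : (2 : F) • ∑ i, T (c i) * T ⁅b, c' i⁆ = 0 := by
    rw [two_smul]
    nth_rewrite 1 [h2]
    exact neg_add_cancel _
  exact (smul_eq_zero.1 h3).resolve_left two_ne_zero

section Reduction

include hdeg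

lemma retract_genPhi_right (g : DiffPoly J F) {b : 𝔤} (hb : b ∈ gradeZeroCentralizer F x f) :
    ⟪g, genPhi u v v' b⟫ = ⟪g, emb u b⟫ := by
  have hbv : ∀ k, ⁅b, v k⁆ ∈ grade F x (1 / 2) := fun k =>
    lie_mem_grade (IsMinimalGrading.mem_centralizer.1 hb).1 (M.v_mem k) (by norm_num)
  rw [homBracket_genPhi]
  simp only [M.retract_half hdeg (hbv _), M.retract_half hdeg (M.v_mem' _), map_zero, zero_mul,
    add_zero, Finset.sum_const_zero, smul_zero]

lemma retract_genPhi_left (h : DiffPoly J F) {b : 𝔤} (hb : b ∈ gradeZeroCentralizer F x f) :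
    ⟪genPhi u v v' b, h⟫ = ⟪emb u b, h⟫ := by
  rw [homBracket_skew _ _ _ _ _ M.symm h, M.retract_genPhi_right hdeg h hb,
    ← homBracket_skew _ _ _ _ _ M.symm h]

lemma retract_genPsi_right (g : DiffPoly J F) {w : 𝔤} (hw : w ∈ grade F x (-1 / 2)) :
    ⟪g, genPsi u e v v' w⟫ = ⟪g, emb u w⟫
      + ∑ k, Polynomial.C (phiSharp B u x v v' ⁅w, v k⁆) * ⟪g, emb u (v' k)⟫
      + lamDer ⟪g, emb u ⁅e, w⁆⟫ := by
  have hwv : ∀ k, ⁅w, v k⁆ ∈ grade F x 0 := fun k => lie_mem_grade hw (M.v_mem k) (by norm_num)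
  have hwvv : ∀ h k, ⁅⁅w, v h⁆, v k⁆ ∈ grade F x (1 / 2) := fun h k =>
    lie_mem_grade (hwv h) (M.v_mem k) (by norm_num)
  rw [homBracket_genPsi]
  simp only [M.retract_half hdeg (hwvv _ _), M.retract_half hdeg (M.v_mem' _), map_zero, zero_mul,
    add_zero, Finset.sum_const_zero, smul_zero, M.retract_zero hdeg (hwv _)]

lemma retract_genL_right (g : DiffPoly J F) :
    ⟪g, genL u x f a a' v v'⟫ = ⟪g, emb u f⟫ + lamDer ⟪g, emb u x⟫
      + ∑ i, Polynomial.C (genPhi u v v' (c i)) * ⟪g, emb u (c' i)⟫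
      + ∑ k, Polynomial.C (genPsi u e v v' ⁅f, v k⁆) * ⟪g, emb u (v' k)⟫ := by
  have hfv : ∀ k, ⁅f, v k⁆ ∈ grade F x (-1 / 2) := fun k =>
    lie_mem_grade M.f_mem (M.v_mem k) (by norm_num)
  let T : 𝔤 →ₗ[F] (DiffPoly J F)[X] :=
    (Polynomial.CAlgHom (R := F) (A := DiffPoly J F)).toLinearMap ∘ₗ (σ).toLinearMap ∘ₗ emb u
  let S : 𝔤 →ₗ[F] (DiffPoly J F)[X] := IsLinearMap.mk' (fun b => ⟪g, emb u b⟫)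
    ⟨fun b₁ b₂ => by rw [map_add, homBracket_add], fun r b => by rw [map_smul, homBracket_smul]⟩
  have hT : T x = 0 := by
    simp only [T, LinearMap.comp_apply, AlgHom.toLinearMap_apply, M.retract_x hdeg, map_zero]
  have h1 := M.sum_a_eq_sum_c T S hT
  have h2 := M.sum_a_mul_a' T S
  rw [h1] at h2
  have h3 : ∑ i, T (c i) * S (c' i) =
      ∑ i, Polynomial.C (genPhi u v v' (c i)) * ⟪g, emb u (c' i)⟫ := by
    refine Finset.sum_congr rfl fun i _ => ?_
    rw [← M.retract_centralizer hdeg (M.c_mem i)]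
    rfl
  have h4 : ∑ j, (Polynomial.C (σ (emb u (a j))) * ⟪g, emb u (a' j)⟫
      + Polynomial.C (σ (emb u (a' j))) * ⟪g, emb u (a j)⟫) =
      ∑ j, T (a j) * S (a' j) + ∑ j, T (a' j) * S (a j) := Finset.sum_add_distrib
  rw [homBracket_genL, h4, h1, ← h2, h3, ← two_smul F, smul_smul]
  simp only [M.retract_half hdeg (M.v_mem _), M.retract_half hdeg (M.v_mem' _), map_zero, zero_mul,
    zero_add, add_zero, Finset.sum_const_zero, smul_zero, M.retract_neg_half hdeg (hfv _)]
  norm_num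

end Reduction

lemma retract_emb_emb (p q : 𝔤) :
    ⟪emb u p, emb u q⟫ = Polynomial.C (σ (emb u ⁅p, q⁆)) + cst (z * B e ⁅p, q⁆)
      + cst (B p q) * Polynomial.X := homBracket_emb _ _ _ _ _ M.symm _ _

lemma retract_emb_emb_of_neg {i j k : ℚ} {p q : 𝔤} (hp : p ∈ grade F x i)
    (hq : q ∈ grade F x j) (hk : i + j = k) (h1 : k ≠ -1) :
    ⟪emb u p, emb u q⟫ = Polynomial.C (σ (emb u ⁅p, q⁆)) + cst (B p q) * Polynomial.X := by
  have h2 : 1 + k ≠ 0 := fun h => h1 (by linarith)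
  rw [M.retract_emb_emb, bilin_eq_zero M.inv M.e_mem (lie_mem_grade hp hq hk) h2, mul_zero,
    cst_zero, add_zero]

lemma retract_emb_emb_of_ne {i j k : ℚ} {p q : 𝔤} (hp : p ∈ grade F x i)
    (hq : q ∈ grade F x j) (hk : i + j = k) (h1 : k ≠ -1) (h2 : k ≠ 0) :
    ⟪emb u p, emb u q⟫ = Polynomial.C (σ (emb u ⁅p, q⁆)) := by
  rw [M.retract_emb_emb_of_neg hp hq hk h1, bilin_eq_zero M.inv hp hq (hk ▸ h2), cst_zero,
    zero_mul, add_zero]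

section Centralizer

variable {b : 𝔤} (hb : b ∈ gradeZeroCentralizer F x f)
include hdeg hb

lemma retract_phi_phi {b₁ : 𝔤} (hb₁ : b₁ ∈ gradeZeroCentralizer F x f) :
    ⟪genPhi u v v' b, genPhi u v v' b₁⟫ =
      Polynomial.C (genPhi u v v' ⁅b, b₁⁆) + cst (B b b₁) * Polynomial.X := by
  rw [M.retract_genPhi_left hdeg _ hb, M.retract_genPhi_right hdeg _ hb₁,
    M.retract_emb_emb_of_neg (IsMinimalGrading.mem_centralizer.1 hb).1
      (IsMinimalGrading.mem_centralizer.1 hb₁).1 (add_zero 0) (by norm_num),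
    M.retract_centralizer hdeg (M.lie_mem_centralizer hb hb₁)]

lemma retract_phi_psi {w : 𝔤} (hw : w ∈ grade F x (-1 / 2)) :
    ⟪genPhi u v v' b, genPsi u e v v' w⟫ = Polynomial.C (genPsi u e v v' ⁅b, w⁆) := by
  have hφ := M.genPhi_mem z hdeg hb
  have hb0 := (IsMinimalGrading.mem_centralizer.1 hb).1
  rw [M.retract_genPsi_right hdeg _ hw, M.retract_emb_of_mem hdeg hφ le_rfl
    (lie_mem_grade M.e_mem hw (by norm_num))]
  simp only [M.retract_emb_of_mem hdeg hφ le_rfl (M.v_mem' _), mul_zero, Finset.sum_const_zero,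
    add_zero, map_zero]
  rw [M.retract_genPhi_left hdeg _ hb, M.retract_emb_emb_of_ne hb0 hw (zero_add _) (by norm_num)
    (by norm_num), M.retract_neg_half hdeg (lie_mem_grade hb0 hw (zero_add _))]

lemma retract_phi_L :
    ⟪genPhi u v v' b, genL u x f a a' v v'⟫ = derLam 0 1 (genPhi u v v' b) := by
  have hφ := M.genPhi_mem z hdeg hb
  have hb0 := (IsMinimalGrading.mem_centralizer.1 hb).1
  have hbf : ⁅b, f⁆ = 0 := by rw [← lie_skew, (IsMinimalGrading.mem_centralizer.1 hb).2, neg_zero]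
  have hbx : ⁅b, x⁆ = 0 := by rw [← lie_skew, mem_grade.1 hb0, Rat.cast_zero, zero_smul, neg_zero]
  have h1 : ⟪emb u b, emb u f⟫ = 0 := by
    rw [M.retract_emb_emb, hbf, bilin_eq_zero M.inv hb0 M.f_mem (by norm_num)]
    simp
  have h2 : ⟪emb u b, emb u x⟫ = 0 := by
    rw [M.retract_emb_emb, hbx, M.bilin_comm b x, M.bilin_x_centralizer hb]
    simp
  have h3 : ∀ i, Polynomial.C (genPhi u v v' (c i)) * ⟪emb u b, emb u (c' i)⟫ =
      Polynomial.C (phiSharp B u x v v' (c i) * phiSharp B u x v v' ⁅b, c' i⁆)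
        + Polynomial.C (B b (c' i) • phiSharp B u x v v' (c i)) * Polynomial.X := by
    intro i
    rw [M.retract_emb_emb_of_neg hb0 (IsMinimalGrading.mem_centralizer.1 (M.c_mem' i)).1
      (add_zero 0) (by norm_num), M.retract_centralizer hdeg
      (M.lie_mem_centralizer hb (M.c_mem' i)), M.phiSharp_of_mem (M.c_mem i),
      M.phiSharp_of_mem (M.lie_mem_centralizer hb (M.c_mem' i)), mul_add, ← map_mul, ← mul_assoc,
      C_mul_cst]
  rw [M.retract_genL_right hdeg]
  simp only [M.retract_emb_of_mem hdeg hφ le_rfl (M.v_mem' _), mul_zero, Finset.sum_const_zero,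
    add_zero, M.retract_genPhi_left hdeg _ hb, h1, h2, map_zero, zero_add]
  simp_rw [h3]
  rw [Finset.sum_add_distrib, ← Finset.sum_mul, ← map_sum, ← map_sum, M.sum_c_mul_lie _ hb,
    M.sum_c _ hb, map_zero, zero_add, M.phiSharp_of_mem hb, derLam_zero_left, one_smul]

lemma retract_L_phi :
    ⟪genL u x f a a' v v', genPhi u v v' b⟫ = derLam 1 1 (genPhi u v v' b) := by
  rw [homBracket_skew _ _ _ _ _ M.symm (genPhi u v v' b), M.retract_phi_L hdeg hb, neg_adj_derLam,
    sub_zero]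

end Centralizer

section NegHalf

variable {w : 𝔤} (hw : w ∈ grade F x (-1 / 2))
include hdeg hw

lemma retract_psi_phi {b : 𝔤} (hb : b ∈ gradeZeroCentralizer F x f) :
    ⟪genPsi u e v v' w, genPhi u v v' b⟫ = Polynomial.C (genPsi u e v v' ⁅w, b⁆) := by
  rw [homBracket_skew _ _ _ _ _ M.symm (genPhi u v v' b), M.retract_phi_psi hdeg hb hw, adj_C,
    ← lie_skew, (isLinearMap_genPsi u e v v').map_neg, map_neg, neg_neg]

/-- `{g _λ ψ(w)} = {g _λ w}` modulo the kernel of `σ`, for `g ∈ W`. -/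
lemma retract_genPsi_right_of_mem {g : DiffPoly J F} (hg : g ∈ WAlg B u deg x f e z) :
    ⟪g, genPsi u e v v' w⟫ = ⟪g, emb u w⟫ := by
  rw [M.retract_genPsi_right hdeg _ hw, M.retract_emb_of_mem hdeg hg le_rfl
    (lie_mem_grade M.e_mem hw (by norm_num))]
  simp only [M.retract_emb_of_mem hdeg hg le_rfl (M.v_mem' _), mul_zero, Finset.sum_const_zero,
    add_zero, map_zero]

omit hdeg in
/-- The quadratic terms of `{w _λ L}` cancel. -/
lemma sum_phi_mul_psi :
    ∑ i, genPhi u v v' (c i) * genPsi u e v v' ⁅w, c' i⁆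
      + ∑ k, genPsi u e v v' ⁅f, v k⁆ * phiSharp B u x v v' ⁅w, v' k⁆ = 0 := by
  have hew : ⁅e, w⁆ ∈ grade F x (1 / 2) := lie_mem_grade M.e_mem hw (by norm_num)
  have h1 : ∀ k, phiSharp B u x v v' ⁅w, v' k⁆ =
      ∑ i, B f ⁅⁅c' i, ⁅e, w⁆⁆, v' k⁆ • genPhi u v v' (c i) := by
    intro k
    have hwv : ⁅w, v' k⁆ ∈ grade F x 0 := lie_mem_grade hw (M.v_mem' k) (by norm_num)
    have h2 := M.sum_c (phiSharp B u x v v') (M.sharp_mem hwv)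
    rw [phiSharp_apply, ← M.phiSharp_of_mem (M.sharp_mem hwv), ← h2]
    refine Finset.sum_congr rfl fun i _ => ?_
    have h3 : B (sharp B x ⁅w, v' k⁆) (c' i) = B f ⁅⁅c' i, ⁅e, w⁆⁆, v' k⁆ := by
      rw [sharp, map_sub, map_smul, LinearMap.sub_apply, LinearMap.smul_apply,
        M.bilin_x_centralizer (M.c_mem' i), smul_zero, sub_zero, M.inv, M.bilin_eq_omegaPlus hw,
        ← lie_skew (v' k), lie_neg, map_neg, M.omegaPlus_lie (M.c_mem' i), neg_neg]
    rw [h3, M.phiSharp_of_mem (M.c_mem i)]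
  have h4 : ∀ i, ∑ k, B f ⁅⁅c' i, ⁅e, w⁆⁆, v' k⁆ • genPsi u e v v' ⁅f, v k⁆ =
      -genPsi u e v v' ⁅w, c' i⁆ := by
    intro i
    have hc0 := IsMinimalGrading.mem_centralizer.1 (M.c_mem' i)
    have h5 := M.sum_v (psiLin u e v v' ∘ₗ (LieAlgebra.ad F 𝔤 f : 𝔤 →ₗ[F] 𝔤))
      (lie_mem_grade hc0.1 hew (zero_add _))
    refine h5.trans ?_
    rw [LinearMap.comp_apply, LieAlgebra.ad_apply, leibniz_lie, hc0.2, zero_lie, zero_add,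
      M.lie_f_lie_e hw, ← lie_skew, map_neg, psiLin_apply]
  simp_rw [h1, Finset.mul_sum]
  rw [Finset.sum_comm, ← Finset.sum_add_distrib]
  refine Finset.sum_eq_zero fun i _ => ?_
  have h6 : ∑ k, genPsi u e v v' ⁅f, v k⁆ * B f ⁅⁅c' i, ⁅e, w⁆⁆, v' k⁆ • genPhi u v v' (c i) =
      (∑ k, B f ⁅⁅c' i, ⁅e, w⁆⁆, v' k⁆ • genPsi u e v v' ⁅f, v k⁆) * genPhi u v v' (c i) := by
    rw [Finset.sum_mul]
    exact Finset.sum_congr rfl fun k _ => by rw [mul_smul_comm, smul_mul_assoc]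
  rw [h6, h4]
  ring

/-- `σ {w _λ L} = (1/2 ∂ + 3/2 λ) ψ(w)`: the summand `∂x` of `L` contributes `1/2 (∂ + λ) ψ(w)` and
`∑ v^k [f, v_k]` contributes `λ ψ(w)`. -/
lemma retract_neg_half_L :
    ⟪emb u w, genL u x f a a' v v'⟫ = derLam (1 / 2) (3 / 2) (genPsi u e v v' w) := by
  have hew : ⁅e, w⁆ ∈ grade F x (1 / 2) := lie_mem_grade M.e_mem hw (by norm_num)
  have h1 : ⟪emb u w, emb u f⟫ = 0 := by
    have h2 : ⁅w, f⁆ = 0 :=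
      M.eq_zero_of_lt_neg_one (lie_mem_grade hw M.f_mem rfl) (by norm_num)
    rw [M.retract_emb_emb, h2, bilin_eq_zero M.inv hw M.f_mem (by norm_num)]
    simp
  have h2 : ⟪emb u w, emb u x⟫ = Polynomial.C ((1 / 2 : F) • genPsi u e v v' w) := by
    have h3 : ⁅w, x⁆ = (1 / 2 : F) • w := by
      rw [← lie_skew, mem_grade.1 hw, ← neg_smul]
      norm_num
    rw [M.retract_emb_emb_of_ne hw IsMinimalGrading.x_mem (add_zero _) (by norm_num)
      (by norm_num), h3, map_smul, map_smul, M.retract_neg_half hdeg hw]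
  have h3 : ∀ i, Polynomial.C (genPhi u v v' (c i)) * ⟪emb u w, emb u (c' i)⟫ =
      Polynomial.C (genPhi u v v' (c i) * genPsi u e v v' ⁅w, c' i⁆) := by
    intro i
    have hc0 := (IsMinimalGrading.mem_centralizer.1 (M.c_mem' i)).1
    rw [M.retract_emb_emb_of_ne hw hc0 (add_zero _) (by norm_num) (by norm_num),
      M.retract_neg_half hdeg (lie_mem_grade hw hc0 (add_zero _)), map_mul]
  have h4 : ∀ k, Polynomial.C (genPsi u e v v' ⁅f, v k⁆) * ⟪emb u w, emb u (v' k)⟫ =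
      Polynomial.C (genPsi u e v v' ⁅f, v k⁆ * phiSharp B u x v v' ⁅w, v' k⁆)
      + Polynomial.C (B f ⁅⁅e, w⁆, v' k⁆ • genPsi u e v v' ⁅f, v k⁆) * Polynomial.X := by
    intro k
    rw [M.retract_emb_emb_of_neg hw (M.v_mem' k) (k := 0) (by norm_num) (by norm_num),
      M.retract_zero hdeg (lie_mem_grade hw (M.v_mem' k) (by norm_num)), mul_add, ← map_mul,
      ← mul_assoc, C_mul_cst, M.bilin_eq_omegaPlus hw]
  have h5 : ∑ k, B f ⁅⁅e, w⁆, v' k⁆ • genPsi u e v v' ⁅f, v k⁆ = genPsi u e v v' w := by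
    refine (M.sum_v (psiLin u e v v' ∘ₗ (LieAlgebra.ad F 𝔤 f : 𝔤 →ₗ[F] 𝔤)) hew).trans ?_
    rw [LinearMap.comp_apply, LieAlgebra.ad_apply, M.lie_f_lie_e hw, psiLin_apply]
  rw [M.retract_genL_right hdeg, h1, h2]
  simp_rw [h3, h4]
  rw [Finset.sum_add_distrib, ← Finset.sum_mul, ← map_sum, ← map_sum, ← map_sum, h5, zero_add,
    lamDer_C, ← add_assoc, add_assoc (_ + _) (Polynomial.C _) (Polynomial.C _), ← map_add,
    M.sum_phi_mul_psi hw, map_zero, add_zero, derLam, add_assoc, Derivation.map_smul, ← add_mul,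
    ← map_add]
  congr 4
  module

lemma retract_L_psi :
    ⟪genL u x f a a' v v', genPsi u e v v' w⟫ = derLam 1 (3 / 2) (genPsi u e v v' w) := by
  rw [M.retract_genPsi_right_of_mem hdeg hw (M.genL_mem z hdeg),
    homBracket_skew _ _ _ _ _ M.symm (emb u w), M.retract_neg_half_L hdeg hw, neg_adj_derLam]
  norm_num

lemma retract_psi_L :
    ⟪genPsi u e v v' w, genL u x f a a' v v'⟫ = derLam (1 / 2) (3 / 2) (genPsi u e v v' w) := by
  rw [homBracket_skew _ _ _ _ _ M.symm (genL u x f a a' v v'), M.retract_L_psi hdeg hw,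
    neg_adj_derLam]
  norm_num

end NegHalf

section Quadratic

include hdeg

lemma retract_psi_psi {w w₁ : 𝔤} (hw : w ∈ grade F x (-1 / 2)) (hw₁ : w₁ ∈ grade F x (-1 / 2)) :
    ⟪genPsi u e v v' w, genPsi u e v v' w₁⟫ =
      Polynomial.C (∑ k, genPhi u v v' (sharp B x ⁅w, v' k⁆)
          * genPhi u v v' (sharp B x ⁅w₁, v k⁆))
        + derLam 1 2 (genPhi u v v' (sharp B x ⁅w, ⁅e, w₁⁆⁆))
        + Polynomial.C ((omegaMinus B e w w₁ / (2 * B x x)) • genLTilde u x f a a' v v' c c')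
        - cst (omegaMinus B e w w₁) * Polynomial.X ^ 2
        + cst (z * omegaMinus B e w w₁) := by
  have hew : ⁅e, w⁆ ∈ grade F x (1 / 2) := lie_mem_grade M.e_mem hw (by norm_num)
  have hew₁ : ⁅e, w₁⁆ ∈ grade F x (1 / 2) := lie_mem_grade M.e_mem hw₁ (by norm_num)
  have hskew : B e ⁅w₁, w⁆ = -omegaMinus B e w w₁ := by
    rw [omegaMinus, ← lie_skew, map_neg]
  have h1 : ⟪emb u w₁, emb u w⟫ =
      -(Polynomial.C ((omegaMinus B e w w₁ / (2 * B x x)) • genLTilde u x f a a' v v' c c')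
        + cst (z * omegaMinus B e w w₁)) := by
    rw [M.retract_emb_emb, M.lie_eq_smul_f hw₁ hw, map_smul, map_smul, M.retract_f hdeg,
      ← M.lie_eq_smul_f hw₁ hw, hskew, bilin_eq_zero M.inv hw₁ hw (by norm_num), neg_div, neg_smul,
      mul_neg, cst_neg, map_neg, cst_zero, zero_mul]
    ring
  have h2 : ∀ k, Polynomial.C (phiSharp B u x v v' ⁅w, v k⁆) * ⟪emb u w₁, emb u (v' k)⟫ =
      Polynomial.C (phiSharp B u x v v' ⁅w, v k⁆ * phiSharp B u x v v' ⁅w₁, v' k⁆)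
        + Polynomial.C (B f ⁅⁅e, w₁⁆, v' k⁆ • phiSharp B u x v v' ⁅w, v k⁆) * Polynomial.X := by
    intro k
    rw [M.retract_emb_emb_of_neg hw₁ (M.v_mem' k) (k := 0) (by norm_num) (by norm_num),
      M.retract_zero hdeg (lie_mem_grade hw₁ (M.v_mem' k) (by norm_num)), mul_add, ← map_mul,
      ← mul_assoc, C_mul_cst, M.bilin_eq_omegaPlus hw₁]
  have h3 : ∑ k, B f ⁅⁅e, w₁⁆, v' k⁆ • phiSharp B u x v v' ⁅w, v k⁆ =
      phiSharp B u x v v' ⁅w, ⁅e, w₁⁆⁆ :=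
    M.sum_v (phiSharp B u x v v' ∘ₗ (LieAlgebra.ad F 𝔤 w : 𝔤 →ₗ[F] 𝔤)) hew₁
  have h4 : ∑ k, phiSharp B u x v v' ⁅w, v k⁆ * phiSharp B u x v v' ⁅w₁, v' k⁆ =
      -∑ k, phiSharp B u x v v' ⁅w, v' k⁆ * phiSharp B u x v v' ⁅w₁, v k⁆ :=
    M.sum_v_mul_v' (phiSharp B u x v v' ∘ₗ (LieAlgebra.ad F 𝔤 w : 𝔤 →ₗ[F] 𝔤))
      (phiSharp B u x v v' ∘ₗ (LieAlgebra.ad F 𝔤 w₁ : 𝔤 →ₗ[F] 𝔤))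
  -- The two elements of `𝔤_0` differ by a multiple of `x = [e, f] / 2`.
  have h5 : phiSharp B u x v v' ⁅w₁, ⁅e, w⁆⁆ = phiSharp B u x v v' ⁅w, ⁅e, w₁⁆⁆ := by
    have h6 : ⁅w₁, ⁅e, w⁆⁆ =
        ⁅w, ⁅e, w₁⁆⁆ + (B e ⁅w₁, w⁆ / (2 * B x x) * 2) • x := by
      rw [leibniz_lie, M.lie_eq_smul_f hw₁ hw, lie_smul, M.lie_e_f, smul_smul, ← lie_skew w₁ e,
        neg_lie, lie_skew, ← M.lie_eq_smul_f hw₁ hw]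
    rw [h6, map_add, map_smul, M.phiSharp_x, smul_zero, add_zero]
  have h7 : ⟪emb u w₁, emb u ⁅e, w⁆⟫ = Polynomial.C (phiSharp B u x v v' ⁅w, ⁅e, w₁⁆⁆)
      + cst (omegaMinus B e w w₁) * Polynomial.X := by
    have h8 : B w₁ ⁅e, w⁆ = omegaMinus B e w w₁ := by
      rw [← M.inv, ← lie_skew, map_neg, LinearMap.neg_apply, M.inv, hskew, neg_neg]
    rw [M.retract_emb_emb_of_neg hw₁ hew (k := 0) (by norm_num) (by norm_num),
      M.retract_zero hdeg (lie_mem_grade hw₁ hew (by norm_num)), h5, h8]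
  have h9 : ⟪emb u w₁, genPsi u e v v' w⟫ =
      -(Polynomial.C ((omegaMinus B e w w₁ / (2 * B x x)) • genLTilde u x f a a' v v' c c')
        + cst (z * omegaMinus B e w w₁))
      - Polynomial.C (∑ k, phiSharp B u x v v' ⁅w, v' k⁆ * phiSharp B u x v v' ⁅w₁, v k⁆)
      + derLam 1 2 (phiSharp B u x v v' ⁅w, ⁅e, w₁⁆⁆)
      + cst (omegaMinus B e w w₁) * Polynomial.X ^ 2 := by
    rw [M.retract_genPsi_right hdeg _ hw, h1, h7]
    simp_rw [h2]
    rw [Finset.sum_add_distrib, ← Finset.sum_mul, ← map_sum, ← map_sum, h3, h4, map_neg,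
      map_add lamDer, lamDer_C, lamDer_cst_mul_X, derLam, one_smul, two_smul, Polynomial.C_add]
    ring
  rw [M.retract_genPsi_right_of_mem hdeg hw₁ (M.genPsi_mem z hdeg hw),
    homBracket_skew _ _ _ _ _ M.symm (emb u w₁), h9, map_add, map_add, map_sub, map_neg, map_add,
    adj_C, adj_C, adj_cst, adj_cst_mul_X_sq, ← neg_neg (adj (derLam _ _ _)), neg_adj_derLam]
  simp only [phiSharp_apply]
  norm_num
  ring

lemma retract_f_L :
    ⟪emb u f, genL u x f a a' v v'⟫ = derLam 1 1 (genLTilde u x f a a' v v' c c')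
      + cst (2 * B x x * z) * Polynomial.X := by
  have hff : ⟪emb u f, emb u f⟫ = 0 := by
    rw [M.retract_emb_emb, lie_self, bilin_eq_zero M.inv M.f_mem M.f_mem (by norm_num)]
    simp
  have hfx : ⟪emb u f, emb u x⟫ = Polynomial.C (genLTilde u x f a a' v v' c c')
      + cst (2 * B x x * z) := by
    rw [M.retract_emb_emb, M.lie_f_x, M.retract_f hdeg,
      bilin_eq_zero M.inv M.f_mem IsMinimalGrading.x_mem (by norm_num), M.bilin_e_f_eq,
      mul_comm z, cst_zero, zero_mul, add_zero]
  have hfc : ∀ i, ⟪emb u f, emb u (c' i)⟫ = 0 := by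
    intro i
    have hc := IsMinimalGrading.mem_centralizer.1 (M.c_mem' i)
    rw [M.retract_emb_emb, hc.2, bilin_eq_zero M.inv M.f_mem hc.1 (by norm_num)]
    simp
  have hfv : ∀ k, Polynomial.C (genPsi u e v v' ⁅f, v k⁆) * ⟪emb u f, emb u (v' k)⟫ =
      Polynomial.C (genPsi u e v v' ⁅f, v' k⁆ * genPsi u e v v' ⁅f, v k⁆) := by
    intro k
    rw [M.retract_emb_emb_of_ne M.f_mem (M.v_mem' k) (k := -1 / 2) (by norm_num) (by norm_num)
      (by norm_num), M.retract_neg_half hdeg (lie_mem_grade M.f_mem (M.v_mem' k) (by norm_num)),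
      ← map_mul, mul_comm]
  have h1 : ∑ k, genPsi u e v v' ⁅f, v' k⁆ * genPsi u e v v' ⁅f, v k⁆ = 0 :=
    M.sum_v'_mul_v (psiLin u e v v' ∘ₗ (LieAlgebra.ad F 𝔤 f : 𝔤 →ₗ[F] 𝔤))
  rw [M.retract_genL_right hdeg, hff, hfx]
  simp_rw [hfc, hfv]
  rw [← map_sum, h1, map_add, lamDer_C, lamDer_cst, derLam, one_smul, one_smul]
  simp

lemma retract_x_L :
    ⟪emb u x, genL u x f a a' v v'⟫ = -(Polynomial.C (genLTilde u x f a a' v v' c c')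
      + cst (2 * B x x * z)) + cst (B x x) * Polynomial.X ^ 2 := by
  have hx : x ∈ grade F x 0 := IsMinimalGrading.x_mem
  have hxf : ⟪emb u x, emb u f⟫ = -(Polynomial.C (genLTilde u x f a a' v v' c c')
      + cst (2 * B x x * z)) := by
    rw [M.retract_emb_emb, M.lie_x_f, map_neg, map_neg, map_neg, map_neg, M.retract_f hdeg,
      bilin_eq_zero M.inv hx M.f_mem (by norm_num), M.bilin_e_f_eq,
      mul_neg, mul_comm z, cst_zero, zero_mul, add_zero, cst_neg]
    ring
  have hxx : ⟪emb u x, emb u x⟫ = cst (B x x) * Polynomial.X := by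
    rw [M.retract_emb_emb, lie_self]
    simp
  have hxc : ∀ i, ⟪emb u x, emb u (c' i)⟫ = 0 := by
    intro i
    have hc := (IsMinimalGrading.mem_centralizer.1 (M.c_mem' i)).1
    rw [M.retract_emb_emb, mem_grade.1 hc, M.bilin_x_centralizer (M.c_mem' i)]
    simp
  have hxv : ∀ k, ⟪emb u x, emb u (v' k)⟫ = 0 := by
    intro k
    rw [M.retract_emb_emb_of_ne hx (M.v_mem' k) (zero_add _) (by norm_num) (by norm_num),
      M.retract_half hdeg (lie_mem_grade hx (M.v_mem' k) (zero_add _)), map_zero]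
  rw [M.retract_genL_right hdeg, hxf, hxx, lamDer_cst_mul_X]
  simp_rw [hxc, hxv]
  simp

lemma retract_L_L :
    ⟪genL u x f a a' v v', genL u x f a a' v v'⟫ = derLam 1 2 (genL u x f a a' v v')
      - cst (B x x) * Polynomial.X ^ 3 + cst (4 * B x x * z) * Polynomial.X := by
  have hL := M.genL_mem z hdeg
  have h1 : ∀ i, ⟪genL u x f a a' v v', emb u (c' i)⟫ = derLam 1 1 (genPhi u v v' (c' i)) := by
    intro i
    rw [← M.retract_genPhi_right hdeg _ (M.c_mem' i), M.retract_L_phi hdeg (M.c_mem' i)]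
  have h2 : ⟪genL u x f a a' v v', emb u f⟫ = derLam 0 1 (genLTilde u x f a a' v v' c c')
      + cst (2 * B x x * z) * Polynomial.X := by
    rw [homBracket_skew _ _ _ _ _ M.symm (emb u f), M.retract_f_L hdeg, map_add, neg_add,
      neg_adj_derLam, adj_cst_mul_X, neg_neg, sub_self]
  have h3 : ⟪genL u x f a a' v v', emb u x⟫ = Polynomial.C (genLTilde u x f a a' v v' c c')
      + cst (2 * B x x * z) - cst (B x x) * Polynomial.X ^ 2 := by
    rw [homBracket_skew _ _ _ _ _ M.symm (emb u x), M.retract_x_L hdeg, map_add, map_neg, map_add,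
      adj_C, adj_cst, adj_cst_mul_X_sq]
    ring
  have h4 : lamDer (cst (J := J) (B x x) * Polynomial.X ^ 2) = cst (B x x) * Polynomial.X ^ 3 := by
    rw [lamDer_mul_X_pow, lamDer_cst]
    ring
  have h5 : genL u x f a a' v v' = genLTilde u x f a a' v v' c c'
      + (1 / 2 : F) • ∑ i, genPhi u v v' (c i) * genPhi u v v' (c' i) := by
    rw [genLTilde, sub_add_cancel]
  -- `∑ φ(c_i) (∂ + λ) φ(c^i)` is `∂ + 2 λ` applied to `1/2 ∑ φ(c_i) φ(c^i) = L - L̃`.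
  have h6 : ∑ i, genPhi u v v' (c' i) * der (genPhi u v v' (c i)) =
      ∑ i, genPhi u v v' (c i) * der (genPhi u v v' (c' i)) := by
    have h7 := M.sum_c_mul_c' (phiSharp B u x v v')
      ((der (F := F) (J := J)).toLinearMap ∘ₗ phiSharp B u x v v')
    simp only [LinearMap.comp_apply, M.phiSharp_of_mem (M.c_mem _),
      M.phiSharp_of_mem (M.c_mem' _)] at h7
    exact h7.symm
  have h8 : ∑ i, Polynomial.C (genPhi u v v' (c i)) * derLam 1 1 (genPhi u v v' (c' i)) =
      derLam 1 2 ((1 / 2 : F) • ∑ i, genPhi u v v' (c i) * genPhi u v v' (c' i)) := by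
    simp only [derLam, one_smul, mul_add, ← mul_assoc, ← map_mul]
    rw [Finset.sum_add_distrib, ← Finset.sum_mul, ← map_sum, ← map_sum, smul_smul,
      Derivation.map_smul, map_sum der]
    simp only [Derivation.leibniz, smul_eq_mul]
    rw [Finset.sum_add_distrib, h6, ← two_smul F, smul_smul]
    norm_num
  rw [M.retract_genL_right hdeg, h2, h3]
  simp only [M.retract_emb_of_mem hdeg hL le_rfl (M.v_mem' _), mul_zero, Finset.sum_const_zero,
    add_zero]
  simp_rw [h1]
  rw [h8]
  conv_rhs => rw [h5]
  have h9 : cst (J := J) (4 * B x x * z) = cst (2 * B x x * z) + cst (2 * B x x * z) := by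
    simp only [cst, ← map_add]
    congr 2
    ring
  rw [map_sub, map_add lamDer, lamDer_C, lamDer_cst, h4, h9]
  simp only [derLam, map_add, smul_add, one_smul, two_smul, zero_smul, map_zero]
  ring

end Quadratic

end DualBases

end Brackets

/-! ### The energy-momentum element -/

section EnergyMomentum

variable {F 𝔤 J : Type*} [Field F] [CharZero F] [LieRing 𝔤] [LieAlgebra F 𝔤]
  {B : LinearMap.BilinForm F 𝔤} {e x f : 𝔤} {u : Module.Basis J F 𝔤} {deg : J → ℚ} {z : F}

lemma isEigenvector_C (g : DiffPoly J F) (r : F) :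
    IsEigenvector (rhoBracket B u deg f e z) g 0 (MvPolynomial.C r) := by
  refine ⟨0, ?_⟩
  rw [rhoBracket_eq_homBracket, homBracket_C, derLam, der_C]
  simp

lemma IsEigenvector.derivative {g h : DiffPoly J F} {Δ : F}
    (H : IsEigenvector (rhoBracket B u deg f e z) g Δ h) :
    IsEigenvector (rhoBracket B u deg f e z) g (Δ + 1) (der h) := by
  obtain ⟨r, hr⟩ := H
  refine ⟨Polynomial.C (Δ • h) + lamDer r, ?_⟩
  rw [rhoBracket_eq_homBracket] at hr ⊢
  rw [homBracket_der, hr, map_add, pow_two, mul_assoc, lamDer_X_mul, lamDer_X_mul, derLam, derLam,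
    map_add, lamDer_mul_X, lamDer_C, lamDer_C, Derivation.map_smul der Δ h, one_smul,
    one_smul, add_smul, one_smul, Polynomial.C_add]
  ring

lemma IsMinimalGrading.isEigenvector_mul (M : IsMinimalGrading B e x f)
    (hdeg : ∀ j, u j ∈ grade F x (deg j)) {g h k : DiffPoly J F} {Δ₁ Δ₂ : F}
    (hh : h ∈ VLeHalf F deg) (hk : k ∈ VLeHalf F deg)
    (H : IsEigenvector (rhoBracket B u deg f e z) g Δ₁ h)
    (K : IsEigenvector (rhoBracket B u deg f e z) g Δ₂ k) :
    IsEigenvector (rhoBracket B u deg f e z) g (Δ₁ + Δ₂) (h * k) := by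
  obtain ⟨r, hr⟩ := H
  obtain ⟨t, ht⟩ := K
  refine ⟨Polynomial.C h * t + Polynomial.C k * r, ?_⟩
  rw [rhoBracket_eq_homBracket] at hr ht ⊢
  rw [homBracket_mul, M.rho_of_mem_VLeHalf hdeg hh, M.rho_of_mem_VLeHalf hdeg hk, hr, ht]
  simp only [derLam, Derivation.leibniz, one_smul, MvPolynomial.smul_eq_C_mul, map_add, map_mul,
    smul_eq_mul]
  ring

variable {J₀ J₁ K : Type*} [Fintype J₀] [Fintype J₁] [Fintype K] [DecidableEq J₁]
  {a a' : J₀ → 𝔤} {v v' : J₁ → 𝔤} {c c' : K → 𝔤}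

/-- Products of derivatives of the eigenvectors `L + 2 (x | x) z`, `φ(b)` and `ψ(w)` are
eigenvectors, and they span `W`. -/
lemma DualBases.isEnergyMomentum (M : DualBases B e x f a a' v v' c c')
    (hdeg : ∀ j, u j ∈ grade F x (deg j))
    (hvv' : ∀ h k, B f ⁅v h, v' k⁆ = if h = k then 1 else 0) :
    IsEnergyMomentum (WAlg B u deg x f e z) (rhoBracket B u deg f e z)
      (genL u x f a a' v v') := by
  have hL := M.genL_mem z hdeg
  have hLL := (M.rhoBracket_eq_retract hdeg hvv' hL hL).trans (M.retract_L_L hdeg)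
  refine ⟨hL, ⟨-B x x, 4 * B x x * z, ?_⟩, ?_⟩
  · rw [hLL, cst_neg]
    ring
  let E : Submonoid (DiffPoly J F) :=
    { carrier := {w | w ∈ WAlg B u deg x f e z ∧
        ∃ Δ, IsEigenvector (rhoBracket B u deg f e z) (genL u x f a a' v v') Δ w}
      one_mem' := ⟨one_mem _, 0, by
        rw [← MvPolynomial.C_1]
        exact isEigenvector_C _ _⟩
      mul_mem' := fun ⟨hg, Δ₁, hg'⟩ ⟨hh, Δ₂, hh'⟩ =>
        ⟨mul_mem hg hh, _, M.isEigenvector_mul hdeg hg.1 hh.1 hg' hh'⟩ }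
  have hE : WAlg B u deg x f e z ≤ Algebra.adjoin F (E : Set (DiffPoly J F)) := by
    rw [← M.adjoin_genSet_eq z hdeg hvv']
    refine Algebra.adjoin_le ?_
    rintro _ ⟨n, y, hy, rfl⟩
    refine iterate_der_mem (fun g hg => der_mem_adjoin (fun g hg => ?_) hg) ?_ n
    · obtain ⟨hg, Δ, hg'⟩ := hg
      exact Algebra.subset_adjoin ⟨der_mem_WAlg hg, _, hg'.derivative⟩
    rcases hy with (rfl | ⟨b, hb, rfl⟩) | ⟨w, hw, rfl⟩
    · -- The shift by a constant removes the term `4 (x | x) z λ` of `{L _λ L}`.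
      rw [← add_sub_cancel_right (genL u x f a a' v v') (MvPolynomial.C (2 * B x x * z))]
      refine sub_mem (Algebra.subset_adjoin ⟨add_mem hL (Subalgebra.algebraMap_mem _ _), 2,
        -(cst (B x x) * Polynomial.X), ?_⟩) (Subalgebra.algebraMap_mem _ _)
      have h1 : (2 : F) • MvPolynomial.C (σ := J × ℕ) (2 * B x x * z) =
          MvPolynomial.C (4 * B x x * z) := by
        rw [MvPolynomial.smul_eq_C_mul, ← map_mul]
        congr 1
        ring
      rw [rhoBracket_eq_homBracket] at hLL ⊢
      rw [homBracket_add, homBracket_C, hLL, derLam, derLam, map_add der, der_C, smul_add (2 : F),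
        h1, Polynomial.C_add, cst, cst]
      simp only [add_zero]
      ring
    · have hφ := M.genPhi_mem z hdeg hb
      refine Algebra.subset_adjoin ⟨hφ, 1, 0, ?_⟩
      rw [M.rhoBracket_eq_retract hdeg hvv' hL hφ, M.retract_L_phi hdeg hb, mul_zero, add_zero]
    · have hψ := M.genPsi_mem z hdeg hw
      refine Algebra.subset_adjoin ⟨hψ, 3 / 2, 0, ?_⟩
      rw [M.rhoBracket_eq_retract hdeg hvv' hL hψ, M.retract_L_psi hdeg hw, mul_zero, add_zero]
  have hspan : Submodule.span F (E : Set (DiffPoly J F)) =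
      Subalgebra.toSubmodule (WAlg B u deg x f e z) := by
    refine le_antisymm (Submodule.span_le.2 fun w hw => hw.1) fun w hw => ?_
    have h1 : w ∈ Subalgebra.toSubmodule (Algebra.adjoin F (E : Set (DiffPoly J F))) := hE hw
    rwa [Algebra.adjoin_eq_span, Submonoid.closure_eq] at h1
  obtain ⟨S, hS, hS', hind⟩ := exists_linearIndependent F (E : Set (DiffPoly J F))
  exact ⟨S, hind, hS'.trans hspan, fun w hw => (hS hw).2⟩

end EnergyMomentum

end ClassicalW
open ClassicalW in
theorem theorem4p3
    {F : Type*} [Field F] [IsAlgClosed F] [CharZero F]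
    {𝔤 : Type*} [LieRing 𝔤] [LieAlgebra F 𝔤] [FiniteDimensional F 𝔤] [LieAlgebra.IsSimple F 𝔤]
    (B : LinearMap.BilinForm F 𝔤) (hBnondeg : B.Nondegenerate) (hBsymm : B.IsSymm)
    (hBinv : ∀ a b c : 𝔤, B ⁅a, b⁆ c = B a ⁅b, c⁆)
    (e x f : 𝔤) (hsl2 : IsSl2Triple ((2 : F) • x) e f) (hf : IsMinimalNilpotent F f)
    {J : Type*} [Fintype J] (u : Module.Basis J F 𝔤) (deg : J → ℚ)
    (hdeg : ∀ j, u j ∈ grade F x (deg j))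
    {J₀ : Type*} [Fintype J₀] [DecidableEq J₀] (a a' : Module.Basis J₀ F (grade F x 0))
    (haa' : ∀ i j, B (a i) (a' j) = if i = j then 1 else 0)
    {J₁ : Type*} [Fintype J₁] [DecidableEq J₁] (v v' : Module.Basis J₁ F (grade F x (1 / 2)))
    (hvv' : ∀ h k, omegaPlus B f (v h) (v' k) = if h = k then 1 else 0)
    {K : Type*} [Fintype K] [DecidableEq K]
    (c c' : Module.Basis K F (gradeZeroCentralizer F x f))
    (hcc' : ∀ i j, B (c i) (c' j) = if i = j then 1 else 0)
    (z : F) :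
    let W : Subalgebra F (DiffPoly J F) := WAlg B u deg x f e z
    let br : DiffPoly J F → DiffPoly J F → Polynomial (DiffPoly J F) := rhoBracket B u deg f e z
    let L : DiffPoly J F := genL u x f (fun j => (a j : 𝔤)) (fun j => (a' j : 𝔤))
      (fun k => (v k : 𝔤)) (fun k => (v' k : 𝔤))
    let φ : 𝔤 → DiffPoly J F := genPhi u (fun k => (v k : 𝔤)) (fun k => (v' k : 𝔤))
    let ψ : 𝔤 → DiffPoly J F := genPsi u e (fun k => (v k : 𝔤)) (fun k => (v' k : 𝔤))
    let Lt : DiffPoly J F := genLTilde u x f (fun j => (a j : 𝔤)) (fun j => (a' j : 𝔤))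
      (fun k => (v k : 𝔤)) (fun k => (v' k : 𝔤)) (fun i => (c i : 𝔤)) (fun i => (c' i : 𝔤))
    -- `L`, `φ(b)`, `ψ(w)` are elements of `W` and generate it as a differential algebra
    (L ∈ W ∧ (∀ b ∈ gradeZeroCentralizer F x f, φ b ∈ W) ∧ (∀ w ∈ grade F x (-1 / 2), ψ w ∈ W) ∧
      Algebra.adjoin F {y : DiffPoly J F | ∃ n : ℕ,
        ∃ y₀ ∈ {L} ∪ φ '' (gradeZeroCentralizer F x f : Set 𝔤) ∪ ψ '' (grade F x (-1 / 2) : Set 𝔤),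
          y = (⇑(der (F := F) (J := J)))^[n] y₀} = W) ∧
    -- the row of `L`
    (br L L = derLam 1 2 L - cst (B x x) * Polynomial.X ^ 3
        + cst (4 * B x x * z) * Polynomial.X) ∧
    (∀ b ∈ gradeZeroCentralizer F x f, br L (φ b) = derLam 1 1 (φ b)) ∧
    (∀ w ∈ grade F x (-1 / 2), br L (ψ w) = derLam 1 (3 / 2) (ψ w)) ∧
    -- the row of `φ(b)`
    (∀ b ∈ gradeZeroCentralizer F x f, br (φ b) L = derLam 0 1 (φ b)) ∧
    (∀ b ∈ gradeZeroCentralizer F x f, ∀ b₁ ∈ gradeZeroCentralizer F x f,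
      br (φ b) (φ b₁) = Polynomial.C (φ ⁅b, b₁⁆) + cst (B b b₁) * Polynomial.X) ∧
    (∀ b ∈ gradeZeroCentralizer F x f, ∀ w ∈ grade F x (-1 / 2),
      br (φ b) (ψ w) = Polynomial.C (ψ ⁅b, w⁆)) ∧
    -- the row of `ψ(w)`
    (∀ w ∈ grade F x (-1 / 2), br (ψ w) L = derLam (1 / 2) (3 / 2) (ψ w)) ∧
    (∀ w ∈ grade F x (-1 / 2), ∀ b ∈ gradeZeroCentralizer F x f,
      br (ψ w) (φ b) = Polynomial.C (ψ ⁅w, b⁆)) ∧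
    (∀ w ∈ grade F x (-1 / 2), ∀ w₁ ∈ grade F x (-1 / 2),
      br (ψ w) (ψ w₁) =
        Polynomial.C (∑ k, φ (sharp B x ⁅w, (v' k : 𝔤)⁆) * φ (sharp B x ⁅w₁, (v k : 𝔤)⁆))
        + derLam 1 2 (φ (sharp B x ⁅w, ⁅e, w₁⁆⁆))
        + Polynomial.C ((omegaMinus B e w w₁ / (2 * B x x)) • Lt)
        - cst (omegaMinus B e w w₁) * Polynomial.X ^ 2
        + cst (z * omegaMinus B e w w₁)) ∧
    -- consequences
    IsEnergyMomentum W br L ∧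
    (∀ b ∈ gradeZeroCentralizer F x f, IsPrimary br L 1 (φ b)) ∧
    (∀ w ∈ grade F x (-1 / 2), IsPrimary br L (3 / 2) (ψ w)) := by
  intro W br L φ ψ Lt
  have M0 := isMinimalGrading hBnondeg hBsymm hBinv hdeg hsl2 hf.exists_lie_lie_eq_smul
  have M := dualBases M0 a a' haa' v v' hvv' c c' hcc'
  have hL : L ∈ W := M.genL_mem z hdeg
  have hφ : ∀ b ∈ gradeZeroCentralizer F x f, φ b ∈ W := fun b hb => M.genPhi_mem z hdeg hb
  have hψ : ∀ w ∈ grade F x (-1 / 2), ψ w ∈ W := fun w hw => M.genPsi_mem z hdeg hw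
  have hbr : ∀ {g h : DiffPoly J F}, g ∈ W → h ∈ W → br g h = _ := fun hg hh =>
    M.rhoBracket_eq_retract hdeg hvv' hg hh
  have hLφ : ∀ b ∈ gradeZeroCentralizer F x f, br L (φ b) = derLam 1 1 (φ b) := fun b hb =>
    (hbr hL (hφ b hb)).trans (M.retract_L_phi hdeg hb)
  have hLψ : ∀ w ∈ grade F x (-1 / 2), br L (ψ w) = derLam 1 (3 / 2) (ψ w) := fun w hw =>
    (hbr hL (hψ w hw)).trans (M.retract_L_psi hdeg hw)
  exact ⟨⟨hL, hφ, hψ, M.adjoin_genSet_eq z hdeg hvv'⟩,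
    (hbr hL hL).trans (M.retract_L_L hdeg), hLφ, hLψ,
    fun b hb => (hbr (hφ b hb) hL).trans (M.retract_phi_L hdeg hb),
    fun b hb b₁ hb₁ => (hbr (hφ b hb) (hφ b₁ hb₁)).trans (M.retract_phi_phi hdeg hb hb₁),
    fun b hb w hw => (hbr (hφ b hb) (hψ w hw)).trans (M.retract_phi_psi hdeg hb hw),
    fun w hw => (hbr (hψ w hw) hL).trans (M.retract_psi_L hdeg hw),
    fun w hw b hb => (hbr (hψ w hw) (hφ b hb)).trans (M.retract_psi_phi hdeg hw hb),
    fun w hw w₁ hw₁ => (hbr (hψ w hw) (hψ w₁ hw₁)).trans (M.retract_psi_psi hdeg hw hw₁),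
    M.isEnergyMomentum hdeg hvv', hLφ, hLψ⟩
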